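/- **Setting.** A strict partition is a sequence $\lambda=(\lambda_1>\lambda_2>\dots>\lambda_{\ell}>0,0,\dots)$ of integers, with length $\ell(\lambda)=\ell$ and weight $|\lambda|=\sum_i\lambda_i$; it is identified with its shifted Young diagram, whose $i$th row consists of the $\lambda_i$ boxes in columns $i,\dots,i+\lambda_i-1$. The content of a box $\square$ in row $i$ and column $j$ is $\mathrm c(\square)=j-i$. Let $\mathbb S_n$ be the set of strict partitions of weight $n$. Write $\mu\nearrow\lambda$ if $\lambda$ is obtained from $\mu$ by adding one box. Let $\kappa(\mu,\lambda)=2$ if $\mu\nearrow\lambda$ and $\ell(\lambda)=\ell(\mu)$, $\kappa(\mu,\lambda)=1$ if $\mu\nearrow\lambda$ and $\ell(\lambda)=\ell(\mu)+1$, and $\kappa(\mu,\lambda)=0$ otherwise. The Schur graph has the strict partitions as vertices and $\kappa(\mu,\lambda)$ oriented edges from $\mu$ to $\lambda$; $\mathsf h(\lambda)$ is the number of oriented paths from $\varnothing$ to $\lambda$ in it. Let $Y(\mu)$ be the set of contents of the boxes that can be removed from $\mu$; for $y\in Y(\mu)$ let $\mu-\square(y)$ be the shifted diagram obtained by removing the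 (unique) such box of content $y$. Fix $\alpha\in(0,\infty)$. For $\lambda\in\mathbb S_n$ put $$M_n(\lambda)=\frac{\mathsf h(\lambda)^2}{n!}\,2^{\ell(\lambda)-n}\cdot\frac{\prod_{\square\in\lambda}\big(\mathrm c(\square)(\mathrm c(\square)+1)+\alpha\big)}{\alpha(\alpha+2)\cdots(\alpha+2n-2)} .$$ For $\lambda\in\mathbb S_n$ and $\nu\in\mathbb S_{n+1}$ put $$p^{\downarrow}(\nu,\lambda)=\frac{\mathsf h(\lambda)}{\mathsf h(\nu)}\kappa(\lambda,\nu),\qquad p^{\uparrow}(\lambda,\nu)=\frac{M_{n+1}(\nu)}{M_n(\lambda)}p^{\downarrow}(\nu,\lambda).$$ Let $T_n$ be the operator on the space $\mathrm{Fun}(\mathbb S_n)$ of real functions on $\mathbb S_n$ (with the supremum norm) given by $$(T_nf)(\lambda)=\sum_{\tilde\lambda\in\mathbb S_n}\sum_{\nu\in\mathbb S_{n+1}}p^{\uparrow}(\lambda,\nu)\,p^{\downarrow}(\nu,\tilde\lambda)\,f(\tilde\lambda).$$ Let $\Omega_+=\{x\in[0,1]^\infty: x_1\ge x_2\ge\dots\ge0,\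 \sum_i x_i\le1\}$ with the product topology, and let $\pi_n\colon C(\Omega_+)\to\mathrm{Fun}(\mathbb S_n)$, $(\pi_nf)(\lambda)=f(\lambda_1/n,\lambda_2/n,\dots)$. Let $\mathsf q_{2k}(x)=\sum_i x_i^{2k+1}$ for $k\ge1$, let $\mathsf q_0=1$, and let $\mathcal F=\mathbb R[\mathsf q_2,\mathsf q_4,\mathsf q_6,\dots]\subset C(\Omega_+)$ be the subalgebra generated by $\mathsf q_2,\mathsf q_4,\dots$. Let $\Gamma=\mathbb R[p_1,p_3,p_5,\dots]$ be the algebra freely generated by the odd power sums $p_{2m-1}=\sum_i y_i^{2m-1}$, and let $\phi\mapsto\phi^\circ$ be the algebra homomorphism $\Gamma\to\mathcal F$ with $p_1^\circ=1$ and $p_{2m+1}^\circ=\mathsf q_{2m}$ for $m\ge1$. Schur's $\mathcal Q$-function $\mathcal Q_\mu$ is the element of $\Gamma$ whose specialization in finitely many variables $y_1,\dots,y_n$ is, with $\ell=\ell(\mu)$, $$\mathcal Q_\mu(y_1,\dots,y_n,0,\dots)=\frac{2^{\ell}}{(n-\ell)!}\sum_{w\in\mathfrak S_n}w\Big(y_1^{\mu_1}\cdots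 y_\ell^{\mu_\ell}\prod_{i\le\ell,\ i<j\le n}\frac{y_i+y_j}{y_i-y_j}\Big)\quad\text{if } n\ge\ell,$$ and $0$ if $n<\ell$, where $w$ permutes the variables. **Proposition 6.8.** For every strict partition $\mu$ the element $\mathcal Q_\mu\in\Gamma$ exists, and the images $\mathcal Q_\mu^\circ$ span $\mathcal F$. There is a linear operator $A\colon\mathcal F\to\mathcal F$ such that for every $f\in\mathcal F$ $$\lim_{n\to\infty}\big\|\,\pi_n(Af)-n^2(T_n-\mathbf 1)\pi_nf\,\big\|=0,$$ and this operator can be written in each of the two following ways. (1) As a formal differential operator in $\mathsf q_2,\mathsf q_4,\dots$: $$A=\sum_{i,j=1}^{\infty}(2i+1)(2j+1)\left(\mathsf q_{2i+2j}-\mathsf q_{2i}\mathsf q_{2j}\right)\frac{\partial^2}{\partial\mathsf q_{2i}\partial\mathsf q_{2j}}+2\sum_{i,j=0}^{\infty}(2i+2j+3)\,\mathsf q_{2i}\mathsf q_{2j}\frac{\partial}{\partial\mathsf q_{2i+2j+2}}-\sum_{i=1}^{\infty}(2i+1)\left(2i+\frac\alpha2\right)\mathsf q_{2i}\frac{\partial}{\partial\mathsf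 q_{2i}},$$ that is, for every polynomial $P$, the value of $A$ at $P(\mathsf q_2,\mathsf q_4,\dots)$ is obtained by applying this operator to $P$ formally and then substituting the functions $\mathsf q_{2k}$. (2) For every strict partition $\mu$, $$A\mathcal Q_\mu^\circ=-|\mu|\left(|\mu|+\frac\alpha2-1\right)\mathcal Q_\mu^\circ+\sum_{y\in Y(\mu)}\big(y(y+1)+\alpha\big)\mathcal Q_{\mu-\square(y)}^\circ .$$ -/

import Mathlib

open Filter Topology

/-- A strict partition `l₁ > l₂ > … > l_ℓ > 0 = 0 = …`, stored as the finitely supported sequence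
`row 0 = l₁`, `row 1 = l₂`, … of its terms: every nonzero term is strictly smaller than all the
terms before it (in particular zeros are followed by zeros only). -/
@[ext]
structure StrictPartition where
  row : ℕ →₀ ℕ
  strict : ∀ i j, i < j → 0 < row j → row j < row i

namespace StrictPartition

/-- The weight `|l| = ∑ lᵢ`. -/
def weight (l : StrictPartition) : ℕ := ∑ i ∈ l.row.support, l.row i

/-- The length `ℓ(l)`, i.e. the number of nonzero terms. -/
def length (l : StrictPartition) : ℕ := l.row.support.card

/-- The shifted Young diagram of `l`, as its set of boxes `(row number, column number)`, both
counted from `0`. Row `i` has `lᵢ` boxes and starts in column `i`. -/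
def boxes (l : StrictPartition) : Finset (ℕ × ℕ) :=
  l.row.support.biUnion fun i => (Finset.Ico i (i + l.row i)).image fun j => (i, j)

theorem mem_boxes (l : StrictPartition) (b : ℕ × ℕ) :
    b ∈ l.boxes ↔ b.1 ≤ b.2 ∧ b.2 < b.1 + l.row b.1 := by
  obtain ⟨i, j⟩ := b
  simp only [boxes, Finset.mem_biUnion, Finsupp.mem_support_iff, Finset.mem_image,
    Finset.mem_Ico, Prod.mk.injEq]
  constructor
  · rintro ⟨a, -, c, h, rfl, rfl⟩
    exact h
  · rintro ⟨h₁, h₂⟩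
    exact ⟨i, by omega, j, ⟨h₁, h₂⟩, rfl, rfl⟩

theorem boxes_injective : Function.Injective boxes := by
  intro l m h
  ext i
  have key : ∀ k, k < l.row i ↔ k < m.row i := fun k => by
    have h₁ := l.mem_boxes (i, i + k)
    have h₂ := m.mem_boxes (i, i + k)
    rw [h] at h₁
    simpa using h₁.symm.trans h₂
  exact le_antisymm (by by_contra hc; exact absurd ((key _).1 (not_le.1 hc)) (lt_irrefl _))
    (by by_contra hc; exact absurd ((key _).2 (not_le.1 hc)) (lt_irrefl _))

/-- The content `c(□) = j - i` of the box in row `i` and column `j`. -/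
def content (b : ℕ × ℕ) : ℤ := (b.2 : ℤ) - (b.1 : ℤ)

/-- The diagram `l` is obtained from the diagram `m` by adding the single box `b`. -/
def AddsBox (m : StrictPartition) (b : ℕ × ℕ) (l : StrictPartition) : Prop :=
  b ∉ m.boxes ∧ l.boxes = insert b m.boxes

/-- `m ↗ l`. -/
def Up (m l : StrictPartition) : Prop := ∃ b, m.AddsBox b l

open Classical in
/-- The edge multiplicity `κ(m, l)` of the Schur graph. -/
noncomputable def kappa (m l : StrictPartition) : ℕ :=
  if m.Up l ∧ l.length = m.length then 2
  else if m.Up l ∧ l.length = m.length + 1 then 1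
  else 0

/-- The Schur graph: vertices are the shifted Young diagrams, and there are `κ(m, l)` oriented edges
from `m` to `l`. -/
noncomputable instance schurGraph : Quiver StrictPartition where
  Hom m l := Fin (kappa m l)

/-- The empty partition. -/
def empty : StrictPartition where
  row := 0
  strict := by simp

/-- `h(l)`: the number of oriented paths from `∅` to `l` in the Schur graph. -/
noncomputable def numPaths (l : StrictPartition) : ℕ := Nat.card (Quiver.Path empty l)

/-- `Y(l)`: the set of contents of all boxes that can be removed from `l`. -/
noncomputable def removable (l : StrictPartition) : Finset ℤ :=
  open Classical in (l.boxes.filter fun b => ∃ m, AddsBox m b l).image content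

open Classical in
/-- `l - □(y)`: the shifted diagram that `l` becomes when the box of content `y ∈ Y(l)` is removed
(by convention it is `l` itself if there is no such box). -/
noncomputable def removeBox (l : StrictPartition) (y : ℤ) : StrictPartition :=
  if h : ∃ m, ∃ b, AddsBox m b l ∧ content b = y then h.choose else l

theorem AddsBox.row_eq {m l : StrictPartition} {b : ℕ × ℕ} (h : m.AddsBox b l) :
    b.1 ≤ b.2 ∧ b.2 + 1 = b.1 + l.row b.1 := by
  have hb : b ∈ l.boxes := by rw [h.2]; exact Finset.mem_insert_self _ _
  rw [mem_boxes] at hb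
  refine ⟨hb.1, ?_⟩
  by_contra hne
  have h' : ((b.1, b.2 + 1) : ℕ × ℕ) ∈ l.boxes := by
    rw [mem_boxes]; exact ⟨by simp only; omega, by simp only; omega⟩
  rw [h.2, Finset.mem_insert] at h'
  rcases h' with h' | h'
  · have := congrArg Prod.snd h'
    simp at this
  · apply h.1
    rw [mem_boxes] at h' ⊢
    simp only at h'
    omega

/-- The diagram `l - □(y)` is unique. -/
theorem AddsBox.removeBox_eq {m l : StrictPartition} {b : ℕ × ℕ} (h : m.AddsBox b l) :
    l.removeBox (content b) = m := by
  have hex : ∃ m', ∃ b', AddsBox m' b' l ∧ content b' = content b := ⟨m, b, h, rfl⟩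
  rw [removeBox, dif_pos hex]
  obtain ⟨b', h', hc⟩ := hex.choose_spec
  have e := h.row_eq
  have e' := h'.row_eq
  simp only [content] at hc
  have h1 : b'.1 = b.1 := by
    rcases lt_trichotomy b'.1 b.1 with hlt | heq | hlt
    · have := l.strict _ _ hlt (by omega)
      omega
    · exact heq
    · have := l.strict _ _ hlt (by omega)
      omega
  have hbb : b' = b := Prod.ext h1 (by omega)
  rw [hbb] at h'
  apply boxes_injective
  rw [← Finset.erase_insert h'.1, ← Finset.erase_insert h.1, ← h'.2, ← h.2]

/-- `𝕊ₙ`, the set of strict partitions of weight `n`. -/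
def Level (n : ℕ) : Type := {l : StrictPartition // l.weight = n}

theorem row_le_weight (l : StrictPartition) (i : ℕ) : l.row i ≤ l.weight := by
  by_cases h : i ∈ l.row.support
  · exact Finset.single_le_sum (f := fun i => l.row i) (fun _ _ => Nat.zero_le _) h
  · rw [Finsupp.notMem_support_iff.1 h]; exact Nat.zero_le _

theorem lt_weight_of_row_ne_zero (l : StrictPartition) {i : ℕ} (h : l.row i ≠ 0) :
    i < l.weight := by
  have hsub : Finset.range (i + 1) ⊆ l.row.support := by
    intro k hk
    rw [Finsupp.mem_support_iff]
    rcases Nat.lt_or_ge k i with hlt | hge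
    · have := l.strict k i hlt (Nat.pos_of_ne_zero h)
      omega
    · have : k = i := by have := Finset.mem_range.1 hk; omega
      rwa [this]
  have h1 : l.row.support.card • 1 ≤ l.weight :=
    Finset.card_nsmul_le_sum _ _ _ fun k hk =>
      Nat.one_le_iff_ne_zero.2 (Finsupp.mem_support_iff.1 hk)
  have h2 := Finset.card_le_card hsub
  simp only [Finset.card_range, smul_eq_mul, mul_one] at h1 h2
  omega

instance (n : ℕ) : Finite (Level n) := by
  let F : Level n → Fin n → Fin (n + 1) := fun l i =>
    ⟨l.1.row i, Nat.lt_succ_of_le ((l.1.row_le_weight i).trans_eq l.2)⟩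
  refine Finite.of_injective F fun l m h => ?_
  apply Subtype.ext
  ext i
  by_cases hi : i < n
  · have := congrArg Fin.val (congrFun h ⟨i, hi⟩)
    exact this
  · have hl : l.1.row i = 0 := by
      by_contra hc; exact hi ((l.1.lt_weight_of_row_ne_zero hc).trans_eq l.2)
    have hm : m.1.row i = 0 := by
      by_contra hc; exact hi ((m.1.lt_weight_of_row_ne_zero hc).trans_eq m.2)
    rw [hl, hm]

noncomputable instance (n : ℕ) : Fintype (Level n) := Fintype.ofFinite _

/-- The down transition function `p↓(l, m) = h(m) κ(m, l) / h(l)`. -/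
noncomputable def pDown (l m : StrictPartition) : ℝ :=
  (numPaths m : ℝ) / (numPaths l : ℝ) * (kappa m l : ℝ)

/-- The Plancherel measure `Plₙ(l) = h(l)² 2^{ℓ(l) - n} / n!`, where `n = |l|`. -/
noncomputable def plancherel (l : StrictPartition) : ℝ :=
  (numPaths l : ℝ) ^ 2 / (l.weight.factorial : ℝ) * (2 : ℝ) ^ ((l.length : ℤ) - (l.weight : ℤ))

/-- `Z_α(n) = α (α + 2) ⋯ (α + 2n - 2)`. -/
noncomputable def multZ (α : ℝ) (n : ℕ) : ℝ := ∏ i ∈ Finset.range n, (α + 2 * (i : ℝ))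

/-- The multiplicative measure `Mₙ^α(l) = Plₙ(l) · Z_α(n)⁻¹ · ∏_{□ ∈ l} (c(□)(c(□) + 1) + α)`,
where `n = |l|`. -/
noncomputable def multMeasure (α : ℝ) (l : StrictPartition) : ℝ :=
  plancherel l * (1 / multZ α l.weight) *
    ∏ b ∈ l.boxes, ((content b : ℝ) * ((content b : ℝ) + 1) + α)

/-- The up transition function of the multiplicative measures. -/
noncomputable def pUp (α : ℝ) (l v : StrictPartition) : ℝ :=
  multMeasure α v / multMeasure α l * pDown v l

/-- The transition matrix of the `n`th up/down Markov chain. -/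
noncomputable def transMatrix (α : ℝ) (n : ℕ) : Matrix (Level n) (Level n) ℝ :=
  fun l l' => ∑ v : Level (n + 1), pUp α l.1 v.1 * pDown v.1 l'.1

/-- The transition operator `Tₙ` on functions, `(Tₙ f)(l) = ∑_{l'} Tₙ(l, l') f(l')`. -/
noncomputable def transOp (α : ℝ) (n : ℕ) : Module.End ℝ (Level n → ℝ) :=
  (transMatrix α n).mulVecLin

end StrictPartition

/-- Convergence of a sequence `gₙ ∈ Lₙ` to `f ∈ L` along maps `πₙ : L → Lₙ`:
`‖πₙ f - gₙ‖ → 0`. -/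
def ConvergesAlong {L : Type*} {Ln : ℕ → Type*} [∀ n, NormedAddCommGroup (Ln n)]
    (π : ∀ n, L → Ln n) (g : ∀ n, Ln n) (f : L) : Prop :=
  Tendsto (fun n => ‖π n f - g n‖) atTop (𝓝 0)

/-- The simplex `Ω₊` of sequences `x₁ ≥ x₂ ≥ … ≥ 0` in `[0,1]^∞` with `∑ xᵢ ≤ 1`, with the product
topology. -/
def OmegaPlus : Type :=
  {x : ℕ → ℝ // (∀ i, 0 ≤ x i ∧ x i ≤ 1) ∧ Antitone x ∧ Summable x ∧ ∑' i, x i ≤ 1}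

namespace OmegaPlus

open StrictPartition

instance : TopologicalSpace OmegaPlus := instTopologicalSpaceSubtype

/-- The embedding `ιₙ : 𝕊ₙ → Ω₊`, `l ↦ (l₁/n, l₂/n, …)`. -/
noncomputable def iota (n : ℕ) (l : Level n) : OmegaPlus :=
  ⟨fun i => (l.1.row i : ℝ) / (n : ℝ), by
    have hs : HasSum (fun i => (l.1.row i : ℝ) / (n : ℝ)) ((n : ℝ) / (n : ℝ)) := by
      have h : HasSum (fun i => (l.1.row i : ℝ) / (n : ℝ))
          (∑ i ∈ l.1.row.support, (l.1.row i : ℝ) / (n : ℝ)) :=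
        hasSum_sum_of_ne_finset_zero
          (fun i hi => by rw [Finsupp.notMem_support_iff.1 hi]; simp)
      rw [← Finset.sum_div] at h
      have e : ∑ i ∈ l.1.row.support, (l.1.row i : ℝ) = (n : ℝ) := by
        exact_mod_cast l.2
      rwa [e] at h
    refine ⟨fun i => ⟨by positivity, ?_⟩, ?_, hs.summable, ?_⟩
    · apply div_le_one_of_le₀ _ (Nat.cast_nonneg n)
      exact_mod_cast (l.1.row_le_weight i).trans_eq l.2
    · intro i j hij
      apply div_le_div_of_nonneg_right _ (Nat.cast_nonneg n)
      rcases Nat.eq_zero_or_pos (l.1.row j) with h0 | hpos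
      · rw [h0]; simp
      · rcases hij.lt_or_eq with hlt | rfl
        · exact_mod_cast (l.1.strict i j hlt hpos).le
        · exact le_rfl
    · rw [hs.tsum_eq]; exact div_self_le_one _⟩

/-- `πₙ : C(Ω₊) → Fun(𝕊ₙ)`, `(πₙ f)(l) = f(ιₙ(l))`. -/
noncomputable def proj (n : ℕ) (f : C(OmegaPlus, ℝ)) : Level n → ℝ := fun l => f (iota n l)

theorem apply_le (x : OmegaPlus) (i : ℕ) : x.1 i ≤ 1 / ((i : ℝ) + 1) := by
  obtain ⟨x, h01, hanti, hsum, hle⟩ := x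
  simp only
  have h1 : ∑ k ∈ Finset.range (i + 1), x k ≤ 1 :=
    (hsum.sum_le_tsum _ fun k _ => (h01 k).1).trans hle
  have h2 : (Finset.range (i + 1)).card • x i ≤ ∑ k ∈ Finset.range (i + 1), x k :=
    Finset.card_nsmul_le_sum _ _ _ fun k hk =>
      hanti (Nat.lt_succ_iff.1 (Finset.mem_range.1 hk))
  rw [Finset.card_range, nsmul_eq_mul] at h2
  push_cast at h2
  rw [le_div_iff₀ (by positivity)]
  linarith

/-- The moment coordinate `q_k(x) = ∑ xᵢ^{k+1}`, `k ≥ 1`, a continuous function on `Ω₊`. -/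
noncomputable def moment (k : ℕ+) : C(OmegaPlus, ℝ) where
  toFun x := ∑' i, x.1 i ^ ((k : ℕ) + 1)
  continuous_toFun := by
    have hs : Summable fun i : ℕ => 1 / ((i : ℝ) + 1) ^ 2 := by
      have := (summable_nat_add_iff 1).2 (Real.summable_one_div_nat_pow.2 (one_lt_two))
      simpa using this
    refine continuous_tsum (u := fun i : ℕ => 1 / ((i : ℝ) + 1) ^ 2) (fun i => ?_) hs ?_
    · exact ((continuous_apply i).comp continuous_subtype_val).pow _
    · intro i x
      have h0 := (x.2.1 i).1
      have h1 := (x.2.1 i).2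
      rw [Real.norm_of_nonneg (pow_nonneg h0 _)]
      calc x.1 i ^ ((k : ℕ) + 1) ≤ x.1 i ^ 2 :=
            pow_le_pow_of_le_one h0 h1 (by have := k.pos; omega)
        _ ≤ (1 / ((i : ℝ) + 1)) ^ 2 := pow_le_pow_left₀ h0 (x.apply_le i) 2
        _ = 1 / ((i : ℝ) + 1) ^ 2 := by rw [div_pow, one_pow]

/-- `𝓕 = ℝ[q₂, q₄, q₆, …] ⊂ C(Ω₊)`. -/
noncomputable def momentAlgebra : Subalgebra ℝ C(OmegaPlus, ℝ) :=
  Algebra.adjoin ℝ (Set.range fun k : ℕ+ => moment (2 * k))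

/-- The element `q_{2k}` of `𝓕`, where `q₀ = 1` by agreement. -/
noncomputable def evenMoment (k : ℕ) : momentAlgebra :=
  if h : 0 < k then
    ⟨moment (2 * ⟨k, h⟩), Algebra.subset_adjoin ⟨⟨k, h⟩, rfl⟩⟩
  else 1

end OmegaPlus

/-! Formal differential operators in the variables `q₂, q₄, q₆, …`; the variable `q_{2k}` is
`MvPolynomial.X k`, `k : ℕ+`. -/

namespace FormalGenerator

open MvPolynomial

/-- The variable `q_{2k}`, where `q₀ = 1` by agreement. -/
noncomputable def qVar (k : ℕ) : MvPolynomial ℕ+ ℝ := if h : 0 < k then X ⟨k, h⟩ else 1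

/-- The formal differential operator
`∑_{i,j ≥ 1} (2i+1)(2j+1)(q_{2i+2j} - q_{2i} q_{2j}) ∂²/∂q_{2i}∂q_{2j}
  + 2 ∑_{i,j ≥ 0} (2i+2j+3) q_{2i} q_{2j} ∂/∂q_{2i+2j+2}
  - ∑_{i ≥ 1} (2i+1)(2i+α/2) q_{2i} ∂/∂q_{2i}`.
All but finitely many terms vanish on a given polynomial. -/
noncomputable def op (α : ℝ) (P : MvPolynomial ℕ+ ℝ) : MvPolynomial ℕ+ ℝ :=
  (∑ᶠ ij : ℕ+ × ℕ+, C ((2 * (ij.1 : ℝ) + 1) * (2 * (ij.2 : ℝ) + 1)) *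
      (qVar ((ij.1 : ℕ) + (ij.2 : ℕ)) - qVar ij.1 * qVar ij.2) *
        pderiv ij.1 (pderiv ij.2 P))
  + 2 * (∑ᶠ ij : ℕ × ℕ, C (2 * (ij.1 : ℝ) + 2 * (ij.2 : ℝ) + 3) *
      (qVar ij.1 * qVar ij.2) * pderiv (ij.1 + ij.2).succPNat P)
  - ∑ᶠ i : ℕ+, C ((2 * (i : ℝ) + 1) * (2 * (i : ℝ) + α / 2)) * qVar i * pderiv i P

/-- Only finitely many of the formal partial derivatives of a polynomial are nonzero. -/
theorem finite_pderiv_ne_zero (P : MvPolynomial ℕ+ ℝ) : {i | pderiv i P ≠ 0}.Finite :=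
  P.vars.finite_toSet.subset fun i hi => by
    by_contra h
    exact hi (pderiv_eq_zero_of_notMem_vars h)

end FormalGenerator

/-! Doubly symmetric functions. -/

namespace DoublySymmetric

open MvPolynomial StrictPartition

/-- The algebra `Γ = ℝ[p₁, p₃, p₅, …]` of doubly symmetric functions, freely generated by the odd
Newton power sums; `p_{2m+1}` is `MvPolynomial.X m`, `m : ℕ`. -/
abbrev Gam : Type := MvPolynomial ℕ ℝ

/-- The value of a doubly symmetric function at `(y₁, …, yₙ, 0, 0, …)`; it is determined by
`p_{2m+1} ↦ ∑ yᵢ^{2m+1}`. -/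
noncomputable def specialize {K : Type*} [Field K] [Algebra ℝ K] {n : ℕ} (y : Fin n → K) :
    Gam →ₐ[ℝ] K :=
  aeval fun m : ℕ => ∑ i, y i ^ (2 * m + 1)

/-- `R_{l|n}(y₁, …, yₙ)`, that is,
`y₁^{l₁} ⋯ y_ℓ^{l_ℓ} ∏_{i ≤ ℓ(l), i < j ≤ n} (yᵢ + yⱼ) / (yᵢ - yⱼ)`. -/
noncomputable def schurR {K : Type*} [Field K] (l : StrictPartition) {n : ℕ} (y : Fin n → K) : K :=
  (∏ i : Fin n, y i ^ l.row i) *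
    ∏ i : Fin n, ∏ j : Fin n,
      if (i : ℕ) < l.length ∧ i < j then (y i + y j) / (y i - y j) else 1

/-- `Q_l(y₁, …, yₙ, 0, …) = 2^ℓ / (n - ℓ)! · ∑_{w ∈ 𝔖ₙ} R_{l|n}(y_{w(1)}, …, y_{w(n)})` if
`n ≥ ℓ = ℓ(l)`, and `0` otherwise. -/
noncomputable def schurQFinite {K : Type*} [Field K] (l : StrictPartition) {n : ℕ}
    (y : Fin n → K) : K :=
  if l.length ≤ n then
    2 ^ l.length / ((n - l.length).factorial : K) *
      ∑ w : Equiv.Perm (Fin n), schurR l fun i => y (w i)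
  else 0

/-- The `n` formal variables `y₁, …, yₙ` in the field of rational functions. -/
noncomputable def formalVar (n : ℕ) (i : Fin n) : FractionRing (MvPolynomial (Fin n) ℝ) :=
  algebraMap (MvPolynomial (Fin n) ℝ) _ (X i)

/-- The doubly symmetric function `g` is Schur's `Q`-function of the strict partition `l`: for every
`n`, its specialization in the formal variables `y₁, …, yₙ` is the symmetrization above. -/
def IsSchurQ (l : StrictPartition) (g : Gam) : Prop :=
  ∀ n : ℕ, specialize (formalVar n) g = schurQFinite l (formalVar n)

open Classical in
/-- Schur's `Q`-function `Q_l ∈ Γ`. -/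
noncomputable def schurQ (l : StrictPartition) : Gam :=
  if h : ∃ g, IsSchurQ l g then h.choose else 0

/-- The homomorphism `φ ↦ φ°` from `Γ` to `𝓕 ⊂ C(Ω₊)`: `p₁° = 1` and `p_{2m+1}° = q_{2m}` for
`m ≥ 1`. -/
noncomputable def circ : Gam →ₐ[ℝ] OmegaPlus.momentAlgebra :=
  aeval fun m : ℕ => OmegaPlus.evenMoment m

end DoublySymmetric

/-! ### Lagrange interpolation and residue sums. -/

section Lagrange

/-! The proof realizes every $Q$-function by vertex operators. Let $q_m$ be the one-row functions,
with generating series $\prod_i (1+y_it)/(1-y_it)$. For a polynomial $\varphi$, the operator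
`vertexOp φ` replaces each $p_k$ in $g$ by $p_k-T^k$, multiplies by $\varphi(T)$ and then replaces
$T^m$ by $q_m$. If $\varphi(0)=0$, its value in finitely many variables is
$2\sum_i\varphi(y_i)\prod_{j\ne i}\frac{y_i+y_j}{y_i-y_j}\,g(y\setminus y_i)$ (`evalOn_vertexOp`).
Hence iterating $B_r=$ `vertexOp (X ^ r)` on $1$ produces the symmetrization that defines $Q_\mu$,
which gives existence. These operators anticommute for positive indices, so any word in them is $0$
or $\pm Q_\nu$, and a degree induction shows that the $Q_\mu$ span $\Gamma$.

The two forms of the operator are compared in $\Gamma$, before setting $p_1=1$. The second-order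
operator `lowerOp` satisfies $[\Delta,B_r]=r(r-1)B_{r-1}$, while $\partial/\partial p_1$ contributes
$2B_{r-1}$ and the Euler operator contributes $rB_r$. So
$\Delta+\frac\alpha2\partial_{p_1}-E^2-(\frac\alpha2-1)E$ acts on $Q_\mu$ by formula (2)
(`gamOp_schurQ`, `lowerQ_toList`), and at $p_1=1$ it becomes the differential operator (1)
(`op_setOne`). Since $\mathsf q_2,\mathsf q_4,\dots$ are algebraically independent as functions on
the simplex, the formal operator descends to $\mathcal F$.

For the Markov chains, the powers $X^r$ are replaced by falling factorials, which gives
inhomogeneous functions $Q^*_\mu$ with leading part $Q_\mu$. Evaluated at the parts of strict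
partitions they are adapted to both transition functions: the down transition multiplies $Q^*_\mu$
by $(n+1-|\mu|)/(n+1)$, and the up transition gives a multiple of $Q^*_\mu$ plus the $Q^*$ with one
index lowered (`shiftSum_neg_one_factQ`, `raiseSum_factQ`). Both are identities for rational
functions in the parts, proved by induction on the number of vertex operators, with base cases given
by residue sums. The same residue sum yields the hook formula for the number of paths, which makes
the transition probabilities explicit. Thus $(T_n-1)Q^*_\mu$ is known exactly
(`transOp_evalAt_factQ`). Rescaling the parts by $1/n$ and discarding the terms of lower degree, by
induction on $|\mu|$, gives the limit on every $Q_\mu$ (`negligible_schurQ`), and hence on all of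
$\mathcal F$. -/

open Polynomial in
/-- Lagrange interpolation of `∏ (X - bᵢ) - ∏ (X - aᵢ)` at the nodes `aᵢ`. -/
theorem Polynomial.prod_X_sub_C_interpolation {ι K : Type*} [DecidableEq ι] [Field K]
    (I : Finset ι) (a b : ι → K) (ha : Set.InjOn a I) :
    ∏ i ∈ I, (X - C (b i)) = ∏ i ∈ I, (X - C (a i)) +
      ∑ i ∈ I, C ((a i - b i) * ∏ j ∈ I.erase i, ((a i - b j) / (a i - a j))) *
        ∏ j ∈ I.erase i, (X - C (a j)) := by
  rcases I.eq_empty_or_nonempty with rfl | hne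
  · simp
  have hmon : ∀ c : ι → K, (∏ i ∈ I, (X - C (c i))).Monic := fun c =>
    monic_prod_of_monic _ _ fun i _ => monic_X_sub_C _
  have hdeg : ∀ c : ι → K, (∏ i ∈ I, (X - C (c i))).degree = (I.card : WithBot ℕ) := fun c => by
    rw [degree_prod]; simp
  -- The two monic products have the same degree, so their difference has degree below the number of
  -- nodes. Agreement at the nodes then suffices.
  refine eq_of_degree_sub_lt_of_eval_index_eq I ha ?_ ?_
  · rw [← sub_sub]
    refine (degree_sub_le _ _).trans_lt (max_lt ?_ ?_)
    · refine (degree_sub_lt_left ?_ ?_ ?_).trans_eq (hdeg b)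
      · rw [hdeg, hdeg]
      · exact (hmon b).ne_zero
      · rw [(hmon a).leadingCoeff, (hmon b).leadingCoeff]
    · refine (degree_sum_le _ _).trans_lt ((Finset.sup_lt_iff ?_).2 fun i hi => ?_)
      · exact WithBot.bot_lt_coe _
      · refine (degree_mul_le _ _).trans_lt ((add_le_add degree_C_le le_rfl).trans_lt ?_)
        rw [degree_prod, zero_add]
        simp only [degree_X_sub_C, Finset.sum_const, nsmul_eq_mul, mul_one]
        exact_mod_cast Finset.card_erase_lt_of_mem hi
  · intro i hi
    rw [eval_add, eval_finsetSum, eval_prod, eval_prod,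
      Finset.prod_eq_zero (f := fun j => eval (a i) (X - C (a j))) hi (by simp),
      zero_add, Finset.sum_eq_single i]
    · rw [eval_mul, eval_C, eval_prod, mul_assoc, ← Finset.prod_mul_distrib,
        ← Finset.mul_prod_erase _ _ hi]
      simp only [eval_sub, eval_X, eval_C]
      congr 1
      refine Finset.prod_congr rfl fun j hj => ?_
      have : a i - a j ≠ 0 := by
        rw [sub_ne_zero]
        exact fun h => (Finset.ne_of_mem_erase hj) (ha (Finset.mem_of_mem_erase hj) hi h.symm)
      field_simp
    · intro j _ hji
      rw [eval_mul, eval_prod, Finset.prod_eq_zero (f := fun j => eval (a i) (X - C (a j)))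
        (Finset.mem_erase.2 ⟨hji.symm, hi⟩) (by simp), mul_zero]
    · exact fun h => absurd hi h

/-- The sum of the residues of `∏ (x - bᵢ) / (x - aᵢ)`. -/
theorem sum_residues {ι K : Type*} [DecidableEq ι] [Field K]
    (I : Finset ι) (a b : ι → K) (ha : Set.InjOn a I) :
    ∑ i ∈ I, (a i - b i) * ∏ j ∈ I.erase i, ((a i - b j) / (a i - a j)) =
      ∑ i ∈ I, (a i - b i) := by
  rcases I.eq_empty_or_nonempty with rfl | hne
  · simp
  -- The residue sum is the subleading coefficient of the interpolation formula: each product over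
  -- `I.erase i` is monic of degree `I.card - 1`.
  have h := congrArg (fun p => p.coeff (I.card - 1))
    (Polynomial.prod_X_sub_C_interpolation I a b ha)
  simp only [Polynomial.coeff_add, Polynomial.finsetSum_coeff, Polynomial.coeff_C_mul] at h
  rw [Polynomial.prod_X_sub_C_coeff_card_pred _ _ hne.card_pos,
    Polynomial.prod_X_sub_C_coeff_card_pred _ _ hne.card_pos] at h
  have h2 : ∀ i ∈ I, (∏ j ∈ I.erase i, (Polynomial.X - Polynomial.C (a j))).coeff (I.card - 1)
      = 1 := fun i hi => by
    have hm : (∏ j ∈ I.erase i, (Polynomial.X - Polynomial.C (a j))).Monic :=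
      Polynomial.monic_prod_of_monic _ _ fun i _ => Polynomial.monic_X_sub_C _
    have hd : (∏ j ∈ I.erase i, (Polynomial.X - Polynomial.C (a j))).natDegree = I.card - 1 := by
      rw [Polynomial.natDegree_prod_of_monic _ _ fun i _ => Polynomial.monic_X_sub_C _]
      simp [Finset.card_erase_of_mem hi]
    rw [← hd]; exact hm
  have h3 := Finset.sum_congr rfl fun i hi => congrArg
    (fun z => ((a i - b i) * ∏ j ∈ I.erase i, ((a i - b j) / (a i - a j))) * z) (h2 i hi)
  simp only [mul_one] at h3
  rw [Finset.sum_sub_distrib, ← h3]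
  linear_combination -h

/-- Evaluation of the interpolation formula at a point. -/
theorem prod_sub_interpolation {ι K : Type*} [DecidableEq ι] [Field K]
    (I : Finset ι) (a b : ι → K) (ha : Set.InjOn a I) (x : K) :
    ∏ i ∈ I, (x - b i) = ∏ i ∈ I, (x - a i) +
      ∑ i ∈ I, (a i - b i) * (∏ j ∈ I.erase i, ((a i - b j) / (a i - a j))) *
        ∏ j ∈ I.erase i, (x - a j) := by
  have h := congrArg (Polynomial.eval x) (Polynomial.prod_X_sub_C_interpolation I a b ha)
  simpa [Polynomial.eval_prod, Polynomial.eval_finsetSum] using h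

end Lagrange

/-! ### One-row $Q$-functions and vertex operators. -/

namespace DoublySymmetric

open MvPolynomial

section RowFunctions

/-- The coefficients of `exp (2 ∑ p_{2k+1} t^{2k+1} / (2k+1))`, defined by Newton's identities. -/
noncomputable def rowQ : ℕ → Gam
  | 0 => 1
  | n + 1 => C (2 / ((n : ℝ) + 1)) *
      ∑ k : Fin (n + 1), if 2 * (k : ℕ) ≤ n then X (k : ℕ) * rowQ (n - 2 * (k : ℕ)) else 0
termination_by n => n

/-- The extension of `rowQ` by zero to negative indices. -/
noncomputable def rowQZ (n : ℤ) : Gam := if 0 ≤ n then rowQ n.toNat else 0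

@[simp] theorem rowQ_zero : rowQ 0 = 1 := by rw [rowQ]

@[simp] theorem rowQZ_natCast (n : ℕ) : rowQZ (n : ℤ) = rowQ n := by simp [rowQZ]

theorem rowQZ_of_neg {n : ℤ} (h : n < 0) : rowQZ n = 0 := by rw [rowQZ, if_neg (by omega)]

/-- Newton's identities. -/
theorem rowQZ_newton (n : ℤ) (N : ℕ) (hN : n ≤ 2 * N) :
    C (n : ℝ) * rowQZ n = 2 * ∑ k ∈ Finset.range N, X k * rowQZ (n - 2 * k - 1) := by
  rcases lt_or_ge n 0 with h | h
  · rw [rowQZ_of_neg h, mul_zero, Finset.sum_eq_zero, mul_zero]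
    intro k _
    rw [rowQZ_of_neg (by omega), mul_zero]
  obtain ⟨m, rfl⟩ := Int.eq_ofNat_of_zero_le h
  cases m with
  | zero =>
    rw [Finset.sum_eq_zero]
    · simp
    · intro k _
      rw [rowQZ_of_neg (by omega), mul_zero]
  | succ m =>
    rw [rowQZ_natCast, rowQ, ← mul_assoc, ← C_mul]
    have : ((((m + 1 : ℕ) : ℤ) : ℝ)) * (2 / ((m : ℝ) + 1)) = 2 := by
      push_cast; field_simp
    rw [this]
    have hC : (C (2 : ℝ) : Gam) = 2 := map_ofNat C 2
    rw [hC]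
    congr 1
    rw [Finset.sum_fin_eq_sum_range]
    have hterm : ∀ k : ℕ, X k * rowQZ (((m + 1 : ℕ) : ℤ) - 2 * k - 1) =
        if 2 * k ≤ m then X k * rowQ (m - 2 * k) else 0 := fun k => by
      split_ifs with hk
      · rw [show (((m + 1 : ℕ) : ℤ) - 2 * k - 1) = ((m - 2 * k : ℕ) : ℤ) by push_cast [hk]; ring,
          rowQZ_natCast]
      · rw [rowQZ_of_neg (by push_cast; omega), mul_zero]
    simp only [hterm]
    have h0 : ∀ k, ¬ 2 * k ≤ m → (if 2 * k ≤ m then X k * rowQ (m - 2 * k) else 0 : Gam) = 0 :=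
      fun k hk => if_neg hk
    trans ∑ k ∈ Finset.range (m + N + 1),
      (if 2 * k ≤ m then X k * rowQ (m - 2 * k) else 0 : Gam)
    · rw [← Finset.sum_subset (Finset.range_subset_range.2 (show m + 1 ≤ m + N + 1 by omega))]
      · exact Finset.sum_congr rfl fun k hk => by rw [dif_pos (Finset.mem_range.1 hk)]
      · intro k _ hk
        exact h0 k (by simp at hk; omega)
    · refine (Finset.sum_subset (Finset.range_subset_range.2 (by omega)) ?_).symm
      intro k _ hk
      exact h0 k (by simp at hk; push_cast at hN; omega)

/-- Newton's identities for the coefficients of a power series with logarithmic derivative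
`2 ∑ x_k t^{2k}`. -/
theorem aeval_rowQ_of_newton {K : Type*} [Field K] [Algebra ℝ K] (x : ℕ → K) (c : ℕ → K)
    (h0 : c 0 = 1)
    (h : ∀ n : ℕ, ((n : K) + 1) * c (n + 1) =
      ∑ k ∈ Finset.range (n + 1), if 2 * k ≤ n then 2 * x k * c (n - 2 * k) else 0) (m : ℕ) :
    aeval x (rowQ m) = c m := by
  have : CharZero K := charZero_of_injective_algebraMap (algebraMap ℝ K).injective
  induction m using Nat.strong_induction_on with
  | _ m ih =>
    cases m with
    | zero => simp [h0]
    | succ n =>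
      have hn : (n : K) + 1 ≠ 0 := by exact_mod_cast Nat.succ_ne_zero n
      rw [rowQ, map_mul, aeval_C, map_sum, Finset.sum_fin_eq_sum_range]
      apply mul_left_cancel₀ hn
      rw [h n, ← mul_assoc, map_div₀]
      simp only [map_add, map_natCast, map_one, map_ofNat]
      rw [mul_div_cancel₀ _ hn, Finset.mul_sum]
      refine Finset.sum_congr rfl fun k hk => ?_
      rw [dif_pos (Finset.mem_range.1 hk)]
      split_ifs with hk'
      · rw [map_mul, aeval_X, ih _ (by omega), mul_assoc]
      · simp

end RowFunctions

section Cayley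

variable {K : Type*} [Field K]

/-- The power series `(1 + a t) / (1 - a t)`. -/
noncomputable def cayleySeries (a : K) : PowerSeries K :=
  PowerSeries.mk fun n => if n = 0 then 1 else 2 * a ^ n

theorem one_sub_mul_cayleySeries (a : K) :
    (1 - PowerSeries.C a * PowerSeries.X) * cayleySeries a =
      1 + PowerSeries.C a * PowerSeries.X := by
  ext n
  rw [sub_mul, one_mul, mul_assoc, map_sub, PowerSeries.coeff_C_mul]
  cases n with
  | zero => simp [cayleySeries]
  | succ n =>
    rw [PowerSeries.coeff_succ_X_mul, map_add, PowerSeries.coeff_C_mul, PowerSeries.coeff_X]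
    cases n with
    | zero => simp [cayleySeries]; ring
    | succ n => simp [cayleySeries, PowerSeries.coeff_one]; ring

/-- The logarithmic derivative of $(1+at)/(1-at)$ is $2a/(1-a^2t^2)$, in which only even powers of
$t$ occur. This is why only odd power sums enter the one-row functions. The proof clears the
denominators instead of inverting them. -/
theorem derivative_cayleySeries (a : K) :
    PowerSeries.derivative K (cayleySeries a) = cayleySeries a *
      PowerSeries.mk fun n => if Even n then 2 * a ^ (n + 1) else 0 := by
  set G : PowerSeries K := PowerSeries.mk fun n => if Even n then 2 * a ^ (n + 1) else 0
  set u : PowerSeries K := PowerSeries.C a * PowerSeries.X with hu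
  have h1 := one_sub_mul_cayleySeries a
  rw [← hu] at h1
  have hG : (1 - u) * (1 + u) * G = PowerSeries.C (2 * a) := by
    have : (1 - u) * (1 + u) = 1 - PowerSeries.C (a ^ 2) * (PowerSeries.X * PowerSeries.X) := by
      rw [hu, map_pow]; ring
    rw [this, sub_mul, one_mul]
    ext n
    rw [map_sub, mul_assoc, PowerSeries.coeff_C_mul, mul_assoc]
    match n with
    | 0 => simp [G]
    | 1 => simp [G, PowerSeries.coeff_succ_X_mul, Nat.even_add_one]
    | n + 2 =>
      rw [PowerSeries.coeff_succ_X_mul, PowerSeries.coeff_succ_X_mul, PowerSeries.coeff_C,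
        if_neg (by omega)]
      simp only [G, PowerSeries.coeff_mk, Nat.even_add_one, not_not]
      split_ifs <;> ring
  have h2 : (1 - u) * PowerSeries.derivative K (cayleySeries a) =
      PowerSeries.C a * (1 + cayleySeries a) := by
    have := congrArg (PowerSeries.derivative K) h1
    have hdu : PowerSeries.derivative K u = PowerSeries.C a := by
      rw [hu, Derivation.leibniz, PowerSeries.derivative_X, PowerSeries.derivative_C]; simp
    rw [Derivation.leibniz] at this
    simp only [map_sub, map_add, Derivation.map_one_eq_zero, smul_eq_mul, zero_add,
      zero_sub, hdu] at this
    linear_combination this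
  have hne1 : (1 - u) ≠ 0 := fun h => by
    have := congrArg (PowerSeries.constantCoeff (R := K)) h
    simp [hu] at this
  have hne2 : (1 + u) ≠ 0 := fun h => by
    have := congrArg (PowerSeries.constantCoeff (R := K)) h
    simp [hu] at this
  apply mul_left_cancel₀ (mul_ne_zero (mul_ne_zero hne1 hne1) hne2)
  have h2' : PowerSeries.C (2 * a) = 2 * PowerSeries.C a := by rw [two_mul, two_mul, map_add]
  rw [h2'] at hG
  linear_combination (1 - u) * (1 + u) * h2 + (PowerSeries.C a * (1 + u)) * h1
    - (1 - u) * cayleySeries a * hG - 2 * PowerSeries.C a * h1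

end Cayley

section Evaluation

variable {ι K : Type*} [DecidableEq ι] [Field K] [Algebra ℝ K]

/-- The value of a doubly symmetric function at the variables `yᵢ`, `i ∈ I`. -/
noncomputable def evalOn (I : Finset ι) (y : ι → K) : Gam →ₐ[ℝ] K :=
  aeval fun m : ℕ => ∑ i ∈ I, y i ^ (2 * m + 1)

/-- `∏_{j ≠ i} (yᵢ + yⱼ) / (yᵢ - yⱼ)` -/
noncomputable def pairFactor (I : Finset ι) (y : ι → K) (i : ι) : K :=
  ∏ j ∈ I.erase i, (y i + y j) / (y i - y j)

theorem derivative_prod_cayleySeries (I : Finset ι) (y : ι → K) :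
    PowerSeries.derivative K (∏ i ∈ I, cayleySeries (y i)) =
      (∏ i ∈ I, cayleySeries (y i)) *
        ∑ i ∈ I, PowerSeries.mk fun n => if Even n then 2 * y i ^ (n + 1) else 0 := by
  induction I using Finset.induction_on with
  | empty => simp
  | insert a I ha ih =>
    rw [Finset.prod_insert ha, Finset.sum_insert ha, Derivation.leibniz, ih,
      derivative_cayleySeries, smul_eq_mul, smul_eq_mul]
    ring

/-- Logarithmic derivatives add up, so that of the product is $2\sum_k p_{2k+1}t^{2k}$. Comparing
coefficients gives the Newton recursion that defines `rowQ`. -/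
theorem evalOn_rowQ_eq_coeff (I : Finset ι) (y : ι → K) (m : ℕ) :
    evalOn I y (rowQ m) = PowerSeries.coeff m (∏ i ∈ I, cayleySeries (y i)) := by
  refine aeval_rowQ_of_newton _ (fun m => PowerSeries.coeff m (∏ i ∈ I, cayleySeries (y i)))
    ?_ (fun n => ?_) m
  · simp [PowerSeries.coeff_zero_eq_constantCoeff, map_prod, cayleySeries]
  · have h := congrArg (PowerSeries.coeff n) (derivative_prod_cayleySeries I y)
    rw [PowerSeries.coeff_derivative, mul_comm, PowerSeries.coeff_mul,
      ← Finset.Nat.sum_antidiagonal_swap, Finset.Nat.sum_antidiagonal_eq_sum_range_succ_mk] at h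
    refine h.trans ?_
    simp only [Prod.fst_swap, Prod.snd_swap, map_sum, PowerSeries.coeff_mk]
    rw [← Finset.sum_filter]
    trans ∑ b ∈ (Finset.range (n + 1)).filter Even,
      PowerSeries.coeff (n - b) (∏ i ∈ I, cayleySeries (y i)) * ∑ i ∈ I, 2 * y i ^ (b + 1)
    · rw [Finset.sum_filter]
      refine Finset.sum_congr rfl fun b _ => ?_
      split_ifs <;> simp
    · refine Finset.sum_nbij' (fun b => b / 2) (fun k => 2 * k) ?_ ?_ ?_ ?_ ?_
      · intro b hb
        simp only [Finset.mem_filter, Finset.mem_range] at hb ⊢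
        omega
      · intro b hb
        simp only [Finset.mem_filter, Finset.mem_range] at hb ⊢
        exact ⟨by omega, even_two_mul _⟩
      · intro b hb
        exact Nat.two_mul_div_two_of_even (Finset.mem_filter.1 hb).2
      · intro b _
        simp
      · intro b hb
        rw [Nat.two_mul_div_two_of_even (Finset.mem_filter.1 hb).2, ← Finset.mul_sum]
        ring

/-- This is the interpolation formula with $b_i=-y_i$ at the point $x=1/t$, multiplied by $t^{|I|}$.
-/
theorem prod_one_add_interpolation (I : Finset ι) (y : ι → K) (hy : Set.InjOn y I) :
    ∏ i ∈ I, (1 + PowerSeries.C (y i) * PowerSeries.X) =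
      ∏ i ∈ I, (1 - PowerSeries.C (y i) * PowerSeries.X) +
        ∑ i ∈ I, PowerSeries.C (2 * y i * pairFactor I y i) * PowerSeries.X *
          ∏ j ∈ I.erase i, (1 - PowerSeries.C (y j) * PowerSeries.X) := by
  have : CharZero K := charZero_of_injective_algebraMap (algebraMap ℝ K).injective
  have key : ∏ i ∈ I, (1 + Polynomial.C (y i) * Polynomial.X) =
      ∏ i ∈ I, (1 - Polynomial.C (y i) * Polynomial.X) +
        ∑ i ∈ I, Polynomial.C (2 * y i * pairFactor I y i) * Polynomial.X *
          ∏ j ∈ I.erase i, (1 - Polynomial.C (y j) * Polynomial.X) := by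
    refine Polynomial.funext fun t => ?_
    simp only [Polynomial.eval_add, Polynomial.eval_prod, Polynomial.eval_finsetSum,
      Polynomial.eval_mul, Polynomial.eval_sub, Polynomial.eval_one, Polynomial.eval_C,
      Polynomial.eval_X]
    by_cases ht : t = 0
    · simp [ht]
    have h := congrArg (fun z => t ^ I.card * z)
      (prod_sub_interpolation I y (fun i => - y i) hy t⁻¹)
    simp only [mul_add, Finset.mul_sum] at h
    have e1 : ∀ c : ι → K, t ^ I.card * ∏ i ∈ I, (t⁻¹ - c i) = ∏ i ∈ I, (1 - c i * t) := by
      intro c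
      rw [← Finset.prod_const, ← Finset.prod_mul_distrib]
      refine Finset.prod_congr rfl fun i _ => ?_
      field_simp
    have e2 : ∀ i ∈ I, t ^ I.card * ∏ j ∈ I.erase i, (t⁻¹ - y j) =
        t * ∏ j ∈ I.erase i, (1 - y j * t) := by
      intro i hi
      rw [← Finset.card_erase_add_one hi, pow_succ', mul_assoc, ← Finset.prod_const,
        ← Finset.prod_mul_distrib]
      congr 1
      refine Finset.prod_congr rfl fun i _ => ?_
      field_simp
    rw [e1, e1] at h
    simp only [neg_mul, sub_neg_eq_add] at h
    rw [h]
    congr 1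
    refine Finset.sum_congr rfl fun i hi => ?_
    rw [mul_left_comm, e2 i hi, pairFactor]
    ring
  have h := congrArg (Polynomial.coeToPowerSeries.ringHom (R := K)) key
  simp only [map_prod, map_add, map_sum, map_mul, map_sub, map_one,
    Polynomial.coeToPowerSeries.ringHom_apply, Polynomial.coe_C, Polynomial.coe_X] at h
  simpa only [map_mul] using h

/-- Partial fractions: the poles at $t=1/y_i$ are simple because the $y_i$ are distinct, and
`cayleySeries (y i) - 1` equals $2y_it/(1-y_it)$. -/
theorem prod_cayleySeries_eq (I : Finset ι) (y : ι → K) (hy : Set.InjOn y I) :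
    ∏ i ∈ I, cayleySeries (y i) =
      1 + ∑ i ∈ I, PowerSeries.C (pairFactor I y i) * (cayleySeries (y i) - 1) := by
  have hne : ∏ i ∈ I, (1 - PowerSeries.C (y i) * PowerSeries.X) ≠ 0 := by
    refine Finset.prod_ne_zero_iff.2 fun i _ h => ?_
    have := congrArg (PowerSeries.constantCoeff (R := K)) h
    simp at this
  apply mul_left_cancel₀ hne
  rw [← Finset.prod_mul_distrib, Finset.prod_congr rfl fun i _ => one_sub_mul_cayleySeries (y i),
    prod_one_add_interpolation I y hy, mul_add, mul_one, Finset.mul_sum]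
  congr 1
  refine Finset.sum_congr rfl fun i hi => ?_
  rw [← Finset.mul_prod_erase I _ hi]
  have h2 : PowerSeries.C (2 * y i * pairFactor I y i) =
      2 * PowerSeries.C (y i) * PowerSeries.C (pairFactor I y i) := by
    rw [map_mul, two_mul, two_mul, map_add]
  rw [h2]
  linear_combination (-(PowerSeries.C (pairFactor I y i) *
    ∏ j ∈ I.erase i, (1 - PowerSeries.C (y j) * PowerSeries.X))) * one_sub_mul_cayleySeries (y i)

/-- The one-row `Q`-functions in finitely many variables. -/
theorem evalOn_rowQ (I : Finset ι) (y : ι → K) (hy : Set.InjOn y I) {m : ℕ} (hm : m ≠ 0) :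
    evalOn I y (rowQ m) = 2 * ∑ i ∈ I, y i ^ m * pairFactor I y i := by
  rw [evalOn_rowQ_eq_coeff, prod_cayleySeries_eq I y hy, map_add, map_sum,
    PowerSeries.coeff_one, if_neg hm, zero_add, Finset.mul_sum]
  refine Finset.sum_congr rfl fun i _ => ?_
  rw [PowerSeries.coeff_C_mul, map_sub, PowerSeries.coeff_one, if_neg hm, cayleySeries,
    PowerSeries.coeff_mk, if_neg hm]
  ring

end Evaluation

section VertexOperator

/-- The `Γ`-linear map `Γ[T] → Γ` with `T ^ m ↦ q_m`. -/
noncomputable def rowQMap : Polynomial Gam →ₗ[Gam] Gam :=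
  Polynomial.lsum fun m => LinearMap.mulRight Gam (rowQ m)

@[simp] theorem rowQMap_C_mul_X_pow (g : Gam) (m : ℕ) :
    rowQMap (Polynomial.C g * Polynomial.X ^ m) = g * rowQ m := by
  rw [rowQMap, Polynomial.C_mul_X_pow_eq_monomial, Polynomial.lsum_apply,
    Polynomial.sum_monomial_index] <;> simp

theorem rowQMap_C_mul (g : Gam) (F : Polynomial Gam) :
    rowQMap (Polynomial.C g * F) = g * rowQMap F := by
  rw [← Polynomial.smul_eq_C_mul, map_smul, smul_eq_mul]

/-- The homomorphism `Γ → Γ[T]` removing the variable `T`: `p_k ↦ p_k - T^k`. -/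
noncomputable def removeVar : Gam →ₐ[ℝ] Polynomial Gam :=
  aeval fun m : ℕ => Polynomial.C (X m) - Polynomial.X ^ (2 * m + 1)

/-- The vertex operator `∑ φ_r B_r` of the polynomial `φ = ∑ φ_r T^r`. -/
noncomputable def vertexOp : Polynomial ℝ →ₗ[ℝ] Module.End ℝ Gam :=
  LinearMap.mk₂ ℝ (fun φ g => rowQMap (φ.map (algebraMap ℝ Gam) * removeVar g))
    (fun φ ψ g => by rw [Polynomial.map_add, add_mul, map_add])
    (fun c φ g => by
      rw [Polynomial.map_smul, smul_mul_assoc, algebraMap_smul, ← algebraMap_smul Gam c,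
        map_smul, algebraMap_smul])
    (fun φ g h => by rw [map_add, mul_add, map_add])
    (fun c φ g => by
      rw [map_smul, mul_smul_comm, ← algebraMap_smul Gam c, map_smul, algebraMap_smul])

theorem vertexOp_apply (φ : Polynomial ℝ) (g : Gam) :
    vertexOp φ g = rowQMap (φ.map (algebraMap ℝ Gam) * removeVar g) := rfl

theorem vertexOp_X_pow_apply (r : ℕ) (g : Gam) :
    vertexOp (Polynomial.X ^ r) g = rowQMap (Polynomial.X ^ r * removeVar g) := by
  simp [vertexOp_apply]

theorem vertexOp_X_pow_one (r : ℕ) : vertexOp (Polynomial.X ^ r) 1 = rowQ r := by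
  rw [vertexOp_X_pow_apply, map_one, mul_one]
  simpa using rowQMap_C_mul_X_pow 1 r

/-- `removeVar` is a ring homomorphism, and a factor $T^{2k+1}$ only shifts the index of the
operator. All later commutation relations follow from this rule by induction over monomials. -/
theorem vertexOp_X_pow_X_mul (r k : ℕ) (g : Gam) :
    vertexOp (Polynomial.X ^ r) (X k * g) =
      X k * vertexOp (Polynomial.X ^ r) g - vertexOp (Polynomial.X ^ (r + (2 * k + 1))) g := by
  simp only [vertexOp_X_pow_apply]
  rw [map_mul removeVar, ← rowQMap_C_mul, ← map_sub]
  congr 1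
  rw [removeVar, aeval_X]
  ring

variable {ι K : Type*} [DecidableEq ι] [Field K] [Algebra ℝ K]

/-- The constant term must vanish because $q_0=1$ is not given by the sum formula that holds for the
other $q_m$. -/
theorem evalOn_rowQMap (I : Finset ι) (y : ι → K) (hy : Set.InjOn y I) (F : Polynomial Gam)
    (hF : F.coeff 0 = 0) :
    evalOn I y (rowQMap F) =
      2 * ∑ i ∈ I, (F.eval₂ (evalOn I y : Gam →+* K) (y i)) * pairFactor I y i := by
  conv_lhs => rw [F.as_sum_support_C_mul_X_pow]
  simp only [map_sum, rowQMap_C_mul_X_pow, Polynomial.eval₂_eq_sum, Polynomial.sum_def,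
    Finset.sum_mul, Finset.mul_sum]
  rw [Finset.sum_comm]
  refine Finset.sum_congr rfl fun m hm => ?_
  rw [map_mul, evalOn_rowQ I y hy, Finset.mul_sum, Finset.mul_sum]
  · refine Finset.sum_congr rfl fun i _ => ?_
    simp only [RingHom.coe_coe]
    ring
  · rintro rfl
    exact Polynomial.mem_support_iff.1 hm hF

/-- Setting $T=y_i$ cancels the contribution of $y_i$ to every power sum. -/
theorem eval₂_removeVar (I : Finset ι) (y : ι → K) {i : ι} (hi : i ∈ I) (g : Gam) :
    (removeVar g).eval₂ (evalOn I y : Gam →+* K) (y i) = evalOn (I.erase i) y g := by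
  have : ((Polynomial.eval₂RingHom (evalOn I y : Gam →+* K) (y i)).comp
      (removeVar : Gam →+* Polynomial Gam)) = (evalOn (I.erase i) y : Gam →+* K) := by
    refine MvPolynomial.ringHom_ext (fun r => ?_) (fun m => ?_)
    · simp [removeVar, evalOn, MvPolynomial.algebraMap_eq, Polynomial.algebraMap_apply]
    · simp [removeVar, evalOn, ← Finset.add_sum_erase I _ hi]
  exact congrArg (fun f => f g) this

/-- The vertex operators in finitely many variables. -/
theorem evalOn_vertexOp (I : Finset ι) (y : ι → K) (hy : Set.InjOn y I) (φ : Polynomial ℝ)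
    (hφ : φ.coeff 0 = 0) (g : Gam) :
    evalOn I y (vertexOp φ g) =
      2 * ∑ i ∈ I, Polynomial.aeval (y i) φ * pairFactor I y i * evalOn (I.erase i) y g := by
  rw [vertexOp_apply, evalOn_rowQMap I y hy]
  · congr 1
    refine Finset.sum_congr rfl fun i hi => ?_
    rw [Polynomial.eval₂_mul, eval₂_removeVar I y hi, Polynomial.eval₂_map, Polynomial.aeval_def]
    have : ((evalOn I y : Gam →+* K).comp (algebraMap ℝ Gam)) = algebraMap ℝ K :=
      (evalOn I y).comp_algebraMap
    rw [this]
    ring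
  · rw [Polynomial.mul_coeff_zero, Polynomial.coeff_map, hφ, map_zero, zero_mul]

/-- `B_{r₁} B_{r₂} ⋯ 1`, where `B_r` is the vertex operator of the polynomial `φ r`. -/
noncomputable def vertexQ (φ : ℕ → Polynomial ℝ) : List ℕ → Gam
  | [] => 1
  | r :: L => vertexOp (φ r) (vertexQ φ L)

end VertexOperator

end DoublySymmetric

/-! ### Algebraic independence of odd power sums, and the symmetrization formula. -/

namespace DoublySymmetric

open MvPolynomial

section Independence

theorem pderiv_aeval {σ τ : Type*} [Fintype σ] (f : σ → MvPolynomial τ ℝ) (i : τ)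
    (p : MvPolynomial σ ℝ) :
    pderiv i (aeval f p) = ∑ k, aeval f (pderiv k p) * pderiv i (f k) := by
  classical
  induction p using MvPolynomial.induction_on with
  | C a => simp [MvPolynomial.algebraMap_eq]
  | add p q hp hq => simp only [map_add, hp, hq, add_mul, Finset.sum_add_distrib]
  | mul_X p j hp =>
    rw [map_mul, aeval_X, pderiv_mul, hp]
    have : ∀ k, aeval f (pderiv k (p * X j)) * pderiv i (f k) =
        aeval f (pderiv k p) * pderiv i (f k) * f j +
          if j = k then aeval f p * pderiv i (f j) else 0 := fun k => by
      rw [pderiv_mul, pderiv_X]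
      rcases eq_or_ne j k with rfl | h
      · simp; ring
      · simp [h]; ring
    simp only [this, Finset.sum_add_distrib, Finset.sum_ite_eq, Finset.mem_univ, if_true,
      Finset.sum_mul]

/-- Jacobian criterion. By the chain rule, a relation $p(f)=0$ gives a linear system for the
$(\partial_kp)(f)$ whose matrix is, up to the factors $2k+1$, the Vandermonde matrix of the squares
of the variables. It has nonzero determinant, so each $\partial_kp$ is again a relation, of lower
degree, and vanishes by induction. Then $p$ is a constant, hence zero. -/
theorem eq_zero_of_aeval_oddPowerSum_eq_zero {N : ℕ} (d : ℕ) (p : MvPolynomial (Fin N) ℝ)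
    (hd : ∀ s, coeff s p ≠ 0 → s.degree < d)
    (h : aeval (fun m : Fin N => ∑ i : Fin N, (X i : MvPolynomial (Fin N) ℝ) ^ (2 * (m : ℕ) + 1)) p
      = 0) : p = 0 := by
  induction d generalizing p with
  | zero =>
    ext s
    by_contra hs
    exact absurd (hd s hs) (Nat.not_lt_zero _)
  | succ d ih =>
    set f : Fin N → MvPolynomial (Fin N) ℝ := fun m => ∑ i, X i ^ (2 * (m : ℕ) + 1) with hf
    have hfd : ∀ i k, pderiv i (f k) = C (2 * (k : ℝ) + 1) * (X i ^ 2) ^ (k : ℕ) := fun i k => by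
      rw [hf, map_sum, Finset.sum_eq_single i]
      · rw [pderiv_pow, pderiv_X_self]
        have h2 : (C (2 : ℝ) : MvPolynomial (Fin N) ℝ) = 2 := map_ofNat C 2
        simp [pow_mul, h2]
      · intro j _ hj
        rw [pderiv_pow, pderiv_X_of_ne hj, mul_zero]
      · simp
    have hv : Matrix.mulVec (Matrix.vandermonde fun i : Fin N => (X i : MvPolynomial (Fin N) ℝ) ^ 2)
        (fun k => aeval f (pderiv k p) * C (2 * (k : ℝ) + 1)) = 0 := by
      ext1 i
      have := pderiv_aeval f i p
      rw [h, map_zero] at this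
      rw [Pi.zero_apply, this, Matrix.mulVec, dotProduct]
      refine Finset.sum_congr rfl fun k _ => ?_
      rw [Matrix.vandermonde_apply, hfd]
      ring
    have hdet : (Matrix.vandermonde fun i : Fin N => (X i : MvPolynomial (Fin N) ℝ) ^ 2).det ≠ 0 := by
      rw [Matrix.det_vandermonde_ne_zero_iff]
      intro i j hij
      by_contra hne
      have := congrArg (eval (Pi.single i (1 : ℝ))) hij
      simp [Ne.symm hne] at this
    have h0 := Matrix.eq_zero_of_mulVec_eq_zero hdet hv
    have hp : ∀ k, pderiv k p = 0 := fun k => by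
      refine ih _ (fun s hs => ?_) ?_
      · rw [coeff_pderiv] at hs
        have := hd _ (left_ne_zero_of_mul hs)
        rw [map_add, Finsupp.degree_single] at this
        omega
      · have := congrFun h0 k
        refine (mul_eq_zero.1 this).resolve_right fun hC => ?_
        have := C_eq_zero.1 hC
        have hk : (0 : ℝ) ≤ (k : ℕ) := Nat.cast_nonneg _
        linarith
    have hC : p = C (coeff 0 p) := by
      ext s
      rw [coeff_C]
      split_ifs with hs
      · rw [hs]
      · obtain ⟨k, hk⟩ : ∃ k, s k ≠ 0 := by
          by_contra! hc
          exact hs (Finsupp.ext fun k => (hc k).symm)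
        have := congrArg (coeff (s - Finsupp.single k 1)) (hp k)
        rw [coeff_pderiv, coeff_zero, tsub_add_cancel_of_le] at this
        · refine (mul_eq_zero.1 this).resolve_right ?_
          positivity
        · intro j
          rcases eq_or_ne k j with rfl | hkj
          · simpa using Nat.one_le_iff_ne_zero.2 hk
          · simp [hkj]
    rw [hC, aeval_C, MvPolynomial.algebraMap_eq, C_eq_zero] at h
    rw [hC, h, C_0]

/-- Finitely many odd power sums are algebraically independent in sufficiently many variables. -/
theorem exists_aeval_oddPowerSum_ne_zero (g : Gam) (hg : g ≠ 0) :
    ∃ N : ℕ, aeval (fun m => ∑ i : Fin N, (X i : MvPolynomial (Fin N) ℝ) ^ (2 * m + 1)) g ≠ 0 := by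
  obtain ⟨N, hN⟩ : ∃ N, ∀ i ∈ g.vars, i < N := ⟨g.vars.sup id + 1, fun i hi =>
    Nat.lt_succ_of_le (Finset.le_sup (f := id) hi)⟩
  obtain ⟨p, rfl⟩ := exists_rename_eq_of_vars_subset_range g (Fin.val : Fin N → ℕ)
    Fin.val_injective fun i hi => ⟨⟨i, hN i hi⟩, rfl⟩
  refine ⟨N, fun h => hg ?_⟩
  rw [aeval_rename] at h
  rw [eq_zero_of_aeval_oddPowerSum_eq_zero (p.support.sup Finsupp.degree + 1) p
    (fun s hs => Nat.lt_succ_of_le (Finset.le_sup (f := Finsupp.degree) (mem_support_iff.2 hs))) h,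
    map_zero]

theorem specialize_formalVar (n : ℕ) (g : Gam) :
    specialize (formalVar n) g = algebraMap (MvPolynomial (Fin n) ℝ) _
      (aeval (fun m => ∑ i : Fin n, (X i : MvPolynomial (Fin n) ℝ) ^ (2 * m + 1)) g) := by
  rw [specialize, ← IsScalarTower.coe_toAlgHom' ℝ, ← AlgHom.comp_apply, comp_aeval]
  simp [formalVar]

theorem evalOn_univ_formalVar (n : ℕ) (g : Gam) :
    evalOn Finset.univ (formalVar n) g = specialize (formalVar n) g := rfl

theorem formalVar_injective (n : ℕ) : Function.Injective (formalVar n) :=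
  (IsFractionRing.injective _ _).comp (X_injective (R := ℝ))

/-- A doubly symmetric function is determined by its specializations in finitely many variables. -/
theorem eq_of_specialize_formalVar {g h : Gam}
    (H : ∀ n, specialize (formalVar n) g = specialize (formalVar n) h) : g = h := by
  by_contra hne
  obtain ⟨N, hN⟩ := exists_aeval_oddPowerSum_ne_zero (g - h) (sub_ne_zero.2 hne)
  apply hN
  have := sub_eq_zero.2 (H N)
  rw [← map_sub, specialize_formalVar] at this
  exact (map_eq_zero_iff _ (IsFractionRing.injective _ _)).1 this

theorem eq_of_evalOn_formalVar {g h : Gam}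
    (H : ∀ n, evalOn Finset.univ (formalVar n) g = evalOn Finset.univ (formalVar n) h) : g = h :=
  eq_of_specialize_formalVar H

end Independence

section Symmetrization

variable {K : Type*} [Field K]

/-- The function to be symmetrized, with the exponents given by a list. -/
noncomputable def listR (L : List ℕ) {n : ℕ} (y : Fin n → K) : K :=
  (∏ i : Fin n, y i ^ L.getD i 0) *
    ∏ i : Fin n, ∏ j : Fin n,
      if (i : ℕ) < L.length ∧ i < j then (y i + y j) / (y i - y j) else 1

theorem listR_cons (a : ℕ) (L : List ℕ) {n : ℕ} (y : Fin (n + 1) → K) :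
    listR (a :: L) y = y 0 ^ a * (∏ j : Fin n, (y 0 + y j.succ) / (y 0 - y j.succ)) *
      listR L (fun i => y i.succ) := by
  simp only [listR, Fin.prod_univ_succ, Fin.val_zero, List.getD_cons_zero, Fin.val_succ,
    List.getD_cons_succ, List.length_cons, Nat.zero_lt_succ, true_and,
    Fin.succ_pos, if_true, if_false, Fin.not_lt_zero, and_false, one_mul,
    Nat.succ_lt_succ_iff, Fin.succ_lt_succ_iff]
  ring

variable [Algebra ℝ K]

theorem evalOn_univ_comp {ι κ : Type*} [DecidableEq ι] [DecidableEq κ] [Fintype κ] (I : Finset ι)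
    (σ : κ ↪ ι) (hσ : Finset.univ.map σ = I) (y : ι → K) :
    evalOn Finset.univ (y ∘ σ) = evalOn I y := by
  subst hσ
  simp [evalOn]

/-- The vertex operator construction of the `Q`-functions agrees with the symmetrization. -/
theorem evalOn_vertexQ_eq_symmetrization (L : List ℕ) (hL : ∀ r ∈ L, r ≠ 0) {n : ℕ} (y : Fin n → K)
    (hy : Function.Injective y) :
    evalOn Finset.univ y (vertexQ (fun r => Polynomial.X ^ r) L) =
      if L.length ≤ n then
        2 ^ L.length / ((n - L.length).factorial : K) *
          ∑ w : Equiv.Perm (Fin n), listR L fun i => y (w i)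
      else 0 := by
  have : CharZero K := charZero_of_injective_algebraMap (algebraMap ℝ K).injective
  induction L generalizing n with
  | nil =>
    have : (n.factorial : K) ≠ 0 := by exact_mod_cast n.factorial_ne_zero
    simp [vertexQ, listR, Fintype.card_perm, this]
  | cons a L ih =>
    have ha : a ≠ 0 := hL a (by simp)
    have hL' : ∀ r ∈ L, r ≠ 0 := fun r hr => hL r (by simp [hr])
    rw [vertexQ, evalOn_vertexOp _ _ hy.injOn _ (by simp [Polynomial.coeff_X_pow, ha.symm])]
    cases n with
    | zero => simp
    | succ n =>
      -- This embeds `Fin n` onto the complement of `p` in the way `Equiv.Perm.decomposeFin` does: a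
      -- permutation of `Fin (n + 1)` is the image `p` of `0` together with a permutation of the
      -- rest, followed by the transposition of `0` and `p`. The first vertex operator sums over `p`
      -- and the induction hypothesis sums over the rest.
      let σ : Fin (n + 1) → (Fin n ↪ Fin (n + 1)) := fun p =>
        (Fin.succEmb n).trans (Equiv.swap 0 p).toEmbedding
      have hσ : ∀ p, Finset.univ.map (σ p) = Finset.univ.erase p := fun p => by
        ext j
        simp only [Finset.mem_map, Finset.mem_univ, true_and, Finset.mem_erase, and_true, σ]
        constructor
        · rintro ⟨k, rfl⟩ h
          have h' : Equiv.swap 0 p k.succ = Equiv.swap 0 p 0 := by simpa using h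
          exact Fin.succ_ne_zero _ ((Equiv.swap 0 p).injective h')
        · intro hj
          have : Equiv.swap 0 p j ≠ 0 := fun h => hj (by
            rw [← Equiv.swap_apply_self 0 p j, h, Equiv.swap_apply_left])
          obtain ⟨k, hk⟩ := Fin.exists_succ_eq_of_ne_zero this
          exact ⟨k, by simp [hk]⟩
      have hlen : (a :: L).length ≤ n + 1 ↔ L.length ≤ n := by simp
      have hev : ∀ p, evalOn (Finset.univ.erase p) y (vertexQ (fun r => Polynomial.X ^ r) L) =
          if L.length ≤ n then 2 ^ L.length / ((n - L.length).factorial : K) *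
            ∑ w : Equiv.Perm (Fin n), listR L fun i => y (σ p (w i)) else 0 := fun p => by
        rw [← evalOn_univ_comp _ (σ p) (hσ p) y,
          ih hL' (y ∘ σ p) (hy.comp (σ p).injective)]
        rfl
      simp only [hev, hlen]
      split_ifs with h
      · rw [← Equiv.Perm.decomposeFin.symm.sum_comp, Fintype.sum_prod_type, List.length_cons,
          Nat.succ_sub_succ, Finset.mul_sum, Finset.mul_sum]
        refine Finset.sum_congr rfl fun p _ => ?_
        rw [Finset.mul_sum, Finset.mul_sum, Finset.mul_sum, Finset.mul_sum]
        refine Finset.sum_congr rfl fun e _ => ?_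
        rw [listR_cons]
        simp only [Equiv.Perm.decomposeFin_symm_apply_zero, Equiv.Perm.decomposeFin_symm_apply_succ]
        have hpf : pairFactor Finset.univ y p = ∏ j : Fin n,
            (y p + y (Equiv.swap 0 p (e j).succ)) / (y p - y (Equiv.swap 0 p (e j).succ)) := by
          rw [pairFactor, ← hσ p, Finset.prod_map, ← Equiv.prod_comp e]
          rfl
        rw [hpf]
        simp only [σ, Function.Embedding.trans_apply, Fin.coe_succEmb, Equiv.coe_toEmbedding,
          map_pow, Polynomial.aeval_X]
        ring
      · simp

end Symmetrization

end DoublySymmetric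

/-! ### Strict partitions as decreasing lists, and existence of the $Q$-functions. -/

namespace StrictPartition

theorem support_row (l : StrictPartition) : l.row.support = Finset.range l.length := by
  have hdown : ∀ i j, i < j → j ∈ l.row.support → i ∈ l.row.support := fun i j hij hj => by
    have := l.strict i j hij (Nat.pos_of_ne_zero (Finsupp.mem_support_iff.1 hj))
    exact Finsupp.mem_support_iff.2 (by omega)
  have hsub : l.row.support ⊆ Finset.range l.length := by
    intro i hi
    have : Finset.range (i + 1) ⊆ l.row.support := fun k hk => by
      rcases (Nat.lt_succ_iff.1 (Finset.mem_range.1 hk)).lt_or_eq with h | rfl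
      · exact hdown _ _ h hi
      · exact hi
    have := Finset.card_le_card this
    rw [Finset.card_range] at this
    exact Finset.mem_range.2 this
  exact Finset.eq_of_subset_of_card_le hsub (by rw [Finset.card_range]; rfl)

theorem row_ne_zero_iff (l : StrictPartition) (i : ℕ) : l.row i ≠ 0 ↔ i < l.length := by
  rw [← Finsupp.mem_support_iff, support_row, Finset.mem_range]

theorem row_eq_zero_iff (l : StrictPartition) (i : ℕ) : l.row i = 0 ↔ l.length ≤ i := by
  rw [← not_lt, ← row_ne_zero_iff, not_not]

theorem weight_eq_sum_range (l : StrictPartition) :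
    l.weight = ∑ i ∈ Finset.range l.length, l.row i := by
  rw [weight, support_row]

/-- The list of the nonzero terms of a strict partition, in decreasing order. -/
noncomputable def toList (l : StrictPartition) : List ℕ := (List.range l.length).map l.row

@[simp] theorem length_toList (l : StrictPartition) : l.toList.length = l.length := by
  simp [toList]

theorem getD_toList (l : StrictPartition) (i : ℕ) : l.toList.getD i 0 = l.row i := by
  rcases lt_or_ge i l.length with h | h
  · simp [toList, h]
  · rw [List.getD_eq_default _ _ (by simpa using h), eq_comm, row_eq_zero_iff]
    exact h

theorem ne_zero_of_mem_toList (l : StrictPartition) {r : ℕ} (hr : r ∈ l.toList) : r ≠ 0 := by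
  simp only [toList, List.mem_map, List.mem_range] at hr
  obtain ⟨i, hi, rfl⟩ := hr
  exact (l.row_ne_zero_iff i).2 hi

theorem pairwise_toList (l : StrictPartition) : l.toList.Pairwise (· > ·) := by
  rw [toList, List.pairwise_map]
  refine (List.pairwise_lt_range (n := l.length)).imp_of_mem fun {a b} _ hb hab => ?_
  exact l.strict a b hab (Nat.pos_of_ne_zero ((l.row_ne_zero_iff b).2 (List.mem_range.1 hb)))

theorem sum_toList (l : StrictPartition) : l.toList.sum = l.weight := by
  rw [weight_eq_sum_range, toList]
  rfl

/-- The strict partition with the given nonzero terms. -/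
def ofList (L : List ℕ) (hL : L.Pairwise (· > ·)) : StrictPartition where
  row := L.toFinsupp
  strict i j hij hj := by
    rw [List.toFinsupp_apply] at hj ⊢
    rw [List.toFinsupp_apply]
    have hj' : j < L.length := by
      by_contra hc
      rw [List.getD_eq_default _ _ (not_lt.1 hc)] at hj
      exact lt_irrefl _ hj
    rw [List.getD_eq_getElem _ _ hj', List.getD_eq_getElem _ _ (hij.trans hj')]
    exact List.pairwise_iff_getElem.1 hL i j _ _ hij

theorem toList_ofList (L : List ℕ) (hL : L.Pairwise (· > ·)) (h0 : ∀ r ∈ L, r ≠ 0) :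
    (ofList L hL).toList = L := by
  have hrow : ∀ i, (ofList L hL).row i = L.getD i 0 := fun i => List.toFinsupp_apply _ _
  have hlen : (ofList L hL).length = L.length := by
    have h1 : ∀ i, i < (ofList L hL).length ↔ i < L.length := fun i => by
      rw [← row_ne_zero_iff, hrow]
      constructor
      · intro h
        by_contra hc
        exact h (List.getD_eq_default _ _ (not_lt.1 hc))
      · intro h
        rw [List.getD_eq_getElem _ _ h]
        exact h0 _ (List.getElem_mem _)
    have h2 := h1 (ofList L hL).length
    have h3 := h1 L.length
    omega
  refine List.ext_getElem (by simpa using hlen) fun i h1 h2 => ?_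
  rw [← List.getD_eq_getElem _ 0 h1, ← List.getD_eq_getElem _ 0 h2, getD_toList, hrow]

end StrictPartition

namespace DoublySymmetric

open MvPolynomial StrictPartition

theorem schurR_eq_listR {K : Type*} [Field K] (l : StrictPartition) {n : ℕ} (y : Fin n → K) :
    schurR l y = listR l.toList y := by
  simp only [schurR, listR, getD_toList, length_toList]

/-- The `Q`-function attached to a list of exponents. -/
noncomputable abbrev listQ (L : List ℕ) : Gam := vertexQ (fun r => Polynomial.X ^ r) L

theorem isSchurQ_listQ (l : StrictPartition) : IsSchurQ l (listQ l.toList) := fun n => by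
  rw [← evalOn_univ_formalVar, evalOn_vertexQ_eq_symmetrization _
    (fun r hr => l.ne_zero_of_mem_toList hr) _ (formalVar_injective n)]
  simp only [schurQFinite, schurR_eq_listR, length_toList]

theorem isSchurQ_schurQ (l : StrictPartition) : IsSchurQ l (schurQ l) := by
  have h : ∃ g, IsSchurQ l g := ⟨_, isSchurQ_listQ l⟩
  rw [schurQ, dif_pos h]
  exact h.choose_spec

theorem schurQ_eq_listQ (l : StrictPartition) : schurQ l = listQ l.toList :=
  eq_of_specialize_formalVar fun n => (isSchurQ_schurQ l n).trans (isSchurQ_listQ l n).symm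

end DoublySymmetric

/-! ### Anticommutation of the vertex operators, and spanning by $Q$-functions. -/

namespace DoublySymmetric

open MvPolynomial StrictPartition

section Antisymmetry

theorem pairFactor_eq_mul_erase {ι K : Type*} [DecidableEq ι] [Field K] (I : Finset ι) (y : ι → K)
    {i u : ι} (hu : u ∈ I) (hiu : i ≠ u) :
    pairFactor I y i = (y i + y u) / (y i - y u) * pairFactor (I.erase u) y i := by
  rw [pairFactor, ← Finset.mul_prod_erase _ _ (Finset.mem_erase.2 ⟨hiu.symm, hu⟩),
    Finset.erase_right_comm, pairFactor]

theorem evalOn_vertexOp_vertexOp {ι K : Type*} [DecidableEq ι] [Field K] [Algebra ℝ K]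
    (I : Finset ι) (y : ι → K) (hy : Set.InjOn y I) (φ ψ : Polynomial ℝ) (hφ : φ.coeff 0 = 0)
    (hψ : ψ.coeff 0 = 0) (g : Gam) :
    evalOn I y (vertexOp φ (vertexOp ψ g)) = 4 * ∑ i ∈ I, ∑ u ∈ I.erase i,
      Polynomial.aeval (y i) φ * Polynomial.aeval (y u) ψ * ((y i + y u) / (y i - y u)) *
        (pairFactor (I.erase u) y i * pairFactor (I.erase i) y u *
          evalOn ((I.erase i).erase u) y g) := by
  rw [evalOn_vertexOp I y hy φ hφ, Finset.mul_sum, Finset.mul_sum]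
  refine Finset.sum_congr rfl fun i hi => ?_
  rw [evalOn_vertexOp (I.erase i) y (hy.mono (Finset.erase_subset i I)) ψ hψ, Finset.mul_sum,
    Finset.mul_sum, Finset.mul_sum, Finset.mul_sum]
  refine Finset.sum_congr rfl fun u hu => ?_
  rw [pairFactor_eq_mul_erase I y (Finset.mem_of_mem_erase hu) (Finset.ne_of_mem_erase hu).symm]
  ring

/-- In finitely many variables the composition is a sum over ordered pairs $i\ne u$. Besides
$\varphi(y_i)\psi(y_u)$ its only factor that is not symmetric in $i$ and $u$ is
$(y_i+y_u)/(y_i-y_u)$, which changes sign. The constant terms have to vanish: $B_0$ fixes $1$, so it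
does not anticommute with itself. -/
theorem vertexOp_anticomm (φ ψ : Polynomial ℝ) (hφ : φ.coeff 0 = 0) (hψ : ψ.coeff 0 = 0)
    (g : Gam) : vertexOp φ (vertexOp ψ g) = - vertexOp ψ (vertexOp φ g) := by
  refine eq_of_evalOn_formalVar fun n => ?_
  have hy := (formalVar_injective n).injOn (s := (Finset.univ : Finset (Fin n)))
  rw [map_neg, evalOn_vertexOp_vertexOp _ _ hy _ _ hφ hψ, evalOn_vertexOp_vertexOp _ _ hy _ _ hψ hφ,
    ← mul_neg, ← Finset.sum_neg_distrib]
  congr 1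
  rw [Finset.sum_comm' (t' := Finset.univ) (s' := fun u => Finset.univ.erase u)]
  · refine Finset.sum_congr rfl fun u _ => ?_
    rw [← Finset.sum_neg_distrib]
    refine Finset.sum_congr rfl fun i _ => ?_
    rw [Finset.erase_right_comm, add_comm (formalVar n i), ← neg_sub (formalVar n u), div_neg]
    ring
  · intro i u
    simp [eq_comm]

variable (φ : ℕ → Polynomial ℝ)

theorem vertexQ_perm (hφ : ∀ r, r ≠ 0 → (φ r).coeff 0 = 0) {L L' : List ℕ} (h : L.Perm L')
    (hL : ∀ r ∈ L, r ≠ 0) : vertexQ φ L = vertexQ φ L' ∨ vertexQ φ L = - vertexQ φ L' := by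
  induction h with
  | nil => exact Or.inl rfl
  | cons a _ ih =>
    rcases ih fun r hr => hL r (List.mem_cons_of_mem _ hr) with h | h
    · exact Or.inl (by rw [vertexQ, h, vertexQ])
    · exact Or.inr (by rw [vertexQ, h, vertexQ, map_neg])
  | swap a b L =>
    exact Or.inr (vertexOp_anticomm _ _ (hφ _ (hL _ (by simp))) (hφ _ (hL _ (by simp))) _)
  | trans h₁ _ ih₁ ih₂ =>
    rcases ih₁ hL with h | h <;> rcases ih₂ fun r hr => hL r (h₁.mem_iff.2 hr) with h' | h'
    · exact Or.inl (h.trans h')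
    · exact Or.inr (h.trans h')
    · exact Or.inr (by rw [h, h'])
    · exact Or.inl (by rw [h, h', neg_neg])

theorem vertexQ_eq_zero_of_not_nodup (hφ : ∀ r, r ≠ 0 → (φ r).coeff 0 = 0) {L : List ℕ}
    (hL : ∀ r ∈ L, r ≠ 0) (hd : ¬ L.Nodup) : vertexQ φ L = 0 := by
  obtain ⟨a, ha⟩ := List.exists_duplicate_iff_not_nodup.2 hd
  obtain ⟨L', hL'⟩ := (List.duplicate_iff_sublist.1 ha).exists_perm_append
  have h0 : (φ a).coeff 0 = 0 := hφ a (hL a ha.mem)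
  have hz : vertexQ φ ([a, a] ++ L') = 0 := by
    have := vertexOp_anticomm _ _ h0 h0 (vertexQ φ L')
    exact self_eq_neg.1 this
  rcases vertexQ_perm φ hφ hL' hL with h | h <;> rw [h, hz]
  exact neg_zero

/-- Straightening: sorting the list costs only a sign, and a repeated entry gives zero since the
operator at that entry squares to zero. -/
theorem listQ_eq_zero_or_schurQ (L : List ℕ) (hL : ∀ r ∈ L, r ≠ 0) :
    listQ L = 0 ∨ ∃ μ : StrictPartition, μ.weight = L.sum ∧
      (listQ L = schurQ μ ∨ listQ L = - schurQ μ) := by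
  have hφ : ∀ r, r ≠ 0 → (Polynomial.X ^ r : Polynomial ℝ).coeff 0 = 0 := fun r hr => by
    simp [Polynomial.coeff_X_pow, hr.symm]
  by_cases hd : L.Nodup
  · right
    have hp := List.perm_insertionSort (· ≥ ·) L
    have hs : (L.insertionSort (· ≥ ·)).Pairwise (· > ·) := by
      have h1 := List.pairwise_insertionSort (· ≥ ·) L
      have h2 : (L.insertionSort (· ≥ ·)).Nodup := hp.nodup_iff.2 hd
      exact (h1.and h2).imp fun h => lt_of_le_of_ne h.1 h.2.symm
    have ht := toList_ofList _ hs fun r hr => hL r (hp.mem_iff.1 hr)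
    refine ⟨ofList _ hs, ?_, ?_⟩
    · rw [← sum_toList, ht, hp.sum_eq]
    · rw [schurQ_eq_listQ, ht]
      exact vertexQ_perm _ hφ hp.symm hL
  · exact Or.inl (vertexQ_eq_zero_of_not_nodup _ hφ hL hd)

end Antisymmetry

section Span

/-- The product of the power sums with the given indices. -/
noncomputable def powerSumProd (L : List ℕ) : Gam := (L.map X).prod

/-- The degree of `powerSumProd`. -/
def powerSumDegree (L : List ℕ) : ℕ := (L.map fun m => 2 * m + 1).sum

/-- The doubly symmetric functions of degree less than `e`. -/
noncomputable def degreeLT (e : ℕ) : Submodule ℝ Gam :=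
  Submodule.span ℝ (powerSumProd '' {L | powerSumDegree L < e})

theorem degreeLT_mono {d e : ℕ} (h : d ≤ e) : degreeLT d ≤ degreeLT e :=
  Submodule.span_mono (Set.image_mono fun _ hL => lt_of_lt_of_le hL h)

theorem powerSumProd_mem_degreeLT {L : List ℕ} {e : ℕ} (h : powerSumDegree L < e) :
    powerSumProd L ∈ degreeLT e := Submodule.subset_span ⟨L, h, rfl⟩

@[simp] theorem powerSumProd_cons (a : ℕ) (L : List ℕ) :
    powerSumProd (a :: L) = X a * powerSumProd L := by simp [powerSumProd]

@[simp] theorem powerSumDegree_cons (a : ℕ) (L : List ℕ) :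
    powerSumDegree (a :: L) = 2 * a + 1 + powerSumDegree L := by simp [powerSumDegree]

theorem X_mul_mem_degreeLT {e : ℕ} {g : Gam} (hg : g ∈ degreeLT e) (a : ℕ) :
    X a * g ∈ degreeLT (2 * a + 1 + e) := by
  induction hg using Submodule.span_induction with
  | mem g hg =>
    obtain ⟨L, hL, rfl⟩ := hg
    rw [← powerSumProd_cons]
    have : powerSumDegree L < e := hL
    exact powerSumProd_mem_degreeLT (by rw [powerSumDegree_cons]; omega)
  | zero => simp
  | add g h _ _ hg hh => rw [mul_add]; exact add_mem hg hh
  | smul c g _ hg => rw [mul_smul_comm]; exact Submodule.smul_mem _ _ hg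

theorem coeff_zero_removeVar (g : Gam) : (removeVar g).coeff 0 = g := by
  rw [Polynomial.coeff_zero_eq_eval_zero]
  have : ((Polynomial.evalRingHom (0 : Gam)).comp (removeVar : Gam →+* Polynomial Gam)) =
      RingHom.id Gam := by
    refine MvPolynomial.ringHom_ext (fun r => ?_) (fun m => ?_)
    · simp [removeVar, MvPolynomial.algebraMap_eq, Polynomial.algebraMap_apply]
    · simp [removeVar]
  exact congrArg (fun f => f g) this

/-- Every positive power of $T$ is paid for with power sums taken out of the product, so the
coefficient has strictly smaller degree. -/
theorem coeff_removeVar_powerSumProd (L : List ℕ) (k : ℕ) :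
    (removeVar (powerSumProd L)).coeff (k + 1) ∈ degreeLT (powerSumDegree L) := by
  induction L generalizing k with
  | nil => simp [powerSumProd, Polynomial.coeff_one]
  | cons a L ih =>
    rw [powerSumProd_cons, map_mul, removeVar, aeval_X, ← removeVar, sub_mul, Polynomial.coeff_sub,
      Polynomial.coeff_C_mul, powerSumDegree_cons, Polynomial.coeff_X_pow_mul']
    refine sub_mem (X_mul_mem_degreeLT (ih k) a) ?_
    split_ifs with h
    · rcases Nat.eq_zero_or_pos (k + 1 - (2 * a + 1)) with h0 | hpos
      · rw [h0, coeff_zero_removeVar]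
        exact powerSumProd_mem_degreeLT (by omega)
      · obtain ⟨j, hj⟩ := Nat.exists_eq_succ_of_ne_zero hpos.ne'
        rw [hj]
        exact degreeLT_mono (by omega) (ih j)
    · exact zero_mem _

theorem exists_mem_degreeLT (g : Gam) : ∃ e, g ∈ degreeLT e := by
  induction g using MvPolynomial.induction_on with
  | C a =>
    refine ⟨1, ?_⟩
    have : (C a : Gam) = a • powerSumProd [] := by simp [powerSumProd, smul_eq_C_mul]
    rw [this]
    exact Submodule.smul_mem _ _ (powerSumProd_mem_degreeLT (by simp [powerSumDegree]))
  | add p q hp hq =>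
    obtain ⟨d, hd⟩ := hp
    obtain ⟨e, he⟩ := hq
    exact ⟨max d e, add_mem (degreeLT_mono (le_max_left _ _) hd)
      (degreeLT_mono (le_max_right _ _) he)⟩
  | mul_X p n hp =>
    obtain ⟨e, he⟩ := hp
    exact ⟨_, mul_comm p (X n) ▸ X_mul_mem_degreeLT he n⟩

/-- The coefficient of $T^0$ in `removeVar g` is $g$ itself, so $gq_r$ is the leading term of
$B_rg$. The remaining terms have coefficients of smaller degree, which allows an induction. -/
theorem mul_rowQ_eq (g : Gam) (r : ℕ) :
    g * rowQ r = vertexOp (Polynomial.X ^ r) g -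
      ∑ k ∈ Finset.range (removeVar g).natDegree,
        (removeVar g).coeff (k + 1) * rowQ (r + (k + 1)) := by
  rw [vertexOp_X_pow_apply]
  have hsum : Polynomial.X ^ r * removeVar g = ∑ k ∈ Finset.range ((removeVar g).natDegree + 1),
      Polynomial.X ^ r * (Polynomial.C ((removeVar g).coeff k) * Polynomial.X ^ k) := by
    rw [← Finset.mul_sum, ← Polynomial.as_sum_range_C_mul_X_pow]
  rw [hsum, map_sum, Finset.sum_range_succ']
  have : ∀ k, rowQMap (Polynomial.X ^ r *
      (Polynomial.C ((removeVar g).coeff k) * Polynomial.X ^ k)) =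
      (removeVar g).coeff k * rowQ (r + k) := fun k => by
    rw [← rowQMap_C_mul_X_pow, pow_add, mul_left_comm]
  simp only [this]
  rw [coeff_zero_removeVar]
  simp

/-- This is Newton's identity of index $2a+1$ solved for its last power sum, whose cofactor is
$q_0=1$. -/
theorem X_eq_rowQ (a : ℕ) :
    (X a : Gam) = ((2 * (a : ℝ) + 1) / 2) • rowQ (2 * a + 1) -
      ∑ k ∈ Finset.range a, X k * rowQ (2 * (a - k)) := by
  have h := rowQZ_newton ((2 * a + 1 : ℕ) : ℤ) (a + 1) (by push_cast; omega)
  rw [Finset.sum_range_succ, rowQZ_natCast] at h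
  have h1 : rowQZ (((2 * a + 1 : ℕ) : ℤ) - 2 * (a : ℤ) - 1) = 1 := by
    rw [show (((2 * a + 1 : ℕ) : ℤ) - 2 * (a : ℤ) - 1) = ((0 : ℕ) : ℤ) by push_cast; ring,
      rowQZ_natCast, rowQ_zero]
  have h2 : ∀ k ∈ Finset.range a, (X k : Gam) * rowQZ (((2 * a + 1 : ℕ) : ℤ) - 2 * (k : ℤ) - 1) =
      X k * rowQ (2 * (a - k)) := fun k hk => by
    have := Finset.mem_range.1 hk
    rw [show (((2 * a + 1 : ℕ) : ℤ) - 2 * (k : ℤ) - 1) = ((2 * (a - k) : ℕ) : ℤ) by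
      push_cast [this.le]; ring, rowQZ_natCast]
  rw [h1, Finset.sum_congr rfl h2] at h
  have h3 : ((2 * (a : ℝ) + 1) / 2) • rowQ (2 * a + 1) =
      C (1 / 2 : ℝ) * (C ((((2 * a + 1 : ℕ) : ℤ)) : ℝ) * rowQ (2 * a + 1)) := by
    rw [← mul_assoc, ← C_mul, smul_eq_C_mul]
    congr 2
    push_cast
    ring
  have h4 : (C (1 / 2 : ℝ) : Gam) * 2 = 1 := by
    rw [← map_ofNat C 2, ← C_mul]; norm_num
  rw [h3, h, ← mul_assoc, h4]
  ring

theorem vertexOp_mem_span_schurQ {r : ℕ} (hr : r ≠ 0) {g : Gam}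
    (hg : g ∈ Submodule.span ℝ (Set.range schurQ)) :
    vertexOp (Polynomial.X ^ r) g ∈ Submodule.span ℝ (Set.range schurQ) := by
  induction hg using Submodule.span_induction with
  | mem g hg =>
    obtain ⟨μ, rfl⟩ := hg
    rw [schurQ_eq_listQ]
    have : vertexOp (Polynomial.X ^ r) (listQ μ.toList) = listQ (r :: μ.toList) := rfl
    rw [this]
    rcases listQ_eq_zero_or_schurQ (r :: μ.toList) (by
      intro s hs
      rcases List.mem_cons.1 hs with rfl | hs
      · exact hr
      · exact μ.ne_zero_of_mem_toList hs) with h | ⟨ν, -, h | h⟩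
    · rw [h]; exact zero_mem _
    · rw [h]; exact Submodule.subset_span ⟨ν, rfl⟩
    · rw [h]; exact neg_mem (Submodule.subset_span ⟨ν, rfl⟩)
  | zero => rw [map_zero]; exact zero_mem _
  | add g h _ _ hg hh => rw [map_add]; exact add_mem hg hh
  | smul c g _ hg => rw [map_smul]; exact Submodule.smul_mem _ _ hg

theorem one_mem_span_schurQ : (1 : Gam) ∈ Submodule.span ℝ (Set.range schurQ) := by
  refine Submodule.subset_span ⟨ofList [] List.Pairwise.nil, ?_⟩
  rw [schurQ_eq_listQ, toList_ofList _ _ (by simp)]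
  rfl

/-- The two claims feed each other. In a product of power sums, one factor is expanded by
`X_eq_rowQ`, which leaves products of a $q_r$ with something of smaller degree. Such a product
$gq_r$ equals $B_rg$, which stays in the span by straightening, minus products $g'q_s$ with $g'$ of
smaller degree than $g$. -/
theorem degreeLT_le_span_schurQ (e : ℕ) :
    degreeLT e ≤ Submodule.span ℝ (Set.range schurQ) ∧ ∀ r, r ≠ 0 → ∀ g ∈ degreeLT e,
      g * rowQ r ∈ Submodule.span ℝ (Set.range schurQ) := by
  induction e with
  | zero =>
    have : degreeLT 0 = ⊥ := by simp [degreeLT]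
    rw [this]
    refine ⟨bot_le, fun r _ g hg => ?_⟩
    rw [(Submodule.mem_bot ℝ).1 hg, zero_mul]
    exact zero_mem _
  | succ e ih =>
    have h1 : degreeLT (e + 1) ≤ Submodule.span ℝ (Set.range schurQ) := by
      refine Submodule.span_le.2 ?_
      rintro _ ⟨L, hL, rfl⟩
      have hL : powerSumDegree L < e + 1 := hL
      cases L with
      | nil => exact one_mem_span_schurQ
      | cons a L =>
        rw [powerSumDegree_cons] at hL
        rw [powerSumProd_cons, X_eq_rowQ, sub_mul, smul_mul_assoc, Finset.sum_mul]
        refine sub_mem (Submodule.smul_mem _ _ ?_) (sum_mem fun k hk => ?_)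
        · rw [mul_comm]
          exact ih.2 _ (by omega) _ (powerSumProd_mem_degreeLT (by omega))
        · have := Finset.mem_range.1 hk
          rw [mul_right_comm, ← powerSumProd_cons]
          exact ih.2 _ (by omega) _ (powerSumProd_mem_degreeLT (by rw [powerSumDegree_cons]; omega))
    refine ⟨h1, fun r hr g hg => ?_⟩
    induction hg using Submodule.span_induction with
    | mem g hg =>
      obtain ⟨L, hL, rfl⟩ := hg
      have hL : powerSumDegree L < e + 1 := hL
      rw [mul_rowQ_eq]
      refine sub_mem (vertexOp_mem_span_schurQ hr (h1 (powerSumProd_mem_degreeLT hL)))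
        (sum_mem fun k _ => ih.2 _ (by omega) _ ?_)
      exact degreeLT_mono (by omega) (coeff_removeVar_powerSumProd L k)
    | zero => rw [zero_mul]; exact zero_mem _
    | add g h _ _ hg hh => rw [add_mul]; exact add_mem hg hh
    | smul c g _ hg => rw [smul_mul_assoc]; exact Submodule.smul_mem _ _ hg

theorem span_schurQ : Submodule.span ℝ (Set.range schurQ) = ⊤ := by
  refine top_le_iff.1 fun g _ => ?_
  obtain ⟨e, he⟩ := exists_mem_degreeLT g
  exact (degreeLT_le_span_schurQ e).1 he

theorem circ_surjective : Function.Surjective circ := by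
  intro f
  obtain ⟨f, hf⟩ := f
  have : (OmegaPlus.momentAlgebra : Subalgebra ℝ C(OmegaPlus, ℝ)) ≤
      (OmegaPlus.momentAlgebra.val.comp circ).range := by
    refine Algebra.adjoin_le ?_
    rintro _ ⟨k, rfl⟩
    refine ⟨X (k : ℕ), ?_⟩
    have hk : 0 < (k : ℕ) := k.pos
    simp only [circ, OmegaPlus.evenMoment, AlgHom.toRingHom_eq_coe, RingHom.coe_coe,
      AlgHom.comp_apply, aeval_X, dif_pos hk]
    rfl
  obtain ⟨g, hg⟩ := this hf
  exact ⟨g, Subtype.ext hg⟩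

theorem span_circ_schurQ :
    Submodule.span ℝ (Set.range fun μ : StrictPartition => circ (schurQ μ)) = ⊤ := by
  have : (Set.range fun μ : StrictPartition => circ (schurQ μ)) =
      circ.toLinearMap '' Set.range schurQ := by
    rw [← Set.range_comp]; rfl
  rw [this, ← Submodule.map_span, span_schurQ, Submodule.map_top]
  exact LinearMap.range_eq_top.2 circ_surjective

end Span

end DoublySymmetric

/-! ### Differential operators on $\Gamma$ and their commutators with vertex operators. -/

namespace DoublySymmetric

open MvPolynomial StrictPartition

section FiniteSums

theorem pderiv_comm {σ : Type*} (i j : σ) (g : MvPolynomial σ ℝ) :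
    pderiv i (pderiv j g) = pderiv j (pderiv i g) := by
  classical
  rcases eq_or_ne i j with rfl | h
  · rfl
  ext s
  simp only [coeff_pderiv, Finsupp.add_apply]
  rw [add_right_comm, Finsupp.single_eq_of_ne h, Finsupp.single_eq_of_ne h.symm, add_zero, add_zero,
    mul_right_comm]

theorem sum_range_antidiagonal {M : Type*} [AddCommMonoid M] (N : ℕ) (F : ℕ → ℕ → M)
    (hF : ∀ i j, N ≤ i + j → F i j = 0) :
    ∑ i ∈ Finset.range N, ∑ j ∈ Finset.range N, F i j =
      ∑ c ∈ Finset.range N, ∑ p ∈ Finset.HasAntidiagonal.antidiagonal c, F p.1 p.2 := by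
  rw [← Finset.sum_product', ← Finset.sum_filter_of_ne (p := fun p => p.1 + p.2 < N)
    (fun p _ hp => by by_contra hc; exact hp (hF _ _ (not_lt.1 hc)))]
  have hmaps : ∀ p ∈ (Finset.range N ×ˢ Finset.range N).filter (fun p => p.1 + p.2 < N),
      p.1 + p.2 ∈ Finset.range N := fun p hp => Finset.mem_range.2 (Finset.mem_filter.1 hp).2
  rw [← Finset.sum_fiberwise_of_maps_to hmaps]
  refine Finset.sum_congr rfl fun c hc => Finset.sum_congr ?_ fun _ _ => rfl
  ext p
  have := Finset.mem_range.1 hc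
  simp only [Finset.mem_filter, Finset.mem_product, Finset.mem_range, Finset.HasAntidiagonal.mem_antidiagonal]
  omega

/-- A derivation is determined by the partial derivatives. -/
theorem derivation_eq_sum_pderiv (D : Derivation ℝ Gam Gam) (g : Gam) (N : ℕ)
    (hN : ∀ k, N ≤ k → pderiv k g = 0) :
    D g = ∑ k ∈ Finset.range N, pderiv k g * D (X k) := by
  have key : ∃ M, ∀ N, M ≤ N → D g = ∑ k ∈ Finset.range N, pderiv k g * D (X k) := by
    clear hN
    induction g using MvPolynomial.induction_on with
    | C a => exact ⟨0, fun N _ => by simp [derivation_C]⟩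
    | add p q hp hq =>
      obtain ⟨M, hM⟩ := hp
      obtain ⟨M', hM'⟩ := hq
      refine ⟨max M M', fun N hN => ?_⟩
      rw [map_add, hM N ((le_max_left _ _).trans hN), hM' N ((le_max_right _ _).trans hN),
        ← Finset.sum_add_distrib]
      exact Finset.sum_congr rfl fun k _ => by rw [map_add, add_mul]
    | mul_X p n hp =>
      obtain ⟨M, hM⟩ := hp
      refine ⟨max M (n + 1), fun N hN => ?_⟩
      rw [Derivation.leibniz, hM N ((le_max_left _ _).trans hN)]
      have : ∀ k, pderiv k (p * X n) * D (X k) = X n * (pderiv k p * D (X k)) +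
          if n = k then p * D (X n) else 0 := fun k => by
        rw [pderiv_mul, pderiv_X]
        rcases eq_or_ne n k with rfl | h
        · simp; ring
        · simp [h]; ring
      simp only [this, Finset.sum_add_distrib, Finset.sum_ite_eq, Finset.mem_range]
      rw [if_pos (by omega), ← Finset.mul_sum, smul_eq_mul, smul_eq_mul, add_comm]
  obtain ⟨M, hM⟩ := key
  rw [hM (max M N) (le_max_left _ _)]
  refine (Finset.sum_subset (Finset.range_subset_range.2 (le_max_right _ _)) fun k _ hk => ?_).symm
  rw [hN k (by simpa using hk), zero_mul]

theorem exists_pderiv_eq_zero (g : Gam) : ∃ N, ∀ M, N ≤ M → ∀ k, M ≤ k → pderiv k g = 0 :=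
  ⟨g.vars.sup id + 1, fun M hM k hk => pderiv_eq_zero_of_notMem_vars fun h => by
    have := Finset.le_sup (f := id) h
    simp only [id] at this
    omega⟩

/-- A derivation applied to a one-row `Q`-function. -/
theorem derivation_rowQZ (D : Derivation ℝ Gam Gam) (n : ℤ) (N : ℕ) (hN : n ≤ 2 * N) :
    D (rowQZ n) = ∑ k ∈ Finset.range N,
      C (2 / (2 * (k : ℝ) + 1)) * (D (X k) * rowQZ (n - 2 * k - 1)) := by
  rcases lt_or_ge n 0 with h | h
  · rw [rowQZ_of_neg h, map_zero, Finset.sum_eq_zero]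
    intro k _
    rw [rowQZ_of_neg (by omega), mul_zero, mul_zero]
  obtain ⟨m, rfl⟩ := Int.eq_ofNat_of_zero_le h
  clear h
  -- This is the identity $D(\exp F)=D(F)\exp F$ read off coefficientwise. Applying $D$ to Newton's
  -- identity and inserting the induction hypothesis gives a double sum, whose inner sum is again
  -- evaluated by Newton's identity.
  induction m using Nat.strong_induction_on with
  | _ m ih =>
    rcases Nat.eq_zero_or_pos m with rfl | hm
    · rw [Finset.sum_eq_zero, rowQZ_natCast, rowQ_zero, Derivation.map_one_eq_zero]
      intro k _
      rw [rowQZ_of_neg (by omega), mul_zero, mul_zero]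
    have hne : (C ((m : ℤ) : ℝ) : Gam) ≠ 0 := by
      rw [Ne, C_eq_zero]; exact_mod_cast hm.ne'
    apply mul_left_cancel₀ hne
    have h1 := congrArg D (rowQZ_newton (m : ℤ) N hN)
    have h2 : (2 : Gam) = C 2 := (map_ofNat C 2).symm
    rw [Derivation.leibniz, derivation_C, smul_zero, add_zero, smul_eq_mul] at h1
    rw [h1, h2, Derivation.leibniz, derivation_C, smul_zero, add_zero, smul_eq_mul, map_sum,
      Finset.sum_congr rfl fun k _ => Derivation.leibniz D (X k) (rowQZ ((m : ℤ) - 2 * k - 1)),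
      Finset.sum_add_distrib]
    have h3 : ∀ k ∈ Finset.range N, X k • D (rowQZ ((m : ℤ) - 2 * k - 1)) =
        ∑ l ∈ Finset.range N, C (2 / (2 * (l : ℝ) + 1)) * D (X l) *
          (X k * rowQZ (((m : ℤ) - 2 * l - 1) - 2 * k - 1)) := fun k _ => by
      have : D (rowQZ ((m : ℤ) - 2 * k - 1)) = ∑ l ∈ Finset.range N,
          C (2 / (2 * (l : ℝ) + 1)) * (D (X l) * rowQZ (((m : ℤ) - 2 * k - 1) - 2 * l - 1)) := by
        rcases lt_or_ge ((m : ℤ) - 2 * k - 1) 0 with h | h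
        · rw [rowQZ_of_neg h, map_zero, Finset.sum_eq_zero]
          intro l _
          rw [rowQZ_of_neg (by omega), mul_zero, mul_zero]
        · obtain ⟨j, hj⟩ := Int.eq_ofNat_of_zero_le h
          rw [hj]
          exact ih j (by omega) (by omega)
      rw [this, smul_eq_mul, Finset.mul_sum]
      refine Finset.sum_congr rfl fun l _ => ?_
      rw [show (m : ℤ) - 2 * k - 1 - 2 * l - 1 = (m : ℤ) - 2 * l - 1 - 2 * k - 1 by ring]
      ring
    rw [Finset.sum_congr rfl h3, Finset.sum_comm, ← Finset.sum_add_distrib, Finset.mul_sum,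
      Finset.mul_sum]
    refine Finset.sum_congr rfl fun l _ => ?_
    have h4 := rowQZ_newton ((m : ℤ) - 2 * l - 1) N (by omega)
    rw [← Finset.mul_sum, mul_add, smul_eq_mul]
    have h5 : (C ((m : ℤ) : ℝ) : Gam) * C (2 / (2 * (l : ℝ) + 1)) =
        C 2 + C (2 / (2 * (l : ℝ) + 1)) * C ((((m : ℤ) - 2 * l - 1 : ℤ)) : ℝ) := by
      rw [← C_mul, ← C_mul, ← C_add]
      congr 1
      have : 2 * (l : ℝ) + 1 ≠ 0 := by positivity
      push_cast
      field_simp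
      ring
    rw [h2] at h4
    linear_combination (-(C (2 / (2 * (l : ℝ) + 1)) * D (X l))) * h4 -
      D (X l) * rowQZ ((m : ℤ) - 2 * l - 1) * h5

theorem pderiv_rowQZ (i : ℕ) (n : ℤ) :
    pderiv i (rowQZ n) = C (2 / (2 * (i : ℝ) + 1)) * rowQZ (n - 2 * i - 1) := by
  rw [derivation_rowQZ (pderiv i) n (n.toNat + i + 1) (by omega), Finset.sum_eq_single i]
  · rw [pderiv_X_self, one_mul]
  · intro k _ hk
    rw [pderiv_X_of_ne hk, zero_mul, mul_zero]
  · intro h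
    exact absurd (Finset.mem_range.2 (by omega)) h

end FiniteSums

section Operators

/-- `∑ p_{2a+1} p_{2b+1}` over `a + b + 1 = i`. -/
noncomputable def powerSumConv : ℕ → Gam
  | 0 => 0
  | i + 1 => ∑ p ∈ Finset.HasAntidiagonal.antidiagonal i, X p.1 * X p.2

/-- The derivation `p_{2j+1} ↦ (2j+1) p_{2i+2j+1}`. -/
noncomputable def shiftDer (i : ℕ) : Derivation ℝ Gam Gam :=
  mkDerivation ℝ fun j => C (2 * (j : ℝ) + 1) * X (i + j)

@[simp] theorem shiftDer_X (i j : ℕ) : shiftDer i (X j) = C (2 * (j : ℝ) + 1) * X (i + j) :=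
  mkDerivation_X _ _ _

theorem vertexOp_X_pow_C (r : ℕ) (a : ℝ) :
    vertexOp (Polynomial.X ^ r) (C a) = C a * rowQ r := by
  have : (C a : Gam) = a • 1 := by rw [smul_eq_C_mul, mul_one]
  rw [this, map_smul, vertexOp_X_pow_one, smul_mul_assoc, one_mul]

/-- This is the case $g=1$ of the relation below. By Newton's identity, $(r+2i)q_{r+2i}$ is a sum
over all power sums: its tail, from index $i$ on, is `shiftDer i (rowQ r)`, and its head is what
$B_r$ produces from `powerSumConv i`, up to the $i$ extra copies of $q_{r+2i}$ that arise there. -/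
theorem shiftDer_rowQ_add (i r : ℕ) :
    shiftDer i (rowQ r) + powerSumConv i * rowQ r =
      vertexOp (Polynomial.X ^ r) (powerSumConv i) +
        C ((r : ℝ) + i) * rowQ (r + 2 * i) := by
  have h2 : (2 : Gam) = C 2 := (map_ofNat C 2).symm
  have hN := rowQZ_newton ((r + 2 * i : ℕ) : ℤ) (i + r) (by push_cast; omega)
  rw [Finset.sum_range_add, rowQZ_natCast] at hN
  have h1 : shiftDer i (rowQ r) =
      2 * ∑ k ∈ Finset.range r, X (i + k) * rowQZ ((r : ℤ) - 2 * k - 1) := by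
    rw [← rowQZ_natCast, derivation_rowQZ (shiftDer i) r r (by omega), Finset.mul_sum]
    refine Finset.sum_congr rfl fun k _ => ?_
    rw [shiftDer_X, h2]
    have : (C (2 / (2 * (k : ℝ) + 1)) : Gam) * C (2 * (k : ℝ) + 1) = C 2 := by
      rw [← C_mul]
      congr 1
      have : 2 * (k : ℝ) + 1 ≠ 0 := by positivity
      field_simp
    linear_combination (X (i + k) * rowQZ ((r : ℤ) - 2 * k - 1)) * this
  have h3 : ∑ k ∈ Finset.range r, X (i + k) *
      rowQZ (((r + 2 * i : ℕ) : ℤ) - 2 * ((i + k : ℕ) : ℤ) - 1) =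
      ∑ k ∈ Finset.range r, (X (i + k) : Gam) * rowQZ ((r : ℤ) - 2 * k - 1) :=
    Finset.sum_congr rfl fun k _ => by
      congr 2
      push_cast
      ring
  rw [h3] at hN
  cases i with
  | zero =>
    simp only [powerSumConv, Finset.range_zero, Finset.sum_empty, zero_add, map_zero, zero_mul,
      add_zero, mul_zero, Nat.cast_zero] at hN h1 ⊢
    rw [h1, ← hN]
    simp
  | succ i =>
    have h4 : vertexOp (Polynomial.X ^ r) (powerSumConv (i + 1)) =
        powerSumConv (i + 1) * rowQ r - 2 * ∑ a ∈ Finset.range (i + 1),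
          X a * rowQZ (((r + 2 * (i + 1) : ℕ) : ℤ) - 2 * (a : ℤ) - 1) +
        C ((i : ℝ) + 1) * rowQ (r + 2 * (i + 1)) := by
      have h5 : ∀ p ∈ Finset.HasAntidiagonal.antidiagonal i, vertexOp (Polynomial.X ^ r) (X p.1 * X p.2) =
          X p.1 * X p.2 * rowQ r -
            (X p.1 * rowQZ (((r + 2 * (i + 1) : ℕ) : ℤ) - 2 * (p.1 : ℤ) - 1) +
              X p.2 * rowQZ (((r + 2 * (i + 1) : ℕ) : ℤ) - 2 * (p.2 : ℤ) - 1)) +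
            rowQ (r + 2 * (i + 1)) := fun p hp => by
        have hp : p.1 + p.2 = i := Finset.HasAntidiagonal.mem_antidiagonal.1 hp
        have e1 : ∀ (s k : ℕ), vertexOp (Polynomial.X ^ s) (X k) =
            X k * rowQ s - rowQ (s + (2 * k + 1)) := fun s k => by
          have := vertexOp_X_pow_X_mul s k 1
          rwa [mul_one, vertexOp_X_pow_one, vertexOp_X_pow_one] at this
        rw [vertexOp_X_pow_X_mul, e1, e1,
          show ((r + 2 * (i + 1) : ℕ) : ℤ) - 2 * (p.1 : ℤ) - 1 = ((r + (2 * p.2 + 1) : ℕ) : ℤ) by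
            push_cast; omega,
          show ((r + 2 * (i + 1) : ℕ) : ℤ) - 2 * (p.2 : ℤ) - 1 = ((r + (2 * p.1 + 1) : ℕ) : ℤ) by
            push_cast; omega, rowQZ_natCast, rowQZ_natCast,
          show r + (2 * p.1 + 1) + (2 * p.2 + 1) = r + 2 * (i + 1) by omega]
        ring
      have h6 : ∑ p ∈ Finset.HasAntidiagonal.antidiagonal i, (X p.1 : Gam) *
          rowQZ (((r + 2 * (i + 1) : ℕ) : ℤ) - 2 * (p.1 : ℤ) - 1) = ∑ a ∈ Finset.range (i + 1),
          X a * rowQZ (((r + 2 * (i + 1) : ℕ) : ℤ) - 2 * (a : ℤ) - 1) := by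
        rw [Finset.Nat.sum_antidiagonal_eq_sum_range_succ_mk]
      have h7 : ∑ p ∈ Finset.HasAntidiagonal.antidiagonal i, (X p.2 : Gam) *
          rowQZ (((r + 2 * (i + 1) : ℕ) : ℤ) - 2 * (p.2 : ℤ) - 1) =
          ∑ p ∈ Finset.HasAntidiagonal.antidiagonal i, (X p.1 : Gam) *
          rowQZ (((r + 2 * (i + 1) : ℕ) : ℤ) - 2 * (p.1 : ℤ) - 1) := by
        rw [← Finset.Nat.sum_antidiagonal_swap]
        rfl
      rw [powerSumConv, map_sum, Finset.sum_congr rfl h5, Finset.sum_add_distrib,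
        Finset.sum_sub_distrib, Finset.sum_add_distrib, Finset.sum_mul, Finset.sum_const,
        Finset.Nat.card_antidiagonal, nsmul_eq_mul, h7, h6]
      simp only [two_mul, map_add, map_natCast, map_one]
      push_cast
      ring
    rw [h4, h1]
    have h6 : (C (((r + 2 * (i + 1) : ℕ) : ℤ) : ℝ) : Gam) =
        C ((i : ℝ) + 1) + C ((r : ℝ) + (i + 1 : ℕ)) := by
      rw [← C_add]
      congr 1
      push_cast
      ring
    rw [h6] at hN
    linear_combination -hN

/-- In commutator form: $[D_i+P_i,B_r]=(r+i)B_{r+2i}$. Multiplying $g$ by $p_{2k+1}$ preserves the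
relation, because $D_ip_{2k+1}=(2k+1)p_{2i+2k+1}$ accounts exactly for the growth of the factor from
$r+i$ to $r+2k+1+i$. -/
theorem shiftDer_vertexOp (i r : ℕ) (g : Gam) :
    shiftDer i (vertexOp (Polynomial.X ^ r) g) +
        powerSumConv i * vertexOp (Polynomial.X ^ r) g =
      vertexOp (Polynomial.X ^ r) (shiftDer i g + powerSumConv i * g) +
        C ((r : ℝ) + i) * vertexOp (Polynomial.X ^ (r + 2 * i)) g := by
  induction g using MvPolynomial.induction_on generalizing r with
  | C a =>
    have h : powerSumConv i * C a = a • powerSumConv i := by rw [smul_eq_C_mul, mul_comm]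
    rw [vertexOp_X_pow_C, vertexOp_X_pow_C, derivation_C, zero_add, h, map_smul, smul_eq_C_mul,
      Derivation.leibniz, derivation_C, smul_zero, add_zero, smul_eq_mul]
    linear_combination C a * shiftDer_rowQ_add i r
  | add p q hp hq =>
    simp only [map_add, mul_add] at hp hq ⊢
    linear_combination hp r + hq r
  | mul_X p k hp =>
    rw [mul_comm p (X k)]
    have e1 : shiftDer i (X k * p) + powerSumConv i * (X k * p) =
        X k * (shiftDer i p + powerSumConv i * p) +
          (2 * (k : ℝ) + 1) • (X (i + k) * p) := by
      rw [Derivation.leibniz, shiftDer_X, smul_eq_C_mul, smul_eq_mul, smul_eq_mul]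
      ring
    rw [e1, map_add, map_smul, vertexOp_X_pow_X_mul, vertexOp_X_pow_X_mul, vertexOp_X_pow_X_mul,
      vertexOp_X_pow_X_mul, map_sub, Derivation.leibniz, shiftDer_X, smul_eq_mul, smul_eq_mul,
      smul_eq_C_mul]
    have h1 := hp r
    have h2 := hp (r + (2 * k + 1))
    rw [show r + (2 * k + 1) + 2 * i = r + 2 * i + (2 * k + 1) by omega] at h2
    rw [show r + (2 * (i + k) + 1) = r + 2 * i + (2 * k + 1) by omega]
    have h3 : (C (((r + (2 * k + 1) : ℕ) : ℝ) + i) : Gam) =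
        C ((r : ℝ) + i) + C (2 * (k : ℝ) + 1) := by
      rw [← C_add]
      congr 1
      push_cast
      ring
    rw [h3] at h2
    linear_combination X k * h1 - h2

/-- The part of degree `-1` and order two of the generator, truncated to the variables
`p_1, …, p_{2N-1}`. -/
noncomputable def lowerOpTrunc (N : ℕ) (g : Gam) : Gam :=
  ∑ i ∈ Finset.range N, ∑ j ∈ Finset.range N,
      C ((2 * (i : ℝ) + 1) * (2 * (j : ℝ) + 1)) * X (i + j) * pderiv i (pderiv j g) +
    2 * ∑ k ∈ Finset.range N, C (2 * (k : ℝ) + 1) * powerSumConv k * pderiv k g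

theorem lowerOpTrunc_eq {g : Gam} {N M : ℕ} (hNM : N ≤ M) (hN : ∀ k, N ≤ k → pderiv k g = 0) :
    lowerOpTrunc M g = lowerOpTrunc N g := by
  have hcomm := fun i j => pderiv_comm i j g
  unfold lowerOpTrunc
  have hsub := Finset.range_subset_range.2 hNM
  congr 1
  · rw [← Finset.sum_subset hsub]
    · refine Finset.sum_congr rfl fun i _ => (Finset.sum_subset hsub fun j _ hj => ?_).symm
      rw [hN j (by simpa using hj), map_zero, mul_zero]
    · intro i _ hi
      refine Finset.sum_eq_zero fun j _ => ?_
      rw [hcomm, hN i (by simpa using hi), map_zero, mul_zero]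
  · rw [← Finset.sum_subset hsub]
    intro k _ hk
    rw [hN k (by simpa using hk), mul_zero]

theorem lowerOpTrunc_add (N : ℕ) (g h : Gam) :
    lowerOpTrunc N (g + h) = lowerOpTrunc N g + lowerOpTrunc N h := by
  simp only [lowerOpTrunc, map_add, mul_add, Finset.sum_add_distrib]
  ring

theorem lowerOpTrunc_smul (N : ℕ) (c : ℝ) (g : Gam) :
    lowerOpTrunc N (c • g) = c • lowerOpTrunc N g := by
  simp only [lowerOpTrunc, Derivation.map_smul, mul_smul_comm, ← Finset.smul_sum, smul_add]

/-- The part of degree `-1` and order two of the generator. -/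
noncomputable def lowerOp : Gam →ₗ[ℝ] Gam where
  toFun g := lowerOpTrunc (exists_pderiv_eq_zero g).choose g
  map_add' g h := by
    set N := max (exists_pderiv_eq_zero (g + h)).choose
      (max (exists_pderiv_eq_zero g).choose (exists_pderiv_eq_zero h).choose)
    rw [← lowerOpTrunc_eq (M := N) (by simp [N]) ((exists_pderiv_eq_zero (g + h)).choose_spec _ le_rfl),
      ← lowerOpTrunc_eq (M := N) (by simp [N]) ((exists_pderiv_eq_zero g).choose_spec _ le_rfl),
      ← lowerOpTrunc_eq (M := N) (by simp [N]) ((exists_pderiv_eq_zero h).choose_spec _ le_rfl),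
      lowerOpTrunc_add]
  map_smul' c g := by
    set N := max (exists_pderiv_eq_zero (c • g)).choose (exists_pderiv_eq_zero g).choose
    rw [← lowerOpTrunc_eq (M := N) (by simp [N]) ((exists_pderiv_eq_zero (c • g)).choose_spec _ le_rfl),
      ← lowerOpTrunc_eq (M := N) (by simp [N]) ((exists_pderiv_eq_zero g).choose_spec _ le_rfl),
      lowerOpTrunc_smul, RingHom.id_apply]

theorem lowerOp_eq {g : Gam} {N : ℕ} (hN : ∀ k, N ≤ k → pderiv k g = 0) :
    lowerOp g = lowerOpTrunc N g := by
  change lowerOpTrunc _ g = _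
  rw [← lowerOpTrunc_eq (le_max_left _ N) ((exists_pderiv_eq_zero g).choose_spec _ le_rfl),
    lowerOpTrunc_eq (le_max_right _ N) hN]

theorem lowerOp_C (a : ℝ) : lowerOp (C a) = 0 := by
  rw [lowerOp_eq (N := 0) (fun k _ => pderiv_C)]
  simp [lowerOpTrunc]

/-- The commutator of a second-order operator with a multiplication has order one. Here it is twice
$2k+1$ times `shiftDer k` plus multiplication by `powerSumConv k`, which is the purpose of these
two. -/
theorem lowerOp_X_mul (k : ℕ) (g : Gam) :
    lowerOp (X k * g) = X k * lowerOp g +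
      C (2 * (2 * (k : ℝ) + 1)) * (shiftDer k g + powerSumConv k * g) := by
  obtain ⟨N₀, hN₀⟩ := exists_pderiv_eq_zero g
  have hg := hN₀ (max N₀ (k + 1)) (le_max_left _ _)
  set N := max N₀ (k + 1)
  have hkN : k < N := by simp [N]
  have hX : ∀ j, pderiv j (X k * g) = X k * pderiv j g + if k = j then g else 0 := fun j => by
    rw [pderiv_mul, pderiv_X]
    rcases eq_or_ne k j with rfl | h
    · simp; ring
    · simp [h]
  have hXg : ∀ j, N ≤ j → pderiv j (X k * g) = 0 := fun j hj => by
    rw [hX, hg j hj, if_neg (by omega)]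
    simp
  rw [lowerOp_eq hXg, lowerOp_eq hg, derivation_eq_sum_pderiv (shiftDer k) g N hg]
  have hXX : ∀ i j, pderiv i (pderiv j (X k * g)) = X k * pderiv i (pderiv j g) +
      (if k = i then pderiv j g else 0) + if k = j then pderiv i g else 0 := fun i j => by
    rw [hX, map_add, pderiv_mul, pderiv_X, apply_ite (pderiv i), map_zero]
    rcases eq_or_ne k i with rfl | h
    · simp; ring
    · simp [h]
  have s1 : ∑ i ∈ Finset.range N, ∑ j ∈ Finset.range N,
      C ((2 * (i : ℝ) + 1) * (2 * (j : ℝ) + 1)) * X (i + j) * pderiv i (pderiv j (X k * g)) =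
      ∑ i ∈ Finset.range N, ∑ j ∈ Finset.range N,
        C ((2 * (i : ℝ) + 1) * (2 * (j : ℝ) + 1)) * X (i + j) * (X k * pderiv i (pderiv j g)) +
      ∑ j ∈ Finset.range N, C ((2 * (k : ℝ) + 1) * (2 * (j : ℝ) + 1)) * X (k + j) * pderiv j g +
      ∑ i ∈ Finset.range N, C ((2 * (i : ℝ) + 1) * (2 * (k : ℝ) + 1)) * X (i + k) *
        pderiv i g := by
    have h1 : ∑ j ∈ Finset.range N, C ((2 * (k : ℝ) + 1) * (2 * (j : ℝ) + 1)) * X (k + j) *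
        pderiv j g = ∑ i ∈ Finset.range N, ∑ j ∈ Finset.range N,
          if k = i then C ((2 * (i : ℝ) + 1) * (2 * (j : ℝ) + 1)) * X (i + j) * pderiv j g
          else 0 := by
      rw [Finset.sum_comm]
      exact Finset.sum_congr rfl fun j _ => by
        rw [Finset.sum_ite_eq, if_pos (Finset.mem_range.2 hkN)]
    have h2 : ∑ i ∈ Finset.range N, C ((2 * (i : ℝ) + 1) * (2 * (k : ℝ) + 1)) * X (i + k) *
        pderiv i g = ∑ i ∈ Finset.range N, ∑ j ∈ Finset.range N,
          if k = j then C ((2 * (i : ℝ) + 1) * (2 * (j : ℝ) + 1)) * X (i + j) * pderiv i g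
          else 0 :=
      Finset.sum_congr rfl fun j _ => by
        rw [Finset.sum_ite_eq, if_pos (Finset.mem_range.2 hkN)]
    rw [h1, h2, ← Finset.sum_add_distrib, ← Finset.sum_add_distrib]
    refine Finset.sum_congr rfl fun i _ => ?_
    rw [← Finset.sum_add_distrib, ← Finset.sum_add_distrib]
    refine Finset.sum_congr rfl fun j _ => ?_
    rw [hXX]
    split_ifs <;> ring
  have s2 : ∑ j ∈ Finset.range N, C (2 * (j : ℝ) + 1) * powerSumConv j * pderiv j (X k * g) =
      ∑ j ∈ Finset.range N, C (2 * (j : ℝ) + 1) * powerSumConv j * (X k * pderiv j g) +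
        C (2 * (k : ℝ) + 1) * powerSumConv k * g := by
    have h1 : C (2 * (k : ℝ) + 1) * powerSumConv k * g = ∑ j ∈ Finset.range N,
        if k = j then C (2 * (j : ℝ) + 1) * powerSumConv j * g else 0 := by
      rw [Finset.sum_ite_eq, if_pos (Finset.mem_range.2 hkN)]
    rw [h1, ← Finset.sum_add_distrib]
    refine Finset.sum_congr rfl fun j _ => ?_
    rw [hX]
    split_ifs <;> ring
  simp only [lowerOpTrunc, shiftDer_X]
  rw [s1, s2]
  have e1 : ∑ j ∈ Finset.range N, C ((2 * (k : ℝ) + 1) * (2 * (j : ℝ) + 1)) * X (k + j) *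
      pderiv j g = C (2 * (k : ℝ) + 1) * ∑ j ∈ Finset.range N,
        pderiv j g * (C (2 * (j : ℝ) + 1) * X (k + j)) := by
    rw [Finset.mul_sum]
    refine Finset.sum_congr rfl fun j _ => ?_
    rw [C_mul]
    ring
  have e2 : ∑ i ∈ Finset.range N, C ((2 * (i : ℝ) + 1) * (2 * (k : ℝ) + 1)) * X (i + k) *
      pderiv i g = C (2 * (k : ℝ) + 1) * ∑ j ∈ Finset.range N,
        pderiv j g * (C (2 * (j : ℝ) + 1) * X (k + j)) := by
    rw [← e1]
    refine Finset.sum_congr rfl fun j _ => ?_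
    rw [mul_comm (2 * (j : ℝ) + 1), add_comm j]
  have e3 : ∑ i ∈ Finset.range N, ∑ j ∈ Finset.range N,
      C ((2 * (i : ℝ) + 1) * (2 * (j : ℝ) + 1)) * X (i + j) * (X k * pderiv i (pderiv j g)) =
      X k * ∑ i ∈ Finset.range N, ∑ j ∈ Finset.range N,
      C ((2 * (i : ℝ) + 1) * (2 * (j : ℝ) + 1)) * X (i + j) * pderiv i (pderiv j g) := by
    rw [Finset.mul_sum]
    refine Finset.sum_congr rfl fun i _ => ?_
    rw [Finset.mul_sum]
    refine Finset.sum_congr rfl fun j _ => ?_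
    ring
  have e4 : ∑ j ∈ Finset.range N, C (2 * (j : ℝ) + 1) * powerSumConv j * (X k * pderiv j g) =
      X k * ∑ j ∈ Finset.range N, C (2 * (j : ℝ) + 1) * powerSumConv j * pderiv j g := by
    rw [Finset.mul_sum]
    refine Finset.sum_congr rfl fun j _ => ?_
    ring
  have h2 : (C (2 * (2 * (k : ℝ) + 1)) : Gam) = 2 * C (2 * (k : ℝ) + 1) := by
    rw [C_mul]; rfl
  rw [e1, e2, e3, e4, h2]
  ring

/-- Each derivative of a one-row function lowers its index and brings a factor $2/(2i+1)$ that
cancels against the weights of the operator. The result is a single sum of terms $p\,q$ and a double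
sum of terms $p\,p\,q$. Newton's identity turns the double sum into a single one, and a second
application evaluates the total. -/
theorem lowerOp_rowQ_succ (m : ℕ) :
    lowerOp (rowQ (m + 1)) = C (((m : ℝ) + 1) * m) * rowQ m := by
  have h2 : (2 : Gam) = C 2 := (map_ofNat C 2).symm
  set N := m + 1 with hNdef
  have hN : ∀ k, N ≤ k → pderiv k (rowQ (m + 1)) = 0 := fun k hk => by
    rw [← rowQZ_natCast, pderiv_rowQZ, rowQZ_of_neg (by push_cast; omega), mul_zero]
  rw [lowerOp_eq hN, lowerOpTrunc]
  have hnew : ∀ n : ℤ, n ≤ 2 * N → C (n : ℝ) * rowQZ n =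
      2 * ∑ k ∈ Finset.range N, X k * rowQZ (n - 2 * k - 1) := fun n hn => rowQZ_newton n N hn
  have e1 : ∑ i ∈ Finset.range N, ∑ j ∈ Finset.range N,
      C ((2 * (i : ℝ) + 1) * (2 * (j : ℝ) + 1)) * X (i + j) *
        pderiv i (pderiv j (rowQ (m + 1))) =
      4 * ∑ c ∈ Finset.range N, C ((c : ℝ) + 1) * (X c * rowQZ ((m : ℤ) - 2 * c - 1)) := by
    have : ∀ i j : ℕ, C ((2 * (i : ℝ) + 1) * (2 * (j : ℝ) + 1)) * X (i + j) *
        pderiv i (pderiv j (rowQ (m + 1))) =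
        C 4 * (X (i + j) * rowQZ ((m : ℤ) - 2 * (i + j : ℕ) - 1)) := fun i j => by
      rw [← rowQZ_natCast, pderiv_rowQZ, pderiv_C_mul, pderiv_rowQZ,
        show ((m + 1 : ℕ) : ℤ) - 2 * j - 1 - 2 * i - 1 = (m : ℤ) - 2 * (i + j : ℕ) - 1 by
          push_cast; ring]
      have : (C ((2 * (i : ℝ) + 1) * (2 * (j : ℝ) + 1)) : Gam) *
          (C (2 / (2 * (j : ℝ) + 1)) * C (2 / (2 * (i : ℝ) + 1))) = C 4 := by
        rw [← C_mul, ← C_mul]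
        congr 1
        have h1 : 2 * (i : ℝ) + 1 ≠ 0 := by positivity
        have h2 : 2 * (j : ℝ) + 1 ≠ 0 := by positivity
        field_simp
        norm_num
      linear_combination (X (i + j) * rowQZ ((m : ℤ) - 2 * (i + j : ℕ) - 1)) * this
    simp only [this]
    rw [sum_range_antidiagonal N (fun i j => (C 4 : Gam) *
      (X (i + j) * rowQZ ((m : ℤ) - 2 * (i + j : ℕ) - 1)))]
    · rw [Finset.mul_sum]
      refine Finset.sum_congr rfl fun c _ => ?_
      have h4 : (C 4 : Gam) = 4 := map_ofNat C 4
      rw [Finset.sum_congr rfl fun p hp => by rw [Finset.HasAntidiagonal.mem_antidiagonal.1 hp],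
        Finset.sum_const, Finset.Nat.card_antidiagonal, nsmul_eq_mul, h4]
      simp only [map_add, map_natCast, map_one]
      push_cast
      ring
    · intro i j hij
      rw [rowQZ_of_neg (by omega), mul_zero, mul_zero]
  have e2 : ∑ k ∈ Finset.range N, C (2 * (k : ℝ) + 1) * powerSumConv k *
      pderiv k (rowQ (m + 1)) = 2 * ∑ i ∈ Finset.range N, ∑ j ∈ Finset.range N,
        X i * (X j * rowQZ ((m : ℤ) - 2 * i - 1 - 2 * j - 1)) := by
    have : ∀ k : ℕ, C (2 * (k : ℝ) + 1) * powerSumConv k * pderiv k (rowQ (m + 1)) =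
        2 * (powerSumConv k * rowQZ ((m : ℤ) - 2 * k)) := fun k => by
      rw [← rowQZ_natCast, pderiv_rowQZ,
        show ((m + 1 : ℕ) : ℤ) - 2 * k - 1 = (m : ℤ) - 2 * k by push_cast; ring]
      have : (C (2 * (k : ℝ) + 1) : Gam) * C (2 / (2 * (k : ℝ) + 1)) = 2 := by
        rw [← C_mul, h2]
        congr 1
        have : 2 * (k : ℝ) + 1 ≠ 0 := by positivity
        field_simp
      linear_combination (powerSumConv k * rowQZ ((m : ℤ) - 2 * k)) * this
    simp only [this]
    rw [sum_range_antidiagonal N (fun i j => (X i : Gam) *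
      (X j * rowQZ ((m : ℤ) - 2 * i - 1 - 2 * j - 1))), ← Finset.mul_sum]
    · congr 1
      have h0 : ∀ k, N ≤ k → powerSumConv k * rowQZ ((m : ℤ) - 2 * k) = 0 := fun k hk => by
        rw [rowQZ_of_neg (by omega), mul_zero]
      have : ∑ k ∈ Finset.range N, powerSumConv k * rowQZ ((m : ℤ) - 2 * k) =
          ∑ k ∈ Finset.range (N + 1), powerSumConv k * rowQZ ((m : ℤ) - 2 * k) := by
        rw [Finset.sum_range_succ _ N, h0 N le_rfl, add_zero]
      rw [this, Finset.sum_range_succ', powerSumConv, zero_mul, add_zero]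
      refine Finset.sum_congr rfl fun c _ => ?_
      rw [powerSumConv, Finset.sum_mul]
      refine Finset.sum_congr rfl fun p hp => ?_
      have hp : p.1 + p.2 = c := Finset.HasAntidiagonal.mem_antidiagonal.1 hp
      rw [mul_assoc]
      congr 3
      push_cast
      omega
    · intro i j hij
      rw [rowQZ_of_neg (by omega), mul_zero, mul_zero]
  rw [e1, e2]
  have h3 := hnew m (by omega)
  have h4 : ∀ i ∈ Finset.range N, ∑ j ∈ Finset.range N,
      X i * (X j * rowQZ ((m : ℤ) - 2 * i - 1 - 2 * j - 1)) * 2 =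
      C (((m : ℤ) - 2 * i - 1 : ℤ) : ℝ) * (X i * rowQZ ((m : ℤ) - 2 * i - 1)) := fun i _ => by
    have := hnew ((m : ℤ) - 2 * i - 1) (by omega)
    rw [← Finset.sum_mul, ← Finset.mul_sum]
    linear_combination (-X i) * this
  have h5 : 2 * ∑ i ∈ Finset.range N, ∑ j ∈ Finset.range N,
      X i * (X j * rowQZ ((m : ℤ) - 2 * i - 1 - 2 * j - 1)) +
      2 * ∑ c ∈ Finset.range N, C ((c : ℝ) + 1) * (X c * rowQZ ((m : ℤ) - 2 * c - 1)) =
      C ((m : ℝ) + 1) * ∑ i ∈ Finset.range N, X i * rowQZ ((m : ℤ) - 2 * i - 1) := by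
    rw [mul_comm 2 (∑ i ∈ Finset.range N, ∑ j ∈ Finset.range N, _), Finset.sum_mul,
      Finset.sum_congr rfl fun i _ => Finset.sum_mul _ _ _, Finset.sum_congr rfl h4,
      Finset.mul_sum, Finset.mul_sum, ← Finset.sum_add_distrib]
    refine Finset.sum_congr rfl fun i _ => ?_
    rw [h2]
    have : (C (((m : ℤ) - 2 * i - 1 : ℤ) : ℝ) : Gam) + C 2 * C ((i : ℝ) + 1) = C ((m : ℝ) + 1) := by
      rw [← C_mul, ← C_add]
      congr 1
      push_cast
      ring
    linear_combination (X i * rowQZ ((m : ℤ) - 2 * i - 1)) * this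
  rw [rowQZ_natCast, Int.cast_natCast] at h3
  rw [C_mul]
  linear_combination 2 * h5 - C ((m : ℝ) + 1) * h3

/-- In commutator form: $[\Delta,B_r]=r(r-1)B_{r-1}$. The induction over monomials uses the
commutator of $\Delta$ with $p_{2k+1}$, the relation `shiftDer_vertexOp`, and
$(r+2k+1)(r+2k)=r(r-1)+2(2k+1)(r+k)$. At $r=0$ the truncated index is harmless since its coefficient
is zero. -/
theorem lowerOp_vertexOp (r : ℕ) (g : Gam) :
    lowerOp (vertexOp (Polynomial.X ^ r) g) = vertexOp (Polynomial.X ^ r) (lowerOp g) +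
      C ((r : ℝ) * (r - 1)) * vertexOp (Polynomial.X ^ (r - 1)) g := by
  induction g using MvPolynomial.induction_on generalizing r with
  | C a =>
    rw [vertexOp_X_pow_C, vertexOp_X_pow_C, lowerOp_C, map_zero, zero_add, ← smul_eq_C_mul,
      map_smul]
    cases r with
    | zero =>
      rw [rowQ_zero, ← C_1, lowerOp_C]; simp
    | succ r =>
      rw [lowerOp_rowQ_succ, smul_eq_C_mul, Nat.add_sub_cancel]
      push_cast
      rw [add_sub_cancel_right]
      ring
  | add p q hp hq =>
    simp only [map_add, mul_add] at hp hq ⊢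
    linear_combination hp r + hq r
  | mul_X p k hp =>
    rw [mul_comm p (X k), lowerOp_X_mul, ← smul_eq_C_mul, map_add, map_smul, vertexOp_X_pow_X_mul,
      vertexOp_X_pow_X_mul, map_sub, lowerOp_X_mul, smul_eq_C_mul]
    have h1 := hp r
    have h2 := hp (r + (2 * k + 1))
    have h3 := shiftDer_vertexOp k r p
    rw [show r + (2 * k + 1) - 1 = r + 2 * k by omega] at h2
    have h4 : C ((r : ℝ) * (r - 1)) * vertexOp (Polynomial.X ^ (r - 1)) (X k * p) =
        C ((r : ℝ) * (r - 1)) * (X k * vertexOp (Polynomial.X ^ (r - 1)) p -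
          vertexOp (Polynomial.X ^ (r + 2 * k)) p) := by
      cases r with
      | zero => simp
      | succ r =>
        rw [vertexOp_X_pow_X_mul, Nat.add_sub_cancel,
          show r + (2 * k + 1) = r + 1 + 2 * k by omega]
    have h5 : (C (((r + (2 * k + 1) : ℕ) : ℝ) * (((r + (2 * k + 1) : ℕ) : ℝ) - 1)) : Gam) =
        C ((r : ℝ) * (r - 1)) + C (2 * (2 * (k : ℝ) + 1)) * C ((r : ℝ) + k) := by
      rw [← C_mul, ← C_add]
      congr 1
      push_cast
      ring
    rw [h5] at h2
    rw [h4]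
    linear_combination X k * h1 - h2 + C (2 * (2 * (k : ℝ) + 1)) * h3

theorem pderiv_zero_vertexOp (r : ℕ) (g : Gam) :
    pderiv 0 (vertexOp (Polynomial.X ^ (r + 1)) g) =
      vertexOp (Polynomial.X ^ (r + 1)) (pderiv 0 g) +
        2 * vertexOp (Polynomial.X ^ r) g := by
  have h2 : (2 : Gam) = C 2 := (map_ofNat C 2).symm
  induction g using MvPolynomial.induction_on generalizing r with
  | C a =>
    rw [vertexOp_X_pow_C, vertexOp_X_pow_C, pderiv_C, map_zero, zero_add, pderiv_C_mul,
      ← rowQZ_natCast, pderiv_rowQZ,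
      show ((r + 1 : ℕ) : ℤ) - 2 * ((0 : ℕ) : ℤ) - 1 = (r : ℤ) by push_cast; ring,
      rowQZ_natCast, h2]
    simp only [Nat.cast_zero, mul_zero, zero_add, div_one]
    ring
  | add p q hp hq =>
    simp only [map_add, mul_add] at hp hq ⊢
    linear_combination hp r + hq r
  | mul_X p k hp =>
    have h1 := hp r
    have h3 := hp (r + (2 * k + 1))
    rw [mul_comm p (X k), vertexOp_X_pow_X_mul, vertexOp_X_pow_X_mul, map_sub,
      show r + 1 + (2 * k + 1) = r + (2 * k + 1) + 1 by omega, h3, pderiv_mul, pderiv_mul, h1,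
      map_add, vertexOp_X_pow_X_mul, show r + 1 + (2 * k + 1) = r + (2 * k + 1) + 1 by omega]
    rcases Nat.eq_zero_or_pos k with rfl | hk
    · rw [pderiv_X_self]; ring_nf
    · rw [pderiv_X_of_ne hk.ne']; simp only [zero_mul, map_zero]; ring

/-- The Euler operator `∑ (2k+1) p_{2k+1} ∂/∂p_{2k+1}`. -/
noncomputable def eulerDer : Derivation ℝ Gam Gam := shiftDer 0

theorem eulerDer_vertexOp (r : ℕ) (g : Gam) :
    eulerDer (vertexOp (Polynomial.X ^ r) g) = vertexOp (Polynomial.X ^ r) (eulerDer g) +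
      C (r : ℝ) * vertexOp (Polynomial.X ^ r) g := by
  have h := shiftDer_vertexOp 0 r g
  simp only [powerSumConv, zero_mul, add_zero, mul_zero, Nat.cast_zero] at h
  exact h

end Operators

end DoublySymmetric

/-! ### The limit generator on $\Gamma$ and its form as a formal differential operator. -/

namespace DoublySymmetric

open MvPolynomial StrictPartition

section Generator

/-- The weight `y (y + 1) + α` of a box of content `y = r - 1`. -/
noncomputable def boxWeight (α : ℝ) (r : ℕ) : ℝ := (r : ℝ) * (r - 1) + α

/-- The sum of the `Q`-functions of the lists obtained by lowering one entry `r`, with the weights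
`r (r - 1) + α`. -/
noncomputable def lowerQ (α : ℝ) (φ : ℕ → Polynomial ℝ) : List ℕ → Gam
  | [] => 0
  | r :: L => boxWeight α r • vertexOp (φ (r - 1)) (vertexQ φ L) + vertexOp (φ r) (lowerQ α φ L)

theorem listQ_cons (r : ℕ) (L : List ℕ) :
    listQ (r :: L) = vertexOp (Polynomial.X ^ r) (listQ L) := rfl

/-- The weight $r(r-1)+\alpha$ of a removed box splits in two: $r(r-1)$ comes from the commutator
with `lowerOp`, and $\alpha=2\cdot\frac\alpha2$ from the commutator with
$\frac\alpha2\,\partial/\partial p_1$. -/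
theorem lowerOp_listQ (α : ℝ) (L : List ℕ) (hL : ∀ r ∈ L, r ≠ 0) :
    lowerOp (listQ L) + (α / 2) • pderiv 0 (listQ L) =
      lowerQ α (fun r => Polynomial.X ^ r) L := by
  induction L with
  | nil =>
    have : (listQ [] : Gam) = C 1 := by simp [vertexQ]
    rw [this, lowerOp_C, pderiv_C]
    simp [lowerQ]
  | cons r L ih =>
    have ih := ih fun s hs => hL s (by simp [hs])
    obtain ⟨r, rfl⟩ := Nat.exists_eq_succ_of_ne_zero (hL r (by simp))
    rw [lowerQ, ← ih, listQ_cons, lowerOp_vertexOp, Nat.succ_eq_add_one, pderiv_zero_vertexOp,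
      Nat.add_sub_cancel, boxWeight]
    simp only [smul_eq_C_mul, map_add]
    rw [← smul_eq_C_mul (pderiv 0 _), map_smul, smul_eq_C_mul]
    have h2 : (C (α / 2) : Gam) * 2 = C α := by
      rw [← map_ofNat C 2, ← C_mul]
      congr 1
      ring
    linear_combination vertexOp (Polynomial.X ^ r) (listQ L) * h2

theorem eulerDer_listQ (L : List ℕ) : eulerDer (listQ L) = (L.sum : ℝ) • listQ L := by
  induction L with
  | nil => simp [vertexQ]
  | cons r L ih =>
    rw [listQ_cons, eulerDer_vertexOp, ih, map_smul, List.sum_cons, smul_eq_C_mul, smul_eq_C_mul,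
      ← add_mul, ← C_add]
    push_cast
    rw [add_comm (r : ℝ)]

/-- The generator as an operator on doubly symmetric functions. -/
noncomputable def gamOp (α : ℝ) (g : Gam) : Gam :=
  lowerOp g + (α / 2) • pderiv 0 g - (eulerDer (eulerDer g) + (α / 2 - 1) • eulerDer g)

theorem gamOp_schurQ (α : ℝ) (μ : StrictPartition) :
    gamOp α (schurQ μ) =
      (-((μ.weight : ℝ) * ((μ.weight : ℝ) + α / 2 - 1))) • schurQ μ +
        lowerQ α (fun r => Polynomial.X ^ r) μ.toList := by
  rw [gamOp, schurQ_eq_listQ, lowerOp_listQ _ _ fun r hr => μ.ne_zero_of_mem_toList hr,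
    eulerDer_listQ, Derivation.map_smul, eulerDer_listQ, sum_toList]
  simp only [smul_eq_C_mul, C_neg, C_mul, C_add, C_sub]
  ring

/-- The homomorphism setting `p_1 = 1`. -/
noncomputable def setOne : Gam →ₐ[ℝ] MvPolynomial ℕ+ ℝ := aeval FormalGenerator.qVar

theorem qVar_zero : FormalGenerator.qVar 0 = 1 := by simp [FormalGenerator.qVar]

theorem qVar_succ (k : ℕ) : FormalGenerator.qVar (k + 1) = X k.succPNat := by
  rw [FormalGenerator.qVar, dif_pos (Nat.succ_pos k)]
  rfl

theorem circ_eq_aeval_setOne (g : Gam) :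
    circ g = aeval (fun k : ℕ+ => OmegaPlus.evenMoment k) (setOne g) := by
  have : circ = (aeval (fun k : ℕ+ => OmegaPlus.evenMoment k)).comp setOne := by
    refine MvPolynomial.algHom_ext fun m => ?_
    rw [circ, setOne, AlgHom.comp_apply, aeval_X, aeval_X]
    cases m with
    | zero => rw [qVar_zero, map_one, OmegaPlus.evenMoment, dif_neg (lt_irrefl 0)]
    | succ k => rw [qVar_succ, aeval_X]; rfl
  rw [this]; rfl

theorem setOne_X (k : ℕ) : setOne (X k) = FormalGenerator.qVar k := aeval_X _ _

theorem setOne_surjective : Function.Surjective setOne := by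
  have : (⊤ : Subalgebra ℝ (MvPolynomial ℕ+ ℝ)) ≤ setOne.range := by
    rw [← adjoin_range_X]
    refine Algebra.adjoin_le ?_
    rintro _ ⟨k, rfl⟩
    refine ⟨X (k : ℕ), ?_⟩
    have hk : 0 < (k : ℕ) := k.pos
    exact (setOne_X _).trans (dif_pos hk)
  exact fun P => this (Algebra.mem_top (x := P))

theorem pderiv_setOne (k : ℕ) (g : Gam) :
    pderiv k.succPNat (setOne g) = setOne (pderiv (k + 1) g) := by
  induction g using MvPolynomial.induction_on with
  | C a => simp [setOne, MvPolynomial.algebraMap_eq]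
  | add p q hp hq => simp only [map_add, hp, hq]
  | mul_X p n hp =>
    rw [map_mul, pderiv_mul, pderiv_mul, hp, map_add, map_mul, map_mul, setOne_X]
    congr 2
    rcases Nat.eq_zero_or_pos n with rfl | hn
    · rw [qVar_zero, pderiv_one, pderiv_X_of_ne (by omega), map_zero]
    · obtain ⟨n, rfl⟩ := Nat.exists_eq_succ_of_ne_zero hn.ne'
      rw [Nat.succ_eq_add_one, qVar_succ]
      rcases eq_or_ne n k with rfl | h
      · rw [pderiv_X_self, pderiv_X_self, map_one]
      · rw [pderiv_X_of_ne, pderiv_X_of_ne (by omega), map_zero]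
        exact fun hc => h (Nat.succPNat_injective hc)

open FormalGenerator in
/-- The formal generator as a finite sum. -/
theorem op_eq_sum (α : ℝ) (P : MvPolynomial ℕ+ ℝ) (M : ℕ)
    (hM : ∀ k, M ≤ k → pderiv k.succPNat P = 0) :
    op α P = (∑ i ∈ Finset.range M, ∑ j ∈ Finset.range M,
      C ((2 * ((i + 1 : ℕ) : ℝ) + 1) * (2 * ((j + 1 : ℕ) : ℝ) + 1)) *
        (qVar ((i + 1) + (j + 1)) - qVar (i + 1) * qVar (j + 1)) *
          pderiv i.succPNat (pderiv j.succPNat P)) +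
      2 * (∑ c ∈ Finset.range M, ∑ p ∈ Finset.HasAntidiagonal.antidiagonal c,
        C (2 * (p.1 : ℝ) + 2 * (p.2 : ℝ) + 3) * (qVar p.1 * qVar p.2) *
          pderiv (p.1 + p.2).succPNat P) -
      ∑ i ∈ Finset.range M, C ((2 * ((i + 1 : ℕ) : ℝ) + 1) * (2 * ((i + 1 : ℕ) : ℝ) + α / 2)) *
        qVar (i + 1) * pderiv i.succPNat P := by
  have hcomm := fun i j => pderiv_comm i j P
  have hM' : ∀ k : ℕ+, M ≤ k.natPred → pderiv k P = 0 := fun k hk => by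
    have := hM _ hk
    rwa [PNat.succPNat_natPred] at this
  have hinj : Set.InjOn Nat.succPNat (Finset.range M : Set ℕ) := Nat.succPNat_injective.injOn
  have hmem : ∀ k : ℕ+, pderiv k P ≠ 0 → k ∈ (Finset.range M).image Nat.succPNat := fun k hk => by
    refine Finset.mem_image.2 ⟨k.natPred, Finset.mem_range.2 ?_, PNat.succPNat_natPred k⟩
    by_contra hc
    exact hk (hM' k (not_lt.1 hc))
  unfold op
  congr 1
  · congr 1
    · rw [finsum_eq_sum_of_support_subset (s := (Finset.range M).image Nat.succPNat ×ˢ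
        (Finset.range M).image Nat.succPNat), Finset.sum_product, Finset.sum_image hinj]
      · exact Finset.sum_congr rfl fun i _ => by rw [Finset.sum_image hinj]; rfl
      · intro p hp
        have hp : pderiv p.1 (pderiv p.2 P) ≠ 0 := right_ne_zero_of_mul hp
        refine Finset.mem_coe.2 (Finset.mem_product.2 ⟨hmem _ fun h => hp ?_, hmem _ fun h => hp ?_⟩)
        · rw [hcomm, h, map_zero]
        · rw [h, map_zero]
    · congr 1
      rw [finsum_eq_sum_of_support_subset (s := Finset.range M ×ˢ Finset.range M),
        Finset.sum_product]
      · exact sum_range_antidiagonal M (fun i j => C (2 * (i : ℝ) + 2 * (j : ℝ) + 3) *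
          (qVar i * qVar j) * pderiv (i + j).succPNat P) fun i j hij => by
            rw [hM _ hij, mul_zero]
      · intro p hp
        have hp : pderiv (p.1 + p.2).succPNat P ≠ 0 := right_ne_zero_of_mul hp
        have : p.1 + p.2 < M := by
          by_contra hc
          exact hp (hM _ (not_lt.1 hc))
        simp only [Finset.coe_product, Finset.coe_range, Set.mem_prod, Set.mem_Iio]
        omega
  · rw [finsum_eq_sum_of_support_subset (s := (Finset.range M).image Nat.succPNat),
      Finset.sum_image hinj]
    · rfl
    · exact fun k hk => hmem k (right_ne_zero_of_mul hk)

theorem eulerDer_eq_sum {g : Gam} {N : ℕ} (hN : ∀ k, N ≤ k → pderiv k g = 0) :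
    eulerDer g = ∑ k ∈ Finset.range N, C (2 * (k : ℝ) + 1) * X k * pderiv k g := by
  rw [derivation_eq_sum_pderiv eulerDer g N hN]
  refine Finset.sum_congr rfl fun k _ => ?_
  rw [eulerDer, shiftDer_X, zero_add, mul_comm]

theorem eulerDer_eulerDer_eq_sum {g : Gam} {N : ℕ} (hN : ∀ k, N ≤ k → pderiv k g = 0) :
    eulerDer (eulerDer g) = ∑ i ∈ Finset.range N, ∑ j ∈ Finset.range N,
        C ((2 * (i : ℝ) + 1) * (2 * (j : ℝ) + 1)) * (X i * X j) * pderiv i (pderiv j g) +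
      ∑ k ∈ Finset.range N, C ((2 * (k : ℝ) + 1) ^ 2) * X k * pderiv k g := by
  have hcomm := fun i j => pderiv_comm i j g
  have h1 : ∀ j, eulerDer (pderiv j g) =
      ∑ i ∈ Finset.range N, C (2 * (i : ℝ) + 1) * X i * pderiv i (pderiv j g) := fun j =>
    eulerDer_eq_sum fun k hk => by rw [hcomm, hN k hk, map_zero]
  have hX : ∀ j, eulerDer (X j) = C (2 * (j : ℝ) + 1) * X j := fun j => by
    rw [eulerDer, shiftDer_X, zero_add]
  have hD : ∀ (c : ℝ) (p q : Gam), eulerDer (C c * p * q) =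
      C c * p * eulerDer q + C c * q * eulerDer p := fun c p q => by
    rw [Derivation.leibniz, Derivation.leibniz, derivation_C]
    simp only [smul_eq_mul]
    ring
  have h2 : eulerDer (eulerDer g) =
      ∑ j ∈ Finset.range N, eulerDer (C (2 * (j : ℝ) + 1) * X j * pderiv j g) :=
    (congrArg eulerDer (eulerDer_eq_sum hN)).trans (map_sum eulerDer _ _)
  refine h2.trans ?_
  rw [Finset.sum_comm, ← Finset.sum_add_distrib]
  refine Finset.sum_congr rfl fun j _ => ?_
  refine (hD _ _ _).trans ?_
  refine congrArg₂ (· + ·) ?_ ?_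
  · refine (congrArg _ (h1 j)).trans ?_
    rw [Finset.mul_sum]
    refine Finset.sum_congr rfl fun i _ => ?_
    rw [C_mul]
    ring
  · refine (congrArg _ (hX j)).trans ?_
    rw [pow_two, C_mul]
    ring

open FormalGenerator in
-- After $p_1=1$ no derivative in $p_1$ survives: the second-order terms involving it carry $\mathsf
-- q_{2i}-\mathsf q_{2i}\mathsf q_0=0$, `powerSumConv 0` is zero, and the first-order contributions
-- $\frac\alpha2-1-(\frac\alpha2-1)$ cancel. The other first-order coefficients combine by
-- $(2k+1)^2+(\frac\alpha2-1)(2k+1)=(2k+1)(2k+\frac\alpha2)$.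
theorem op_setOne (α : ℝ) (g : Gam) : op α (setOne g) = setOne (gamOp α g) := by
  obtain ⟨N, hN⟩ := exists_pderiv_eq_zero g
  have hN1 := hN (N + 1) (Nat.le_succ N)
  rw [op_eq_sum α (setOne g) N fun k hk => by
    rw [pderiv_setOne, hN1 _ (by omega), map_zero]]
  simp only [pderiv_setOne]
  have hC : ∀ a : ℝ, setOne (C a) = C a := fun a => by
    rw [setOne, aeval_C]; rfl
  have h2 : (setOne 2 : MvPolynomial ℕ+ ℝ) = 2 := map_ofNat setOne 2
  have e2 : setOne (∑ i ∈ Finset.range (N + 1), ∑ j ∈ Finset.range (N + 1),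
      C ((2 * (i : ℝ) + 1) * (2 * (j : ℝ) + 1)) * X (i + j) * pderiv i (pderiv j g)) -
      setOne (∑ i ∈ Finset.range (N + 1), ∑ j ∈ Finset.range (N + 1),
        C ((2 * (i : ℝ) + 1) * (2 * (j : ℝ) + 1)) * (X i * X j) * pderiv i (pderiv j g)) =
      ∑ i ∈ Finset.range N, ∑ j ∈ Finset.range N, C ((2 * ((i + 1 : ℕ) : ℝ) + 1) *
        (2 * ((j + 1 : ℕ) : ℝ) + 1)) * (qVar (i + 1 + (j + 1)) - qVar (i + 1) * qVar (j + 1)) *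
          setOne (pderiv (i + 1) (pderiv (j + 1) g)) := by
    have e1 : setOne (∑ i ∈ Finset.range (N + 1), ∑ j ∈ Finset.range (N + 1),
        C ((2 * (i : ℝ) + 1) * (2 * (j : ℝ) + 1)) * X (i + j) * pderiv i (pderiv j g)) -
        setOne (∑ i ∈ Finset.range (N + 1), ∑ j ∈ Finset.range (N + 1),
        C ((2 * (i : ℝ) + 1) * (2 * (j : ℝ) + 1)) * (X i * X j) * pderiv i (pderiv j g)) =
        ∑ i ∈ Finset.range (N + 1), ∑ j ∈ Finset.range (N + 1), C ((2 * (i : ℝ) + 1) *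
          (2 * (j : ℝ) + 1)) * (qVar (i + j) - qVar i * qVar j) *
          setOne (pderiv i (pderiv j g)) := by
      rw [← map_sub setOne, ← Finset.sum_sub_distrib, map_sum setOne]
      refine Finset.sum_congr rfl fun i _ => ?_
      rw [← Finset.sum_sub_distrib, map_sum setOne]
      refine Finset.sum_congr rfl fun j _ => ?_
      rw [map_sub setOne, map_mul setOne, map_mul setOne, map_mul setOne, map_mul setOne,
        map_mul setOne, hC, setOne_X, setOne_X, setOne_X]
      ring
    rw [e1, Finset.sum_range_succ', Finset.sum_eq_zero (s := Finset.range (N + 1)), add_zero]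
    · refine Finset.sum_congr rfl fun i _ => ?_
      rw [Finset.sum_range_succ', qVar_zero, add_zero, mul_one, sub_self, mul_zero, zero_mul,
        add_zero]
    · intro j _
      rw [qVar_zero, zero_add, one_mul, sub_self, mul_zero, zero_mul]
  have e3 : setOne (∑ k ∈ Finset.range (N + 1), C (2 * (k : ℝ) + 1) * powerSumConv k *
      pderiv k g) = ∑ c ∈ Finset.range N,
        ∑ p ∈ Finset.HasAntidiagonal.antidiagonal c,
          C (2 * (p.1 : ℝ) + 2 * (p.2 : ℝ) + 3) * (qVar p.1 * qVar p.2) *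
            setOne (pderiv (p.1 + p.2 + 1) g) := by
    rw [Finset.sum_range_succ', powerSumConv, mul_zero, zero_mul, add_zero, map_sum setOne]
    refine Finset.sum_congr rfl fun c _ => ?_
    rw [powerSumConv, Finset.mul_sum, Finset.sum_mul, map_sum setOne]
    refine Finset.sum_congr rfl fun p hp => ?_
    have hp : p.1 + p.2 = c := Finset.HasAntidiagonal.mem_antidiagonal.1 hp
    rw [map_mul setOne, map_mul setOne, map_mul setOne, hC, setOne_X, setOne_X, hp,
      show 2 * ((c + 1 : ℕ) : ℝ) + 1 = 2 * (p.1 : ℝ) + 2 * (p.2 : ℝ) + 3 by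
        rw [← hp]; push_cast; ring]
  have e4 : setOne (∑ k ∈ Finset.range (N + 1), C ((2 * (k : ℝ) + 1) ^ 2) * X k * pderiv k g) +
      C (α / 2 - 1) * setOne (∑ k ∈ Finset.range (N + 1), C (2 * (k : ℝ) + 1) * X k *
        pderiv k g) - C (α / 2) * setOne (pderiv 0 g) =
      ∑ i ∈ Finset.range N, C ((2 * ((i + 1 : ℕ) : ℝ) + 1) *
        (2 * ((i + 1 : ℕ) : ℝ) + α / 2)) * qVar (i + 1) * setOne (pderiv (i + 1) g) := by
    have : ∀ k : ℕ, setOne (C ((2 * (k : ℝ) + 1) ^ 2) * X k * pderiv k g) +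
        C (α / 2 - 1) * setOne (C (2 * (k : ℝ) + 1) * X k * pderiv k g) =
        C ((2 * (k : ℝ) + 1) * (2 * (k : ℝ) + α / 2)) * qVar k * setOne (pderiv k g) :=
      fun k => by
        have : (C ((2 * (k : ℝ) + 1) ^ 2) : MvPolynomial ℕ+ ℝ) +
            C (α / 2 - 1) * C (2 * (k : ℝ) + 1) =
            C ((2 * (k : ℝ) + 1) * (2 * (k : ℝ) + α / 2)) := by
          rw [← C_mul, ← C_add]
          congr 1
          ring
        rw [map_mul setOne, map_mul setOne, map_mul setOne, map_mul setOne, hC, hC, setOne_X]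
        linear_combination (qVar k * setOne (pderiv k g)) * this
    rw [map_sum setOne, map_sum setOne, Finset.mul_sum, ← Finset.sum_add_distrib,
      Finset.sum_congr rfl fun k _ => this k, Finset.sum_range_succ', qVar_zero]
    simp
  rw [gamOp, lowerOp_eq hN1, lowerOpTrunc, eulerDer_eulerDer_eq_sum hN1, eulerDer_eq_sum hN1,
    ← e2, ← e3, ← e4, smul_eq_C_mul, smul_eq_C_mul, map_sub setOne, map_add setOne,
    map_add setOne, map_add setOne, map_add setOne, map_mul setOne, map_mul setOne,
    map_mul setOne, hC, hC, h2]
  ring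

end Generator

end DoublySymmetric

/-! ### Shift identities for factorial $Q$-functions at points in general position. -/

namespace DoublySymmetric

open MvPolynomial StrictPartition

section ShiftSums

variable {ι : Type*} [DecidableEq ι]

theorem evalOn_congr {I : Finset ι} {y z : ι → ℝ} (h : ∀ i ∈ I, y i = z i) :
    evalOn I y = evalOn I z := by
  unfold evalOn
  congr 1
  funext m
  exact Finset.sum_congr rfl fun i hi => by rw [h i hi]

theorem pairFactor_congr {I : Finset ι} {y z : ι → ℝ} {u : ι} (hu : y u = z u)
    (h : ∀ i ∈ I, y i = z i) : pairFactor I y u = pairFactor I z u :=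
  Finset.prod_congr rfl fun j hj => by rw [hu, h j (Finset.mem_of_mem_erase hj)]

/-- `∏_{j ≠ i} (yᵢ + δ - yⱼ) (yᵢ + yⱼ) / ((yᵢ + δ + yⱼ) (yᵢ - yⱼ))` -/
noncomputable def shiftCoeff (δ : ℝ) (I : Finset ι) (y : ι → ℝ) (i : ι) : ℝ :=
  ∏ j ∈ I.erase i, ((y i + δ - y j) * (y i + y j)) / ((y i + δ + y j) * (y i - y j))

/-- The points `yᵢ`, `i ∈ I`, are distinct and stay in general position when one of them is
shifted by `δ`. -/
def ShiftGeneric (δ : ℝ) (I : Finset ι) (y : ι → ℝ) : Prop :=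
  Set.InjOn y I ∧ ∀ i ∈ I, ∀ j ∈ I, i ≠ j → y i + δ ≠ y j ∧ y i + δ + y j ≠ 0

theorem ShiftGeneric.mono {δ : ℝ} {I J : Finset ι} {y : ι → ℝ} (h : ShiftGeneric δ I y)
    (hJ : J ⊆ I) : ShiftGeneric δ J y :=
  ⟨h.1.mono hJ, fun i hi j hj => h.2 i (hJ hi) j (hJ hj)⟩

theorem ShiftGeneric.sub_ne_zero {δ : ℝ} {I : Finset ι} {y : ι → ℝ} (h : ShiftGeneric δ I y)
    {i j : ι} (hi : i ∈ I) (hj : j ∈ I) (hij : i ≠ j) : y i - y j ≠ 0 :=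
  _root_.sub_ne_zero.2 fun e => hij (h.1 hi hj e)

theorem ShiftGeneric.injOn_update {δ : ℝ} {I : Finset ι} {y : ι → ℝ} (h : ShiftGeneric δ I y)
    {i : ι} (hi : i ∈ I) : Set.InjOn (Function.update y i (y i + δ)) I := by
  intro a ha b hb hab
  by_contra hne
  rcases eq_or_ne a i with rfl | ha'
  · rw [Function.update_self, Function.update_of_ne (Ne.symm hne)] at hab
    exact (h.2 a ha b hb hne).1 hab
  · rcases eq_or_ne b i with rfl | hb'
    · rw [Function.update_self, Function.update_of_ne hne] at hab
      exact (h.2 b hb a ha (Ne.symm hne)).1 hab.symm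
    · rw [Function.update_of_ne ha', Function.update_of_ne hb'] at hab
      exact hne (h.1 ha hb hab)

/-- The weighted sum of the values of `g` at the points obtained by shifting one variable. -/
noncomputable def shiftSum (e : ℝ → ℝ) (δ : ℝ) (I : Finset ι) (y : ι → ℝ) (g : Gam) : ℝ :=
  ∑ i ∈ I, e (y i) * shiftCoeff δ I y i * evalOn I (Function.update y i (y i + δ)) g

/-- This explains the form of `shiftCoeff`: it is the quotient of the pair factors of the variable
$y_i$ before and after the shift. -/
theorem shiftCoeff_mul_pairFactor_self {δ : ℝ} {I : Finset ι} {y : ι → ℝ}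
    (h : ShiftGeneric δ I y) {i : ι} (hi : i ∈ I) :
    shiftCoeff δ I y i * pairFactor I (Function.update y i (y i + δ)) i = pairFactor I y i := by
  rw [shiftCoeff, pairFactor, pairFactor, ← Finset.prod_mul_distrib]
  refine Finset.prod_congr rfl fun j hj => ?_
  have hji := Finset.ne_of_mem_erase hj
  have hj := Finset.mem_of_mem_erase hj
  rw [Function.update_self, Function.update_of_ne hji]
  have h1 := h.sub_ne_zero hi hj hji.symm
  have h2 := (h.2 i hi j hj hji.symm).2
  have h3 := _root_.sub_ne_zero.2 (h.2 i hi j hj hji.symm).1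
  field_simp

/-- For another variable $y_u$ the shift alters one factor only, and the factor of index $u$ in
`shiftCoeff` undoes that change. What remains is the shift coefficient with $y_u$ removed. -/
theorem shiftCoeff_mul_pairFactor {δ : ℝ} {I : Finset ι} {y : ι → ℝ}
    (h : ShiftGeneric δ I y) {i u : ι} (hi : i ∈ I) (hu : u ∈ I) (hui : u ≠ i) :
    shiftCoeff δ I y i * pairFactor I (Function.update y i (y i + δ)) u =
      pairFactor I y u * shiftCoeff δ (I.erase u) y i := by
  rw [shiftCoeff, ← Finset.mul_prod_erase _ _ (Finset.mem_erase.2 ⟨hui, hu⟩),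
    Finset.erase_right_comm, shiftCoeff, pairFactor_eq_mul_erase I _ hi hui,
    pairFactor_eq_mul_erase I y hi hui, Function.update_self, Function.update_of_ne hui]
  have hc : pairFactor (I.erase i) (Function.update y i (y i + δ)) u =
      pairFactor (I.erase i) y u :=
    pairFactor_congr (Function.update_of_ne hui _ _)
      fun j hj => Function.update_of_ne (Finset.ne_of_mem_erase hj) _ _
  rw [hc]
  have h1 := h.sub_ne_zero hi hu hui.symm
  have h1' := h.sub_ne_zero hu hi hui
  have h2 := (h.2 i hi u hu hui.symm).2
  have h3 := _root_.sub_ne_zero.2 (h.2 i hi u hu hui.symm).1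
  have h4 : y u - (y i + δ) ≠ 0 := fun hc => h3 (by linarith)
  have key : (y i + δ - y u) * (y i + y u) / ((y i + δ + y u) * (y i - y u)) *
      ((y u + (y i + δ)) / (y u - (y i + δ))) = (y u + y i) / (y u - y i) := by
    rw [div_mul_div_comm, div_eq_div_iff (mul_ne_zero (mul_ne_zero h2 h1) h4) h1']
    ring
  rw [← key]
  ring

/-- The vertex operator removes a variable $y_u$. Either $y_u$ is the shifted one, so that only
$\varphi$ sees the shift, or the shift happens among the remaining variables. This is the recursion
that makes an induction over the list of indices possible. -/
theorem shiftSum_vertexOp (e : ℝ → ℝ) {δ : ℝ} {I : Finset ι} {y : ι → ℝ}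
    (h : ShiftGeneric δ I y) {φ : Polynomial ℝ} (hφ : φ.coeff 0 = 0) (g : Gam) :
    shiftSum e δ I y (vertexOp φ g) = 2 * ∑ u ∈ I, pairFactor I y u *
      (e (y u) * Polynomial.aeval (y u + δ) φ * evalOn (I.erase u) y g +
        Polynomial.aeval (y u) φ * shiftSum e δ (I.erase u) y g) := by
  have h1 : ∀ i ∈ I, e (y i) * shiftCoeff δ I y i *
      evalOn I (Function.update y i (y i + δ)) (vertexOp φ g) =
      2 * (pairFactor I y i * (e (y i) * Polynomial.aeval (y i + δ) φ *
        evalOn (I.erase i) y g)) + 2 * ∑ u ∈ I.erase i, pairFactor I y u *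
          (Polynomial.aeval (y u) φ * (e (y i) * shiftCoeff δ (I.erase u) y i *
            evalOn (I.erase u) (Function.update y i (y i + δ)) g)) := fun i hi => by
    rw [evalOn_vertexOp I _ (h.injOn_update hi) φ hφ, ← Finset.add_sum_erase I _ hi, mul_add,
      mul_add, Function.update_self, ← shiftCoeff_mul_pairFactor_self h hi]
    congr 1
    · rw [evalOn_congr (I := I.erase i) (z := y)
        fun j hj => Function.update_of_ne (Finset.ne_of_mem_erase hj) _ _]
      ring
    · rw [Finset.mul_sum, Finset.mul_sum, Finset.mul_sum]
      refine Finset.sum_congr rfl fun u hu => ?_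
      have hui := Finset.ne_of_mem_erase hu
      have := shiftCoeff_mul_pairFactor h hi (Finset.mem_of_mem_erase hu) hui
      rw [Function.update_of_ne hui]
      linear_combination (2 * e (y i) * Polynomial.aeval (y u) φ *
        evalOn (I.erase u) (Function.update y i (y i + δ)) g) * this
  rw [shiftSum, Finset.sum_congr rfl h1, Finset.sum_add_distrib, ← Finset.mul_sum,
    ← Finset.mul_sum, ← mul_add]
  congr 1
  rw [Finset.sum_comm' (t' := I) (s' := fun u => I.erase u), ← Finset.sum_add_distrib]
  · refine Finset.sum_congr rfl fun u _ => ?_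
    rw [shiftSum, ← Finset.mul_sum, ← Finset.mul_sum, mul_add]
  · intro i u
    simp only [Finset.mem_erase]
    tauto

end ShiftSums

section FactorialQ

/-- The factorial analogue of `listQ`. -/
noncomputable abbrev factQ (L : List ℕ) : Gam := vertexQ (fun r => descPochhammer ℝ r) L

theorem factQ_cons (r : ℕ) (L : List ℕ) :
    factQ (r :: L) = vertexOp (descPochhammer ℝ r) (factQ L) := rfl

theorem coeff_zero_descPochhammer {r : ℕ} (hr : r ≠ 0) : (descPochhammer ℝ r).coeff 0 = 0 := by
  obtain ⟨r, rfl⟩ := Nat.exists_eq_succ_of_ne_zero hr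
  rw [descPochhammer_succ_left, Polynomial.mul_coeff_zero, Polynomial.coeff_X_zero, zero_mul]

theorem aeval_descPochhammer_succ (r : ℕ) (s : ℝ) :
    Polynomial.aeval s (descPochhammer ℝ (r + 1)) =
      Polynomial.aeval s (descPochhammer ℝ r) * (s - r) := by
  rw [descPochhammer_succ_right]
  simp

theorem aeval_descPochhammer_succ' (r : ℕ) (s : ℝ) :
    Polynomial.aeval s (descPochhammer ℝ (r + 1)) =
      s * Polynomial.aeval (s - 1) (descPochhammer ℝ r) := by
  rw [descPochhammer_succ_left]
  simp

variable {ι : Type*} [DecidableEq ι]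

/-- This is the residue sum with $a_i=y_i(y_i-1)$ and $b_i=y_i(y_i+1)$, since
$a_i-a_j=(y_i-1+y_j)(y_i-y_j)$ and $a_i-b_j=(y_i-1-y_j)(y_i+y_j)$. -/
theorem sum_shiftCoeff_neg_one {I : Finset ι} {y : ι → ℝ} (h : ShiftGeneric (-1) I y) :
    ∑ i ∈ I, y i * shiftCoeff (-1) I y i = ∑ i ∈ I, y i := by
  have hsub : ∀ i j, y i * (y i - 1) - y j * (y j - 1) = (y i + -1 + y j) * (y i - y j) :=
    fun i j => by ring
  have ha : Set.InjOn (fun i => y i * (y i - 1)) I := fun i hi j hj hij => by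
    by_contra hne
    refine mul_ne_zero (h.2 i hi j hj hne).2 (h.sub_ne_zero hi hj hne) ?_
    rw [← hsub]
    exact sub_eq_zero.2 hij
  have := sum_residues I (fun i => y i * (y i - 1)) (fun i => y i * (y i + 1)) ha
  have h2 : ∀ i, y i * (y i - 1) - y i * (y i + 1) = -2 * y i := fun i => by ring
  have h3 : ∀ i, ∏ j ∈ I.erase i, ((y i * (y i - 1) - y j * (y j + 1)) /
      (y i * (y i - 1) - y j * (y j - 1))) = shiftCoeff (-1) I y i := fun i =>
    Finset.prod_congr rfl fun j _ => by
      rw [hsub]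
      congr 1
      ring
  simp only [h2, h3] at this
  simp only [mul_assoc, ← Finset.mul_sum] at this
  linarith

/-- Lowering one variable of a factorial `Q`-function, for points in general position. -/
theorem shiftSum_neg_one_factQ {L : List ℕ} (hL : ∀ r ∈ L, r ≠ 0) {I : Finset ι} {y : ι → ℝ}
    (h : ShiftGeneric (-1) I y) :
    shiftSum (fun s => s) (-1) I y (factQ L) =
      (∑ i ∈ I, y i - L.sum) * evalOn I y (factQ L) := by
  induction L generalizing I with
  | nil =>
    simp only [shiftSum, factQ, vertexQ, map_one, mul_one, List.sum_nil, Nat.cast_zero, sub_zero]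
    exact sum_shiftCoeff_neg_one h
  | cons r L ih =>
    have hr := coeff_zero_descPochhammer (hL r (by simp))
    rw [factQ_cons, shiftSum_vertexOp _ h hr, evalOn_vertexOp I y h.1 _ hr, mul_left_comm]
    congr 1
    rw [Finset.mul_sum]
    refine Finset.sum_congr rfl fun u hu => ?_
    rw [ih (fun s hs => hL s (by simp [hs])) (h.mono (Finset.erase_subset u I))]
    have h1 := Finset.add_sum_erase I y hu
    -- The falling factorial of degree $r$ satisfies $s\,\varphi(s-1)=(s-r)\varphi(s)$. This is the
    -- reason for using falling factorials in place of powers.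
    have h2 := aeval_descPochhammer_succ r (y u)
    rw [aeval_descPochhammer_succ'] at h2
    rw [← sub_eq_add_neg, h2, ← h1, List.sum_cons]
    push_cast
    ring

/-- Interpolation with $b_i=-y_i$, evaluated at $0$. It measures by how much the finite-variable
formula for $B_0 1$ misses the value $1$, and is needed for lists ending in $1$. -/
theorem two_mul_sum_pairFactor {I : Finset ι} {y : ι → ℝ} (hy : Set.InjOn y I)
    (h0 : ∀ i ∈ I, y i ≠ 0) : 2 * ∑ i ∈ I, pairFactor I y i = 1 - (-1) ^ I.card := by
  have h := prod_sub_interpolation I y (fun i => -y i) hy 0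
  have hne : ∏ i ∈ I, (0 - y i) ≠ 0 :=
    Finset.prod_ne_zero_iff.2 fun i hi => by rw [zero_sub]; exact neg_ne_zero.2 (h0 i hi)
  have h1 : ∏ i ∈ I, (0 - -y i) = (-1) ^ I.card * ∏ i ∈ I, (0 - y i) := by
    rw [← Finset.prod_const, ← Finset.prod_mul_distrib]
    exact Finset.prod_congr rfl fun i _ => by ring
  have h2 : ∀ i ∈ I, (y i - -y i) * (∏ j ∈ I.erase i, ((y i - -y j) / (y i - y j))) *
      ∏ j ∈ I.erase i, (0 - y j) = (-2 * pairFactor I y i) * ∏ j ∈ I, (0 - y j) := fun i hi => by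
    rw [← Finset.mul_prod_erase I (fun j => 0 - y j) hi]
    simp only [sub_neg_eq_add]
    rw [pairFactor]
    ring
  rw [h1, Finset.sum_congr rfl h2, ← Finset.sum_mul, ← one_add_mul] at h
  have h3 := mul_right_cancel₀ hne h
  rw [h3, ← Finset.mul_sum]
  ring

variable (α : ℝ)

/-- The weighted sum of the values of `g` at the points obtained by raising one of the variables
by one, or by adjoining a new variable `y_a = 1`. -/
noncomputable def raiseSum (a : ι) (I : Finset ι) (y : ι → ℝ) (g : Gam) : ℝ :=
  shiftSum (fun s => 2 * (s * (s + 1) + α) / (s + 1)) 1 I y g +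
    α * (∏ j ∈ I, (y j - 1) / (y j + 1)) * evalOn (insert a I) (Function.update y a 1) g

/-- Take $a_i=y_i(y_i+1)$ and $b_i=y_i(y_i-1)$, and split the weight as $2y_i+2\alpha/(y_i+1)$. The
first part is the residue sum. The second is the interpolation formula at $0$, where the quotient of
the two products is $\prod(y_j-1)/(y_j+1)$, the weight of a new variable. -/
theorem sum_shiftCoeff_one {I : Finset ι} {y : ι → ℝ} (h : ShiftGeneric 1 I y)
    (h0 : ∀ i ∈ I, 0 < y i) :
    ∑ i ∈ I, 2 * (y i * (y i + 1) + α) / (y i + 1) * shiftCoeff 1 I y i +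
      α * ∏ j ∈ I, (y j - 1) / (y j + 1) = 2 * ∑ i ∈ I, y i + α := by
  have hsub : ∀ i j, y i * (y i + 1) - y j * (y j + 1) = (y i + 1 + y j) * (y i - y j) :=
    fun i j => by ring
  have ha : Set.InjOn (fun i => y i * (y i + 1)) I := fun i hi j hj hij => by
    by_contra hne
    refine mul_ne_zero (h.2 i hi j hj hne).2 (h.sub_ne_zero hi hj hne) ?_
    rw [← hsub]
    exact sub_eq_zero.2 hij
  have h1 := sum_residues I (fun i => y i * (y i + 1)) (fun i => y i * (y i - 1)) ha
  have h1' := prod_sub_interpolation I (fun i => y i * (y i + 1)) (fun i => y i * (y i - 1)) ha 0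
  have h2 : ∀ i, y i * (y i + 1) - y i * (y i - 1) = 2 * y i := fun i => by ring
  have h3 : ∀ i, ∏ j ∈ I.erase i, ((y i * (y i + 1) - y j * (y j - 1)) /
      (y i * (y i + 1) - y j * (y j + 1))) = shiftCoeff 1 I y i := fun i =>
    Finset.prod_congr rfl fun j _ => by
      rw [hsub]
      congr 1
      ring
  simp only [h2, h3] at h1 h1'
  have hne : ∏ i ∈ I, (0 - y i * (y i + 1)) ≠ 0 :=
    Finset.prod_ne_zero_iff.2 fun i hi => by
      rw [zero_sub]
      exact neg_ne_zero.2 (mul_pos (h0 i hi) (by linarith [h0 i hi])).ne'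
  have h4 : ∏ i ∈ I, (0 - y i * (y i - 1)) =
      (∏ j ∈ I, (y j - 1) / (y j + 1)) * ∏ i ∈ I, (0 - y i * (y i + 1)) := by
    rw [← Finset.prod_mul_distrib]
    refine Finset.prod_congr rfl fun i hi => ?_
    have : y i + 1 ≠ 0 := by linarith [h0 i hi]
    field_simp
    ring
  have h5 : ∀ i ∈ I, 2 * y i * shiftCoeff 1 I y i * ∏ j ∈ I.erase i, (0 - y j * (y j + 1)) =
      (-2 / (y i + 1) * shiftCoeff 1 I y i) * ∏ i ∈ I, (0 - y i * (y i + 1)) := fun i hi => by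
    rw [← Finset.mul_prod_erase I (fun j => 0 - y j * (y j + 1)) hi]
    have : y i + 1 ≠ 0 := by linarith [h0 i hi]
    field_simp
    ring
  rw [h4, Finset.sum_congr rfl h5, ← Finset.sum_mul, ← one_add_mul] at h1'
  have h6 := mul_right_cancel₀ hne h1'
  have h7 : ∀ i ∈ I, 2 * (y i * (y i + 1) + α) / (y i + 1) * shiftCoeff 1 I y i =
      2 * y i * shiftCoeff 1 I y i - α * (-2 / (y i + 1) * shiftCoeff 1 I y i) := fun i hi => by
    have : y i + 1 ≠ 0 := by linarith [h0 i hi]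
    field_simp
    ring
  rw [Finset.sum_congr rfl h7, Finset.sum_sub_distrib, h1, h6, ← Finset.mul_sum, ← Finset.mul_sum]
  ring

/-- As for shifts, but the variable removed by the vertex operator may also be the new one, $y_a=1$.
Its pair factor times $\prod(y_j-1)/(y_j+1)$ is $(-1)^{|I|}$, which gives the extra term containing
$\varphi(1)$. -/
theorem raiseSum_vertexOp {a : ι} {I : Finset ι} (haI : a ∉ I) {y : ι → ℝ}
    (h : ShiftGeneric 1 I y) (h0 : ∀ i ∈ I, 0 < y i) (h1 : ∀ i ∈ I, y i ≠ 1)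
    {φ : Polynomial ℝ} (hφ : φ.coeff 0 = 0) (g : Gam) :
    raiseSum α a I y (vertexOp φ g) = 2 * ∑ u ∈ I, pairFactor I y u *
      (2 * (y u * (y u + 1) + α) / (y u + 1) * Polynomial.aeval (y u + 1) φ *
        evalOn (I.erase u) y g + Polynomial.aeval (y u) φ * raiseSum α a (I.erase u) y g) +
      2 * α * Polynomial.aeval (1 : ℝ) φ * (-1) ^ I.card * evalOn I y g := by
  have hupd : ∀ i ∈ I, Function.update y a 1 i = y i := fun i hi =>
    Function.update_of_ne (fun hc : i = a => haI (hc ▸ hi)) _ _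
  have hinj : Set.InjOn (Function.update y a 1) (insert a I : Finset ι) := by
    intro i hi j hj hij
    by_contra hne
    rcases Finset.mem_insert.1 hi with rfl | hi' <;> rcases Finset.mem_insert.1 hj with rfl | hj'
    · exact hne rfl
    · rw [Function.update_self, hupd j hj'] at hij
      exact h1 j hj' hij.symm
    · rw [Function.update_self, hupd i hi'] at hij
      exact h1 i hi' hij
    · rw [hupd i hi', hupd j hj'] at hij
      exact hne (h.1 hi' hj' hij)
  have e1 : (∏ j ∈ I, (y j - 1) / (y j + 1)) *
      pairFactor (insert a I) (Function.update y a 1) a = (-1) ^ I.card := by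
    rw [pairFactor, Finset.erase_insert haI, ← Finset.prod_mul_distrib, ← Finset.prod_const]
    refine Finset.prod_congr rfl fun j hj => ?_
    rw [Function.update_self, hupd j hj]
    have hp : y j + 1 ≠ 0 := by linarith [h0 j hj]
    have hm : 1 - y j ≠ 0 := sub_ne_zero.2 (h1 j hj).symm
    field_simp
    ring
  have e2 : ∀ u ∈ I, (∏ j ∈ I, (y j - 1) / (y j + 1)) *
      pairFactor (insert a I) (Function.update y a 1) u =
      pairFactor I y u * ∏ j ∈ I.erase u, (y j - 1) / (y j + 1) := fun u hu => by
    have hua : u ≠ a := fun hc => haI (hc ▸ hu)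
    rw [pairFactor_eq_mul_erase (insert a I) _ (Finset.mem_insert_self a I) hua,
      Finset.erase_insert haI, Function.update_self, hupd u hu,
      pairFactor_congr (hupd u hu) hupd, ← Finset.mul_prod_erase I _ hu]
    have hp : y u + 1 ≠ 0 := by linarith [h0 u hu]
    have hm : y u - 1 ≠ 0 := sub_ne_zero.2 (h1 u hu)
    field_simp
  rw [raiseSum, shiftSum_vertexOp _ h hφ, evalOn_vertexOp _ _ hinj _ hφ, Finset.sum_insert haI,
    Finset.erase_insert haI, Function.update_self, evalOn_congr hupd]
  have e3 : α * (∏ j ∈ I, (y j - 1) / (y j + 1)) * ∑ u ∈ I,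
      Polynomial.aeval (Function.update y a 1 u) φ *
        pairFactor (insert a I) (Function.update y a 1) u *
          evalOn ((insert a I).erase u) (Function.update y a 1) g =
      ∑ u ∈ I, pairFactor I y u * (Polynomial.aeval (y u) φ *
        (α * (∏ j ∈ I.erase u, (y j - 1) / (y j + 1)) *
          evalOn (insert a (I.erase u)) (Function.update y a 1) g)) := by
    rw [Finset.mul_sum]
    refine Finset.sum_congr rfl fun u hu => ?_
    have hua : u ≠ a := fun hc => haI (hc ▸ hu)
    rw [hupd u hu, Finset.erase_insert_of_ne hua.symm]
    linear_combination (α * Polynomial.aeval (y u) φ *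
      evalOn (insert a (I.erase u)) (Function.update y a 1) g) * e2 u hu
  have e4 : ∑ u ∈ I, pairFactor I y u *
      (2 * (y u * (y u + 1) + α) / (y u + 1) * Polynomial.aeval (y u + 1) φ *
        evalOn (I.erase u) y g + Polynomial.aeval (y u) φ * raiseSum α a (I.erase u) y g) =
      ∑ u ∈ I, pairFactor I y u * (2 * (y u * (y u + 1) + α) / (y u + 1) *
        Polynomial.aeval (y u + 1) φ * evalOn (I.erase u) y g + Polynomial.aeval (y u) φ *
          shiftSum (fun s => 2 * (s * (s + 1) + α) / (s + 1)) 1 (I.erase u) y g) +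
      ∑ u ∈ I, pairFactor I y u * (Polynomial.aeval (y u) φ *
        (α * (∏ j ∈ I.erase u, (y j - 1) / (y j + 1)) *
          evalOn (insert a (I.erase u)) (Function.update y a 1) g)) := by
    rw [← Finset.sum_add_distrib]
    refine Finset.sum_congr rfl fun u _ => ?_
    rw [raiseSum]
    ring
  rw [e4, ← e3, ← e1]
  ring

/-- Raising one variable of a factorial `Q`-function, for points in general position. -/
theorem raiseSum_factQ {a : ι} {L : List ℕ} (hL : ∀ r ∈ L, r ≠ 0) (hs : L.Pairwise (· > ·))
    {I : Finset ι} (haI : a ∉ I) {y : ι → ℝ} (h : ShiftGeneric 1 I y) (h0 : ∀ i ∈ I, 0 < y i)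
    (h1 : ∀ i ∈ I, y i ≠ 1) :
    raiseSum α a I y (factQ L) = (2 * ∑ i ∈ I, y i + 2 * L.sum + α) * evalOn I y (factQ L) +
      2 * evalOn I y (lowerQ α (fun r => descPochhammer ℝ r) L) := by
  induction L generalizing I with
  | nil =>
    simp only [raiseSum, shiftSum, factQ, vertexQ, map_one, mul_one, List.sum_nil, Nat.cast_zero,
      mul_zero, add_zero, lowerQ, map_zero]
    exact sum_shiftCoeff_one α h h0
  | cons r L ih =>
    have hr0 := hL r (by simp)
    have hr := coeff_zero_descPochhammer hr0
    have ih' : ∀ u ∈ I, raiseSum α a (I.erase u) y (factQ L) = _ := fun u hu =>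
      ih (fun s hs => hL s (by simp [hs])) hs.of_cons
        (fun hc => haI (Finset.mem_of_mem_erase hc)) (h.mono (Finset.erase_subset u I))
        (fun i hi => h0 i (Finset.mem_of_mem_erase hi))
        (fun i hi => h1 i (Finset.mem_of_mem_erase hi))
    obtain ⟨r, rfl⟩ := Nat.exists_eq_succ_of_ne_zero hr0
    rw [factQ_cons, raiseSum_vertexOp α haI h h0 h1 hr, lowerQ, Nat.succ_eq_add_one,
      Nat.add_sub_cancel, evalOn_vertexOp I y h.1 _ hr, map_add, evalOn_vertexOp I y h.1 _ hr,
      map_smul, smul_eq_mul]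
    have key : ∀ u ∈ I, pairFactor I y u *
        (2 * (y u * (y u + 1) + α) / (y u + 1) *
          Polynomial.aeval (y u + 1) (descPochhammer ℝ (r + 1)) *
          evalOn (I.erase u) y (factQ L) + Polynomial.aeval (y u) (descPochhammer ℝ (r + 1)) *
            raiseSum α a (I.erase u) y (factQ L)) =
        (2 * ∑ i ∈ I, y i + 2 * (((r + 1) :: L).sum : ℕ) + α) *
          (Polynomial.aeval (y u) (descPochhammer ℝ (r + 1)) * pairFactor I y u *
            evalOn (I.erase u) y (factQ L)) +
        2 * (Polynomial.aeval (y u) (descPochhammer ℝ (r + 1)) * pairFactor I y u *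
            evalOn (I.erase u) y (lowerQ α (fun r => descPochhammer ℝ r) L)) +
        2 * boxWeight α (r + 1) * (Polynomial.aeval (y u) (descPochhammer ℝ r) *
          pairFactor I y u * evalOn (I.erase u) y (factQ L)) := fun u hu => by
      have hp : y u + 1 ≠ 0 := by linarith [h0 u hu]
      rw [ih' u hu, aeval_descPochhammer_succ' r (y u + 1), add_sub_cancel_right,
        aeval_descPochhammer_succ, ← Finset.add_sum_erase I y hu, List.sum_cons, boxWeight]
      push_cast
      field_simp
      ring
    rw [Finset.sum_congr rfl key, Finset.sum_add_distrib, Finset.sum_add_distrib, ← Finset.mul_sum,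
      ← Finset.mul_sum, ← Finset.mul_sum]
    -- The extra term contains $\varphi(1)$ and vanishes unless the head of the list is $1$. In that
    -- case the list is $[1]$ because its entries decrease, and the extra term compensates the
    -- difference between $B_0 1=1$ and the finite-variable sum.
    rcases Nat.eq_zero_or_pos r with rfl | hrpos
    · have hLnil : L = [] := by
        rcases L with _ | ⟨s, L⟩
        · rfl
        · have h2 : 0 + 1 > s := (List.pairwise_cons.1 hs).1 s (by simp)
          exact absurd (show s = 0 by omega) (hL s (by simp))
      subst hLnil
      have hpf := two_mul_sum_pairFactor h.1 fun i hi => (h0 i hi).ne'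
      simp only [factQ, vertexQ, map_one, mul_one, lowerQ, map_zero, mul_zero,
        Finset.sum_const_zero, descPochhammer_zero, one_mul, zero_add, descPochhammer_one,
        Polynomial.aeval_X, add_zero]
      have h1 : vertexOp 1 (1 : Gam) = 1 := by
        have := vertexOp_X_pow_one 0
        rwa [pow_zero, rowQ_zero] at this
      rw [h1, map_one, boxWeight]
      push_cast
      linear_combination 2 * α * hpf
    · rw [evalOn_vertexOp I y h.1 _ (coeff_zero_descPochhammer hrpos.ne')]
      have : Polynomial.aeval (1 : ℝ) (descPochhammer ℝ (r + 1)) = 0 := by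
        rw [aeval_descPochhammer_succ', sub_self]
        obtain ⟨r, rfl⟩ := Nat.exists_eq_succ_of_ne_zero hrpos.ne'
        rw [Nat.succ_eq_add_one, aeval_descPochhammer_succ', zero_mul, mul_zero]
      rw [this]
      ring

end FactorialQ

end DoublySymmetric

/-! ### Removing the genericity assumption by continuity. -/

namespace DoublySymmetric

open MvPolynomial StrictPartition

section SpecialPosition

variable {ι : Type*} [DecidableEq ι]

theorem continuousAt_evalOn (I : Finset ι) {z : ℝ → ι → ℝ} {t₀ : ℝ}
    (hz : ∀ i, ContinuousAt (fun t => z t i) t₀) (g : Gam) :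
    ContinuousAt (fun t => evalOn I (z t) g) t₀ := by
  induction g using MvPolynomial.induction_on with
  | C a => simpa [evalOn] using continuousAt_const
  | add p q hp hq =>
    simp only [map_add]
    exact hp.add hq
  | mul_X p n hp =>
    simp only [map_mul]
    refine hp.mul ?_
    simp only [evalOn, aeval_X]
    exact tendsto_finsetSum _ fun i _ => (hz i).pow _

theorem continuousAt_update {z : ℝ → ι → ℝ} {t₀ : ℝ} (hz : ∀ i, ContinuousAt (fun t => z t i) t₀)
    (u : ι) {c : ℝ → ℝ} (hc : ContinuousAt c t₀) (i : ι) :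
    ContinuousAt (fun t => Function.update (z t) u (c t) i) t₀ := by
  rcases eq_or_ne i u with rfl | h
  · simpa using hc
  · simpa [h] using hz i

theorem eventually_ne_nhdsGT (c : ℝ) : ∀ᶠ t : ℝ in 𝓝[>] 1, t ≠ c := by
  rcases le_or_gt c 1 with h | h
  · filter_upwards [self_mem_nhdsWithin] with t ht
    exact (h.trans_lt ht).ne'
  · filter_upwards [mem_nhdsWithin_of_mem_nhds (Iio_mem_nhds h)] with t ht
    exact ne_of_lt ht

variable {I : Finset ι} {y : ι → ℝ}

theorem one_lt_add (hy : Set.InjOn y I) (h1 : ∀ i ∈ I, 1 ≤ y i) {i j : ι} (hi : i ∈ I) (hj : j ∈ I)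
    (hij : i ≠ j) : 2 < y i + y j := by
  have := h1 i hi
  have := h1 j hj
  have hne : y i ≠ y j := fun h => hij (hy hi hj h)
  rcases lt_or_gt_of_ne hne with h | h <;> linarith

/-- Parts of a partition may differ by one, which is not generic. Dilating by $t>1$ close to $1$
repairs this: each pair excludes at most one $t$, and since $y_i+y_j>2$ the sums $ty_i+\delta+ty_j$
stay positive. The identities are then transported to $t=1$ by continuity. -/
theorem eventually_shiftGeneric (hy : Set.InjOn y I) (h1 : ∀ i ∈ I, 1 ≤ y i) {δ : ℝ}
    (hδ : -1 ≤ δ) : ∀ᶠ t : ℝ in 𝓝[>] 1, ShiftGeneric δ I fun i => t * y i := by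
  have h : ∀ᶠ t : ℝ in 𝓝[>] 1, ∀ i ∈ I, ∀ j ∈ I, t ≠ δ / (y j - y i) :=
    (Finset.eventually_all I).2 fun i _ => (Finset.eventually_all I).2 fun j _ =>
      eventually_ne_nhdsGT _
  filter_upwards [h, self_mem_nhdsWithin] with t ht ht1
  have ht1 : 1 < t := ht1
  refine ⟨fun i hi j hj hij => hy hi hj (mul_left_cancel₀ (by linarith) hij), fun i hi j hj hij => ?_⟩
  have h2 := one_lt_add hy h1 hi hj hij
  refine ⟨fun hc => ?_, by nlinarith⟩
  have hd : y j - y i ≠ 0 := fun h => hij (hy hi hj (by linarith))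
  exact ht i hi j hj (by rw [eq_div_iff hd]; linarith)

theorem continuousAt_shiftCoeff (hy : Set.InjOn y I) (h1 : ∀ i ∈ I, 1 ≤ y i) {δ : ℝ}
    (hδ : -1 ≤ δ) {i : ι} (hi : i ∈ I) :
    ContinuousAt (fun t : ℝ => shiftCoeff δ I (fun i => t * y i) i) 1 := by
  have hz : ∀ i, ContinuousAt (fun t : ℝ => t * y i) 1 := fun i =>
    continuousAt_id.mul continuousAt_const
  refine tendsto_finsetProd _ fun j hj => ?_
  have hij := (Finset.ne_of_mem_erase hj).symm
  have hj := Finset.mem_of_mem_erase hj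
  have h2 := one_lt_add hy h1 hi hj hij
  refine ContinuousAt.div (f := fun t : ℝ => (t * y i + δ - t * y j) * (t * y i + t * y j))
    (g := fun t : ℝ => (t * y i + δ + t * y j) * (t * y i - t * y j)) ?_ ?_ ?_
  · fun_prop
  · fun_prop
  · simp only [one_mul]
    exact mul_ne_zero (by linarith) (sub_ne_zero.2 fun h => hij (hy hi hj h))

theorem continuousAt_shiftSum (hy : Set.InjOn y I) (h1 : ∀ i ∈ I, 1 ≤ y i) {δ : ℝ}
    (hδ : -1 ≤ δ) {e : ℝ → ℝ} (he : ∀ i ∈ I, ContinuousAt e (y i)) (g : Gam) :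
    ContinuousAt (fun t : ℝ => shiftSum e δ I (fun i => t * y i) g) 1 := by
  have hz : ∀ i, ContinuousAt (fun t : ℝ => t * y i) 1 := fun i =>
    continuousAt_id.mul continuousAt_const
  refine tendsto_finsetSum _ fun i hi => ?_
  refine ((ContinuousAt.comp (f := fun t : ℝ => t * y i) ?_ (hz i)).mul
    (continuousAt_shiftCoeff hy h1 hδ hi)).mul
    (continuousAt_evalOn I (continuousAt_update hz i ((hz i).add continuousAt_const)) g)
  simpa using he i hi

theorem eq_of_eventually_nhdsGT {F G : ℝ → ℝ} (hF : ContinuousAt F 1) (hG : ContinuousAt G 1)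
    (h : ∀ᶠ t in 𝓝[>] 1, F t = G t) : F 1 = G 1 :=
  tendsto_nhds_unique_of_eventuallyEq (hF.tendsto.mono_left nhdsWithin_le_nhds)
    (hG.tendsto.mono_left nhdsWithin_le_nhds) h

/-- Lowering one variable of a factorial `Q`-function. -/
theorem shiftSum_neg_one_factQ_of_one_le {L : List ℕ} (hL : ∀ r ∈ L, r ≠ 0) (hy : Set.InjOn y I)
    (h1 : ∀ i ∈ I, 1 ≤ y i) :
    shiftSum (fun s => s) (-1) I y (factQ L) =
      (∑ i ∈ I, y i - L.sum) * evalOn I y (factQ L) := by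
  have hz : ∀ i, ContinuousAt (fun t : ℝ => t * y i) 1 := fun i =>
    continuousAt_id.mul continuousAt_const
  have := eq_of_eventually_nhdsGT
    (F := fun t => shiftSum (fun s => s) (-1) I (fun i => t * y i) (factQ L))
    (G := fun t => (∑ i ∈ I, t * y i - L.sum) * evalOn I (fun i => t * y i) (factQ L))
    (continuousAt_shiftSum hy h1 le_rfl (fun i _ => continuousAt_id) _)
    ((ContinuousAt.sub (tendsto_finsetSum _ fun i _ => hz i) continuousAt_const).mul
      (continuousAt_evalOn I hz _))
    ((eventually_shiftGeneric hy h1 le_rfl).mono fun t ht =>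
      shiftSum_neg_one_factQ hL ht)
  simpa using this

/-- Raising one variable of a factorial `Q`-function. -/
theorem raiseSum_factQ_of_one_le (α : ℝ) {a : ι} {L : List ℕ} (hL : ∀ r ∈ L, r ≠ 0)
    (hs : L.Pairwise (· > ·)) (haI : a ∉ I) (hy : Set.InjOn y I) (h1 : ∀ i ∈ I, 1 ≤ y i) :
    raiseSum α a I y (factQ L) = (2 * ∑ i ∈ I, y i + 2 * L.sum + α) * evalOn I y (factQ L) +
      2 * evalOn I y (lowerQ α (fun r => descPochhammer ℝ r) L) := by
  have hz : ∀ i, ContinuousAt (fun t : ℝ => t * y i) 1 := fun i =>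
    continuousAt_id.mul continuousAt_const
  have := eq_of_eventually_nhdsGT
    (F := fun t => raiseSum α a I (fun i => t * y i) (factQ L))
    (G := fun t => (2 * ∑ i ∈ I, t * y i + 2 * L.sum + α) *
      evalOn I (fun i => t * y i) (factQ L) +
      2 * evalOn I (fun i => t * y i) (lowerQ α (fun r => descPochhammer ℝ r) L)) ?_ ?_ ?_
  · simpa using this
  · refine (continuousAt_shiftSum hy h1 (by norm_num) (fun i hi => ?_) _).add
      ((continuousAt_const.mul (tendsto_finsetProd _ fun j hj => ?_)).mul
        (continuousAt_evalOn _ (continuousAt_update hz a continuousAt_const) _))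
    · have : y i + 1 ≠ 0 := by linarith [h1 i hi]
      fun_prop (disch := assumption)
    · have : 1 * y j + 1 ≠ 0 := by linarith [h1 j hj]
      exact ContinuousAt.div ((hz j).sub continuousAt_const) ((hz j).add continuousAt_const) this
  · exact ((((continuousAt_const.mul (tendsto_finsetSum _ fun i _ => hz i)).add
      continuousAt_const).add continuousAt_const).mul (continuousAt_evalOn I hz _)).add
        (continuousAt_const.mul (continuousAt_evalOn I hz _))
  · filter_upwards [eventually_shiftGeneric hy h1 (δ := 1) (by norm_num),
      self_mem_nhdsWithin] with t ht ht1
    have ht1 : 1 < t := ht1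
    have hlt : ∀ i ∈ I, 1 < t * y i := fun i hi => by nlinarith [h1 i hi]
    exact raiseSum_factQ α hL hs haI ht (fun i hi => by linarith [hlt i hi])
      fun i hi => (hlt i hi).ne'

end SpecialPosition

end DoublySymmetric

/-- The relation is a partial bijection that covers all nonzero terms. It serves to match neighbours
in the Schur graph with row indices, where the rows that cannot be changed carry coefficient zero.
-/
theorem Finset.sum_eq_sum_of_rel {A B M : Type*} [AddCommMonoid M] (s : Finset A) (t : Finset B)
    (R : A → B → Prop) (F : A → M) (G : B → M) (h₁ : ∀ a ∈ s, F a ≠ 0 → ∃ b ∈ t, R a b)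
    (h₂ : ∀ b ∈ t, G b ≠ 0 → ∃ a ∈ s, R a b)
    (h₃ : ∀ a ∈ s, ∀ b ∈ t, ∀ b' ∈ t, R a b → R a b' → b = b')
    (h₄ : ∀ a ∈ s, ∀ a' ∈ s, ∀ b ∈ t, R a b → R a' b → a = a')
    (h₅ : ∀ a ∈ s, ∀ b ∈ t, R a b → F a = G b) : ∑ a ∈ s, F a = ∑ b ∈ t, G b := by
  choose f hf hR using h₁
  refine Finset.sum_bij_ne_zero f (fun a ha h => hf a ha h) ?_ ?_ ?_
  · intro a ha h a' ha' h' e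
    exact h₄ a ha a' ha' (f a ha h) (hf a ha h) (hR a ha h) (e ▸ hR a' ha' h')
  · intro b hb h
    obtain ⟨a, ha, hab⟩ := h₂ b hb h
    have h0 : F a ≠ 0 := by rwa [h₅ a ha b hb hab]
    exact ⟨a, ha, h0, h₃ a ha _ (hf a ha h0) b hb (hR a ha h0) hab⟩
  · intro a ha h
    exact h₅ a ha _ (hf a ha h) (hR a ha h)

/-! ### Edges of the Schur graph, and the hook formula for the number of paths. -/

namespace StrictPartition

section Steps

/-- `l` is obtained from `m` by adding a box to the row `i`. -/
def StepAt (i : ℕ) (m l : StrictPartition) : Prop := l.row = m.row + Finsupp.single i 1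

variable {i j : ℕ} {m l : StrictPartition}

theorem StepAt.row_self (h : StepAt i m l) : l.row i = m.row i + 1 := by
  rw [h, Finsupp.add_apply, Finsupp.single_eq_same]

theorem StepAt.row_of_ne (h : StepAt i m l) (hj : j ≠ i) : l.row j = m.row j := by
  rw [h, Finsupp.add_apply, Finsupp.single_eq_of_ne hj, add_zero]

theorem stepAt_iff : StepAt i m l ↔ l.row i = m.row i + 1 ∧ ∀ j, j ≠ i → l.row j = m.row j := by
  refine ⟨fun h => ⟨h.row_self, fun j hj => h.row_of_ne hj⟩, fun h => ?_⟩
  refine Finsupp.ext fun j => ?_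
  rcases eq_or_ne j i with rfl | hj
  · rw [h.1, Finsupp.add_apply, Finsupp.single_eq_same]
  · rw [h.2 j hj, Finsupp.add_apply, Finsupp.single_eq_of_ne hj, add_zero]

theorem StepAt.eq_index (h : StepAt i m l) (h' : StepAt j m l) : i = j := by
  by_contra hne
  have h1 := h.row_self
  rw [h'.row_of_ne hne] at h1
  omega

theorem StepAt.eq_left {m' : StrictPartition} (h : StepAt i m l) (h' : StepAt i m' l) : m = m' :=
  StrictPartition.ext (add_right_cancel ((show _ = _ from h).symm.trans h'))

theorem StepAt.eq_right {l' : StrictPartition} (h : StepAt i m l) (h' : StepAt i m l') : l = l' :=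
  StrictPartition.ext ((show _ = _ from h).trans (show _ = _ from h').symm)

theorem StepAt.weight_eq (h : StepAt i m l) : l.weight = m.weight + 1 := by
  have hw : ∀ k : StrictPartition, k.weight = k.row.sum fun _ a => a := fun _ => rfl
  rw [hw, hw, show l.row = _ from h, Finsupp.sum_add_index' (fun _ => rfl) (fun _ _ _ => rfl),
    Finsupp.sum_single_index rfl]

theorem addsBox_iff {b : ℕ × ℕ} :
    AddsBox m b l ↔ StepAt b.1 m l ∧ b.2 = b.1 + m.row b.1 := by
  constructor
  · intro h
    have hb := h.row_eq
    have hmem : ∀ c : ℕ × ℕ, c ∈ l.boxes ↔ c = b ∨ c ∈ m.boxes := fun c => by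
      rw [h.2, Finset.mem_insert]
    have hlt : ∀ j k, k < l.row j ↔ (j, j + k) = b ∨ k < m.row j := fun j k => by
      have := hmem (j, j + k)
      simpa [mem_boxes] using this
    have h1 : m.row b.1 + 1 = l.row b.1 := by
      have e1 := hlt b.1 (m.row b.1)
      have e2 := h.1
      rw [mem_boxes] at e2
      have e3 : ∀ k, k < l.row b.1 → k = b.2 - b.1 ∨ k < m.row b.1 := fun k hk => by
        rcases (hlt b.1 k).1 hk with e | e
        · left
          have := congrArg Prod.snd e
          simp only at this
          omega
        · exact Or.inr e
      by_contra hne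
      rcases Nat.lt_or_ge (m.row b.1 + 1) (l.row b.1) with h' | h'
      · rcases e3 (m.row b.1) (by omega) with e | e <;> omega
      · have : l.row b.1 ≤ m.row b.1 := by omega
        exact e2 ⟨hb.1, by omega⟩
    refine ⟨stepAt_iff.2 ⟨h1.symm, fun j hj => ?_⟩, by omega⟩
    have hne : ∀ k, (j, j + k) ≠ b := fun k e => hj (congrArg Prod.fst e)
    refine le_antisymm ?_ ?_
    · by_contra hc
      rcases (hlt j (m.row j)).1 (not_le.1 hc) with e | e
      · exact hne _ e
      · exact lt_irrefl _ e
    · by_contra hc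
      exact lt_irrefl _ ((hlt j (l.row j)).2 (Or.inr (not_le.1 hc)))
  · rintro ⟨h, hb⟩
    have h1 := h.row_self
    refine ⟨fun hc => ?_, ?_⟩
    · rw [mem_boxes] at hc
      omega
    · ext c
      rw [Finset.mem_insert, mem_boxes, mem_boxes]
      rcases eq_or_ne c.1 b.1 with hc | hc
      · rw [hc, h1, Prod.ext_iff, hc]
        constructor
        · rintro ⟨h2, h3⟩
          by_cases h4 : c.2 = b.2
          · exact Or.inl ⟨rfl, h4⟩
          · exact Or.inr ⟨h2, by omega⟩
        · rintro (⟨-, h2⟩ | ⟨h2, h3⟩)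
          · omega
          · omega
      · rw [h.row_of_ne hc]
        constructor
        · exact Or.inr
        · rintro (rfl | h2)
          · exact absurd rfl hc
          · exact h2

theorem up_iff : m.Up l ↔ ∃ i, StepAt i m l :=
  ⟨fun ⟨b, h⟩ => ⟨b.1, (addsBox_iff.1 h).1⟩,
    fun ⟨i, h⟩ => ⟨(i, i + m.row i), addsBox_iff.2 ⟨h, rfl⟩⟩⟩

theorem StepAt.support_eq (h : StepAt i m l) : l.row.support = insert i m.row.support := by
  ext j
  rw [Finset.mem_insert, Finsupp.mem_support_iff, Finsupp.mem_support_iff]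
  rcases eq_or_ne j i with rfl | hj
  · simp [h.row_self]
  · simp [h.row_of_ne hj, hj]

theorem StepAt.length_eq_of_ne_zero (h : StepAt i m l) (hi : m.row i ≠ 0) :
    l.length = m.length := by
  rw [length, length, h.support_eq, Finset.insert_eq_of_mem (Finsupp.mem_support_iff.2 hi)]

theorem StepAt.length_eq_of_eq_zero (h : StepAt i m l) (hi : m.row i = 0) :
    l.length = m.length + 1 := by
  rw [length, length, h.support_eq, Finset.card_insert_of_notMem (by simpa using hi)]

theorem StepAt.kappa_eq (h : StepAt i m l) : kappa m l = if m.row i = 0 then 1 else 2 := by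
  have hup : m.Up l := up_iff.2 ⟨i, h⟩
  split_ifs with hi
  · have := h.length_eq_of_eq_zero hi
    rw [kappa, if_neg (by omega), if_pos ⟨hup, this⟩]
  · rw [kappa, if_pos ⟨hup, h.length_eq_of_ne_zero hi⟩]

theorem exists_stepAt_of_kappa_ne_zero (h : kappa m l ≠ 0) : ∃ i, StepAt i m l := by
  rw [← up_iff]
  by_contra hc
  exact h (by rw [kappa, if_neg (fun h => hc h.1), if_neg (fun h => hc h.1)])

/-- A box can be removed from the row `i` unless the next row is only one box shorter. -/
theorem exists_stepAt_left (l : StrictPartition) (i : ℕ) (hi : l.row i ≠ 0)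
    (h : l.row i = l.row (i + 1) + 1 → l.row (i + 1) = 0) : ∃ m, StepAt i m l := by
  refine ⟨⟨l.row - Finsupp.single i 1, fun a b hab hb => ?_⟩, stepAt_iff.2 ⟨?_, fun j hj => ?_⟩⟩
  · rw [Finsupp.tsub_apply] at hb
    rw [Finsupp.tsub_apply, Finsupp.tsub_apply]
    have h1 := l.strict a b hab (by omega)
    rcases eq_or_ne a i with rfl | ha
    · rw [Finsupp.single_eq_of_ne hab.ne'] at hb ⊢
      rw [Finsupp.single_eq_same]
      rcases Nat.eq_or_lt_of_le (Nat.succ_le_of_lt hab) with e | hlt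
      · rw [Nat.succ_eq_add_one] at e
        subst e
        omega
      · have := l.strict (a + 1) b hlt (by omega)
        have := l.strict a (a + 1) (Nat.lt_succ_self a) (by omega)
        omega
    · rw [Finsupp.single_eq_of_ne ha]
      omega
  · simp only [Finsupp.tsub_apply, Finsupp.single_eq_same]
    omega
  · simp only [Finsupp.tsub_apply, Finsupp.single_eq_of_ne hj, Nat.sub_zero]

/-- A box can be added to the row `i` unless the previous row is only one box longer. -/
theorem exists_stepAt_right (m : StrictPartition) (i : ℕ) (hi : i ≤ m.length)
    (h : ∀ j, j + 1 = i → m.row j ≠ m.row i + 1) : ∃ l, StepAt i m l := by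
  refine ⟨⟨m.row + Finsupp.single i 1, fun a b hab hb => ?_⟩, rfl⟩
  rw [Finsupp.add_apply] at hb ⊢
  rw [Finsupp.add_apply]
  rcases eq_or_ne b i with rfl | hbi
  · rw [Finsupp.single_eq_same, Finsupp.single_eq_of_ne hab.ne]
    obtain ⟨c, rfl⟩ : ∃ c, b = c + 1 := ⟨b - 1, by omega⟩
    have hc := (m.row_ne_zero_iff c).2 (by omega)
    have h1 : m.row (c + 1) < m.row c := by
      rcases Nat.eq_zero_or_pos (m.row (c + 1)) with e | e
      · omega
      · exact m.strict _ _ (Nat.lt_succ_self c) e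
    have h2 := h c rfl
    have h3 : m.row c ≤ m.row a := by
      rcases eq_or_ne a c with rfl | hac
      · exact le_rfl
      · exact (m.strict a c (by omega) (Nat.pos_of_ne_zero hc)).le
    omega
  · rw [Finsupp.single_eq_of_ne hbi] at hb ⊢
    have := m.strict a b hab (by omega)
    omega

end Steps

section Weights

open DoublySymmetric

/-- The parts of a strict partition as real numbers. -/
noncomputable def realRow (l : StrictPartition) (i : ℕ) : ℝ := l.row i

theorem injOn_realRow (l : StrictPartition) : Set.InjOn l.realRow l.row.support := by
  intro i hi j hj hij
  have hi := Nat.pos_of_ne_zero (Finsupp.mem_support_iff.1 (Finset.mem_coe.1 hi))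
  have hj := Nat.pos_of_ne_zero (Finsupp.mem_support_iff.1 (Finset.mem_coe.1 hj))
  have hij : l.row i = l.row j := Nat.cast_injective hij
  rcases lt_trichotomy i j with h | h | h
  · have := l.strict i j h hj
    omega
  · exact h
  · have := l.strict j i h hi
    omega

theorem one_le_realRow (l : StrictPartition) : ∀ i ∈ l.row.support, 1 ≤ l.realRow i := fun i hi => by
  have := Nat.pos_of_ne_zero (Finsupp.mem_support_iff.1 hi)
  exact Nat.one_le_cast.2 this

theorem sum_realRow (l : StrictPartition) : ∑ i ∈ l.row.support, l.realRow i = l.weight := by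
  rw [weight, Nat.cast_sum]
  rfl

theorem StepAt.realRow_eq {i : ℕ} {m l : StrictPartition} (h : StepAt i m l) :
    l.realRow = Function.update m.realRow i (m.realRow i + 1) := by
  funext j
  rcases eq_or_ne j i with rfl | hj
  · rw [Function.update_self, realRow, realRow, h.row_self]
    push_cast
    ring
  · rw [Function.update_of_ne hj, realRow, realRow, h.row_of_ne hj]

theorem StepAt.realRow_eq' {i : ℕ} {m l : StrictPartition} (h : StepAt i m l) :
    m.realRow = Function.update l.realRow i (l.realRow i - 1) := by
  rw [h.realRow_eq]
  simp

/-- The value of a doubly symmetric function at the parts of a strict partition. -/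
noncomputable def evalAt (l : StrictPartition) : Gam →ₐ[ℝ] ℝ := evalOn l.row.support l.realRow

theorem evalOn_eq_of_subset {ι : Type*} [DecidableEq ι] {I J : Finset ι} (hIJ : I ⊆ J) {y : ι → ℝ}
    (h : ∀ j ∈ J, j ∉ I → y j = 0) : evalOn J y = evalOn I y := by
  unfold evalOn
  congr 1
  funext m
  exact (Finset.sum_subset hIJ fun j hj hI => by
    rw [h j hj hI, zero_pow (Nat.succ_ne_zero _)]).symm

theorem evalAt_eq_of_subset (l : StrictPartition) {J : Finset ℕ} (hJ : l.row.support ⊆ J) :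
    evalAt l = evalOn J l.realRow :=
  (evalOn_eq_of_subset hJ fun j _ hj => by
    rw [realRow, Finsupp.notMem_support_iff.1 hj, Nat.cast_zero]).symm

/-- The square root of `∏_{i ≠ j} |yᵢ - yⱼ| / (yᵢ + yⱼ)`. -/
noncomputable def absVand (I : Finset ℕ) (y : ℕ → ℝ) : ℝ :=
  Real.sqrt (∏ i ∈ I, ∏ j ∈ I.erase i, |y i - y j| / |y i + y j|)

theorem absVand_eq_mul (I : Finset ℕ) (y : ℕ → ℝ) {u : ℕ} (hu : u ∈ I) :
    absVand I y = (∏ j ∈ I.erase u, |y u - y j| / |y u + y j|) * absVand (I.erase u) y := by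
  have h0 : 0 ≤ ∏ j ∈ I.erase u, |y u - y j| / |y u + y j| :=
    Finset.prod_nonneg fun j _ => by positivity
  rw [absVand, absVand, ← Real.sqrt_sq h0, ← Real.sqrt_mul (sq_nonneg _)]
  congr 1
  rw [← Finset.mul_prod_erase I _ hu, pow_two, mul_assoc]
  congr 1
  rw [← Finset.prod_mul_distrib]
  refine Finset.prod_congr rfl fun i hi => ?_
  rw [← Finset.mul_prod_erase (I.erase i) _ (Finset.mem_erase.2
    ⟨(Finset.ne_of_mem_erase hi).symm, hu⟩), Finset.erase_right_comm, abs_sub_comm, add_comm (y i)]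

theorem absVand_congr {I : Finset ℕ} {y z : ℕ → ℝ} (h : ∀ i ∈ I, y i = z i) :
    absVand I y = absVand I z := by
  unfold absVand
  congr 1
  refine Finset.prod_congr rfl fun i hi => Finset.prod_congr rfl fun j hj => ?_
  rw [h i hi, h j (Finset.mem_of_mem_erase hj)]

/-- The hook formula for the number of paths in the Schur graph. -/
noncomputable def hookNumber (l : StrictPartition) : ℝ :=
  2 ^ l.weight / 2 ^ l.length * (l.weight.factorial / ∏ i ∈ l.row.support, ((l.row i).factorial : ℝ)) *
    absVand l.row.support l.realRow

theorem sub_ne_zero_realRow (l : StrictPartition) {i j : ℕ} (hi : i ∈ l.row.support)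
    (hj : j ∈ l.row.support) (hij : i ≠ j) : l.realRow i - l.realRow j ≠ 0 :=
  sub_ne_zero.2 fun h => hij (l.injOn_realRow hi hj h)

theorem hookNumber_pos (l : StrictPartition) : 0 < l.hookNumber := by
  have : 0 < absVand l.row.support l.realRow := by
    refine Real.sqrt_pos.2 (Finset.prod_pos fun i hi => Finset.prod_pos fun j hj => ?_)
    have hj' := Finset.mem_of_mem_erase hj
    have h1 := l.sub_ne_zero_realRow hi hj' (Finset.ne_of_mem_erase hj).symm
    have h2 : l.realRow i + l.realRow j ≠ 0 := by
      linarith [l.one_le_realRow i hi, l.one_le_realRow j hj']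
    positivity
  have h2 : (0 : ℝ) < ∏ i ∈ l.row.support, ((l.row i).factorial : ℝ) :=
    Finset.prod_pos fun i _ => by exact_mod_cast Nat.factorial_pos _
  have h3 : (0 : ℝ) < l.weight.factorial := by exact_mod_cast Nat.factorial_pos _
  unfold hookNumber
  positivity

/-- The coefficient attached to the removal of a box from the row `i`. -/
noncomputable def downCoeff (l : StrictPartition) (i : ℕ) : ℝ :=
  l.realRow i * shiftCoeff (-1) l.row.support l.realRow i

/-- The two kinds of edges are treated at once, because a zero row may be included in all products:
$0!=1$ and $|0-y|/|0+y|=1$. The multiplicity $\kappa$ compensates the change of $2^{-\ell}$. -/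
theorem StepAt.kappa_mul_hookNumber {i : ℕ} {m l : StrictPartition} (h : StepAt i m l) :
    (kappa m l : ℝ) * hookNumber m * (m.weight + 1) = downCoeff l i * hookNumber l := by
  set I := l.row.support with hI
  have hIm : I = insert i m.row.support := h.support_eq
  have hiI : i ∈ I := hIm ▸ Finset.mem_insert_self _ _
  have hsub : m.row.support ⊆ I := hIm ▸ Finset.subset_insert _ _
  have hother : ∀ k ∈ I.erase i, m.realRow k = l.realRow k := fun k hk => by
    rw [realRow, realRow, h.row_of_ne (Finset.ne_of_mem_erase hk)]
  have hyi : l.realRow i = m.realRow i + 1 := by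
    rw [realRow, realRow, h.row_self]
    push_cast
    ring
  have hm0 : 0 ≤ m.realRow i := Nat.cast_nonneg _
  -- everything is a product over `I`
  have hfac : ∏ k ∈ m.row.support, ((m.row k).factorial : ℝ) =
      ∏ k ∈ I, ((m.row k).factorial : ℝ) :=
    Finset.prod_subset hsub fun k _ hk => by
      rw [Finsupp.notMem_support_iff.1 hk, Nat.factorial_zero, Nat.cast_one]
  have hfac2 : ∏ k ∈ I, ((l.row k).factorial : ℝ) =
      l.realRow i * ∏ k ∈ I, ((m.row k).factorial : ℝ) := by
    rw [← Finset.mul_prod_erase I _ hiI,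
      ← Finset.mul_prod_erase I (fun k => ((m.row k).factorial : ℝ)) hiI, h.row_self,
      Nat.factorial_succ, hyi, realRow]
    push_cast
    rw [mul_assoc]
    congr 2
    exact Finset.prod_congr rfl fun k hk => by rw [h.row_of_ne (Finset.ne_of_mem_erase hk)]
  have hvand : absVand m.row.support m.realRow = absVand I m.realRow := by
    by_cases hi : i ∈ m.row.support
    · rw [hIm, Finset.insert_eq_of_mem hi]
    · have h0 : m.realRow i = 0 := by
        rw [realRow, Finsupp.notMem_support_iff.1 hi, Nat.cast_zero]
      rw [absVand_eq_mul I _ hiI, hIm, Finset.erase_insert hi, Finset.prod_eq_one, one_mul]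
      intro k hk
      have := m.one_le_realRow k hk
      rw [h0, zero_sub, zero_add, abs_neg, div_self]
      exact abs_ne_zero.2 (by linarith)
  have hk : (kappa m l : ℝ) / 2 ^ m.length = 2 / 2 ^ l.length := by
    rw [h.kappa_eq]
    split_ifs with hi
    · rw [h.length_eq_of_eq_zero hi, pow_succ]
      field_simp
      norm_num
    · rw [h.length_eq_of_ne_zero hi]
      norm_num
  have hv2 : absVand I m.realRow = shiftCoeff (-1) I l.realRow i * absVand I l.realRow := by
    rw [absVand_eq_mul I _ hiI, absVand_eq_mul I l.realRow hiI, absVand_congr hother, ← mul_assoc]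
    congr 1
    rw [shiftCoeff, ← Finset.prod_mul_distrib]
    refine Finset.prod_congr rfl fun k hk => ?_
    have hki := Finset.ne_of_mem_erase hk
    have hkI := Finset.mem_of_mem_erase hk
    have h1 := l.sub_ne_zero_realRow hiI hkI hki.symm
    have hk1 := l.one_le_realRow k hkI
    have e1 : l.realRow i + -1 = m.realRow i := by linarith
    rw [hother k hk, e1, abs_of_pos (show 0 < m.realRow i + l.realRow k by linarith),
      abs_of_pos (show 0 < l.realRow i + l.realRow k by linarith)]
    have h2 : m.realRow i + l.realRow k ≠ 0 := by linarith
    have h3 : l.realRow i + l.realRow k ≠ 0 := by linarith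
    have h4 : m.row i ≠ l.row k := by
      rw [h.row_of_ne hki]
      intro hc
      have hkm : m.row k ≠ 0 := by
        rw [← h.row_of_ne hki]
        exact Finsupp.mem_support_iff.1 hkI
      have hi : m.row i ≠ 0 := hc ▸ hkm
      exact hki (m.injOn_realRow (Finsupp.mem_support_iff.2 hkm) (Finsupp.mem_support_iff.2 hi)
        (by rw [realRow, realRow, hc]))
    -- The integers $m_i$ and $l_k$ differ, so adding one to $m_i$ cannot cross $l_k$. Both
    -- differences have the same sign, and the absolute values can be removed.
    rcases lt_or_gt_of_ne h4 with hlt | hlt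
    · have h5 : m.realRow i < l.realRow k := Nat.cast_lt.2 hlt
      have h6 : l.realRow i ≤ l.realRow k := by
        rw [realRow, realRow, h.row_self]
        exact_mod_cast hlt
      have h7 : l.realRow i - l.realRow k < 0 := lt_of_le_of_ne (by linarith) h1
      rw [abs_of_neg h7, abs_of_neg (by linarith)]
      field_simp
    · have h5 : l.realRow k < m.realRow i := Nat.cast_lt.2 hlt
      rw [abs_of_pos (by linarith), abs_of_pos (by linarith)]
      field_simp
  have hP : ∏ k ∈ I, ((m.row k).factorial : ℝ) ≠ 0 :=
    Finset.prod_ne_zero_iff.2 fun k _ => by exact_mod_cast (Nat.factorial_pos _).ne'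
  have hl0 : l.realRow i ≠ 0 := by linarith
  have hcast : ((m.weight + 1 : ℕ) : ℝ) = m.weight + 1 := by push_cast; ring
  rw [hookNumber, hookNumber, downCoeff, ← hI, hfac, hvand, hv2, hfac2, h.weight_eq,
    Nat.factorial_succ, Nat.cast_mul, hcast, pow_succ]
  have e : (kappa m l : ℝ) = 2 / 2 ^ l.length * 2 ^ m.length := by
    rw [← hk]
    field_simp
  rw [e]
  field_simp

/-- If the next row is nonempty and one box shorter, the factor with index $i+1$ contains
$l_i-1-l_{i+1}=0$. -/
theorem downCoeff_ne_zero_iff (l : StrictPartition) {i : ℕ} (hi : i ∈ l.row.support)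
    (h : downCoeff l i ≠ 0) : ∃ m, StepAt i m l := by
  refine exists_stepAt_left l i (Finsupp.mem_support_iff.1 hi) fun h1 => ?_
  by_contra h2
  refine h ?_
  rw [downCoeff, shiftCoeff, Finset.prod_eq_zero (i := i + 1), mul_zero]
  · exact Finset.mem_erase.2 ⟨by omega, Finsupp.mem_support_iff.2 h2⟩
  · have : l.realRow i + -1 - l.realRow (i + 1) = 0 := by
      rw [realRow, realRow, h1]
      push_cast
      ring
    rw [this, zero_mul, zero_div]

/-- This is the lowering identity for the empty list. It is the recursion needed for `hookNumber` to
count paths. -/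
theorem sum_downCoeff (l : StrictPartition) :
    ∑ i ∈ l.row.support, downCoeff l i = l.weight := by
  have := shiftSum_neg_one_factQ_of_one_le (L := []) (by simp) l.injOn_realRow l.one_le_realRow
  simpa [shiftSum, vertexQ, sum_realRow, downCoeff] using this

/-- Sums over the edges ending at `l`. -/
theorem sum_kappa_mul (n : ℕ) (l : StrictPartition) (hl : l.weight = n + 1)
    (F : StrictPartition → ℝ) (G : ℕ → ℝ) (hG : ∀ i m, StepAt i m l → G i = F m) :
    ∑ m : Level n, (kappa m.1 l : ℝ) * hookNumber m.1 * F m.1 =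
      hookNumber l / (n + 1) * ∑ i ∈ l.row.support, downCoeff l i * G i := by
  rw [Finset.mul_sum]
  refine Finset.sum_eq_sum_of_rel _ _ (fun m i => StepAt i m.1 l) _ _ ?_ ?_ ?_ ?_ ?_
  · intro m _ h
    obtain ⟨i, hi⟩ := exists_stepAt_of_kappa_ne_zero (m := m.1) (l := l) fun hc =>
      h (by rw [hc, Nat.cast_zero, zero_mul, zero_mul])
    exact ⟨i, hi.support_eq ▸ Finset.mem_insert_self _ _, hi⟩
  · intro i hi h
    obtain ⟨m, hm⟩ := downCoeff_ne_zero_iff l hi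
      (left_ne_zero_of_mul (right_ne_zero_of_mul h))
    have := hm.weight_eq
    exact ⟨⟨m, by omega⟩, Finset.mem_univ _, hm⟩
  · exact fun m _ i _ j _ hi hj => hi.eq_index hj
  · exact fun m _ m' _ i _ h h' => Subtype.ext (h.eq_left h')
  · intro m _ i _ h
    have h1 := h.kappa_mul_hookNumber
    rw [m.2] at h1
    have : (n : ℝ) + 1 ≠ 0 := by positivity
    rw [hG i m.1 h]
    field_simp
    linear_combination F m.1 * h1

end Weights

section Paths

theorem kappa_eq_zero_of_weight_ne {m l : StrictPartition} (h : l.weight ≠ m.weight + 1) :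
    kappa m l = 0 := by
  by_contra hc
  obtain ⟨i, hi⟩ := exists_stepAt_of_kappa_ne_zero hc
  exact h hi.weight_eq

/-- The paths ending at a nonempty partition, by their last edge. -/
noncomputable def pathEquiv (n : ℕ) (l : StrictPartition) (hl : l.weight = n + 1) :
    Quiver.Path empty l ≃ Σ m : Level n, Quiver.Path empty m.1 × Fin (kappa m.1 l) where
  toFun p := match l, p, hl with
    | _, .nil, hl => absurd hl (by simp [empty, weight])
    | l, .cons (b := m) p e, hl => ⟨⟨m, by
        by_contra hc
        have : kappa m l = 0 := kappa_eq_zero_of_weight_ne (by omega)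
        exact (this ▸ (show Fin (kappa m l) from e)).elim0⟩, p, e⟩
  invFun x := .cons x.2.1 x.2.2
  left_inv p := by
    cases p with
    | nil => exact absurd hl (by simp [empty, weight])
    | cons p e => rfl
  right_inv x := rfl

/-- Both sides satisfy the same recursion over the last edge. Finiteness is carried along because
the cardinality of an infinite type is $0$ by convention, so counting over the last edge requires
it. -/
theorem finite_path_and_numPaths (n : ℕ) (l : StrictPartition) (hl : l.weight = n) :
    Finite (Quiver.Path empty l) ∧ (numPaths l : ℝ) = hookNumber l := by
  induction n generalizing l with
  | zero =>
    have hrow : l.row = 0 := Finsupp.ext fun i => Nat.le_zero.1 ((l.row_le_weight i).trans_eq hl)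
    obtain rfl : l = empty := StrictPartition.ext hrow
    have huniq : ∀ p : Quiver.Path empty empty, p = .nil := fun p => by
      cases p with
      | nil => rfl
      | cons p e =>
        rename_i m
        have : kappa m empty = 0 := kappa_eq_zero_of_weight_ne (by omega)
        exact (this ▸ (show Fin (kappa m empty) from e)).elim0
    have : Unique (Quiver.Path empty empty) := ⟨⟨.nil⟩, huniq⟩
    refine ⟨inferInstance, ?_⟩
    rw [numPaths, Nat.card_unique]
    simp [hookNumber, empty, weight, length, absVand]
  | succ n ih =>
    have hfin : ∀ m : Level n, Finite (Quiver.Path empty m.1) := fun m => (ih m.1 m.2).1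
    refine ⟨Finite.of_equiv _ (pathEquiv n l hl).symm, ?_⟩
    rw [numPaths, Nat.card_congr (pathEquiv n l hl), Nat.card_sigma]
    have h1 := sum_kappa_mul n l hl (fun _ => 1) (fun _ => 1) fun _ _ _ => rfl
    simp only [mul_one] at h1
    rw [sum_downCoeff, hl] at h1
    have : (n : ℝ) + 1 ≠ 0 := by positivity
    push_cast at h1 ⊢
    rw [div_mul_cancel₀ _ this] at h1
    rw [← h1]
    refine Finset.sum_congr rfl fun m _ => ?_
    rw [Nat.card_prod, Nat.card_fin, ← (ih m.1 m.2).2, numPaths]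
    push_cast
    ring

theorem numPaths_eq_hookNumber (l : StrictPartition) : (numPaths l : ℝ) = hookNumber l :=
  (finite_path_and_numPaths _ l rfl).2

end Paths

end StrictPartition

/-! ### The transition operators on factorial $Q$-functions. -/

namespace StrictPartition

open DoublySymmetric

section Transitions

theorem StepAt.evalAt_eq {i : ℕ} {m l : StrictPartition} (h : StepAt i m l) :
    evalAt m = evalOn l.row.support (Function.update l.realRow i (l.realRow i - 1)) := by
  rw [← h.realRow_eq']
  exact m.evalAt_eq_of_subset (h.support_eq ▸ Finset.subset_insert _ _)

theorem sum_pDown_mul_evalAt {n : ℕ} {l : StrictPartition} (hl : l.weight = n + 1) (g : Gam) :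
    ∑ m : Level n, pDown l m.1 * evalAt m.1 g =
      shiftSum (fun s => s) (-1) l.row.support l.realRow g / (n + 1) := by
  have h := sum_kappa_mul n l hl (fun m => evalAt m g)
    (fun i => evalOn l.row.support (Function.update l.realRow i (l.realRow i - 1)) g)
    fun i m hm => by rw [hm.evalAt_eq]
  have h0 := l.hookNumber_pos.ne'
  have h1 : ∀ m : Level n, pDown l m.1 * evalAt m.1 g =
      (kappa m.1 l : ℝ) * hookNumber m.1 * evalAt m.1 g / hookNumber l := fun m => by
    rw [pDown, numPaths_eq_hookNumber, numPaths_eq_hookNumber]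
    ring
  rw [Finset.sum_congr rfl fun m _ => h1 m, ← Finset.sum_div, h, shiftSum]
  simp only [downCoeff, ← sub_eq_add_neg]
  field_simp

theorem sum_pDown_mul_factQ {n : ℕ} {l : StrictPartition} (hl : l.weight = n + 1) {L : List ℕ}
    (hL : ∀ r ∈ L, r ≠ 0) :
    ∑ m : Level n, pDown l m.1 * evalAt m.1 (factQ L) =
      ((n : ℝ) + 1 - L.sum) / (n + 1) * evalAt l (factQ L) := by
  rw [sum_pDown_mul_evalAt hl,
    shiftSum_neg_one_factQ_of_one_le hL l.injOn_realRow l.one_le_realRow, sum_realRow, hl, evalAt]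
  push_cast
  ring

theorem content_nonneg {l : StrictPartition} {b : ℕ × ℕ} (hb : b ∈ l.boxes) : 0 ≤ content b := by
  rw [mem_boxes] at hb
  rw [content]
  omega

variable {α : ℝ}

theorem multMeasure_pos (hα : 0 < α) (l : StrictPartition) : 0 < multMeasure α l := by
  have h1 := l.hookNumber_pos
  have h2 : 0 < multZ α l.weight := Finset.prod_pos fun i _ => by positivity
  have h3 : 0 < ∏ b ∈ l.boxes, ((content b : ℝ) * ((content b : ℝ) + 1) + α) :=
    Finset.prod_pos fun b hb => by
      have : (0 : ℝ) ≤ content b := by exact_mod_cast content_nonneg hb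
      positivity
  have h4 : (0 : ℝ) < l.weight.factorial := by exact_mod_cast Nat.factorial_pos _
  rw [multMeasure, plancherel, numPaths_eq_hookNumber]
  positivity

/-- In the quotient of the measures only the new box, of content $l_i$, and the last factor of the
normalization survive, and the change of $2^\ell$ amounts to a factor $1/\kappa$. One quotient of
path numbers cancels against the down transition, the other is given by the hook recursion. -/
theorem StepAt.pUp_eq (hα : 0 < α) {i : ℕ} {l v : StrictPartition} (h : StepAt i l v) :
    pUp α l v = (kappa l v : ℝ) * (l.realRow i * (l.realRow i + 1) + α) /
      (downCoeff v i * (α + 2 * l.weight)) := by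
  have hbox : AddsBox l (i, i + l.row i) v := addsBox_iff.2 ⟨h, rfl⟩
  have hc : ((content (i, i + l.row i) : ℤ) : ℝ) = l.realRow i := by
    rw [content, realRow]
    push_cast
    ring
  have hl := l.hookNumber_pos
  have hv := v.hookNumber_pos
  have hkap : (0 : ℝ) < kappa l v := by
    rw [h.kappa_eq]
    split_ifs <;> norm_num
  have hrel := h.kappa_mul_hookNumber
  have hd : 0 < downCoeff v i := by
    have : 0 < downCoeff v i * hookNumber v := hrel ▸ by positivity
    exact pos_of_mul_pos_left this hv.le
  have hpow : (2 : ℝ) ^ v.length * kappa l v = 2 * 2 ^ l.length := by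
    rw [h.kappa_eq]
    split_ifs with hi
    · rw [h.length_eq_of_eq_zero hi, pow_succ]
      push_cast
      ring
    · rw [h.length_eq_of_ne_zero hi]
      push_cast
      ring
  have hZ : 0 < multZ α l.weight := Finset.prod_pos fun i _ => by positivity
  have hP : 0 < ∏ b ∈ l.boxes, ((content b : ℝ) * ((content b : ℝ) + 1) + α) :=
    Finset.prod_pos fun b hb => by
      have : (0 : ℝ) ≤ content b := by exact_mod_cast content_nonneg hb
      positivity
  have hf : (0 : ℝ) < l.weight.factorial := by exact_mod_cast Nat.factorial_pos _
  have hM : multMeasure α v = multMeasure α l * ((hookNumber v / hookNumber l) ^ 2 *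
      (l.realRow i * (l.realRow i + 1) + α) / (kappa l v * (l.weight + 1) *
        (α + 2 * l.weight))) := by
    rw [multMeasure, multMeasure, plancherel, plancherel, numPaths_eq_hookNumber,
      numPaths_eq_hookNumber, h.weight_eq, hbox.2, Finset.prod_insert hbox.1, hc, multZ, multZ,
      Finset.prod_range_succ, Nat.factorial_succ, zpow_sub₀ two_ne_zero, zpow_sub₀ two_ne_zero,
      zpow_natCast, zpow_natCast, zpow_natCast, zpow_natCast, pow_succ]
    rw [multZ] at hZ
    have e : (2 : ℝ) ^ v.length = 2 * 2 ^ l.length / kappa l v := by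
      rw [eq_div_iff hkap.ne', hpow]
    have hw : (l.weight : ℝ) + 1 ≠ 0 := by positivity
    have hw2 : α + 2 * (l.weight : ℝ) ≠ 0 := by positivity
    rw [e]
    push_cast
    field_simp
    ring
  have hw : (l.weight : ℝ) + 1 ≠ 0 := by positivity
  have hw2 : α + 2 * (l.weight : ℝ) ≠ 0 := by positivity
  rw [pUp, hM, mul_div_cancel_left₀ _ (multMeasure_pos hα l).ne', pDown, numPaths_eq_hookNumber,
    numPaths_eq_hookNumber]
  field_simp
  linear_combination -(l.realRow i * (l.realRow i + 1) + α) * hrel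

/-- Raising and lowering are inverse: the shift coefficients of $l$ for $+1$ and of $v$ for $-1$
multiply to $1$, factor by factor. -/
theorem StepAt.pUp_eq_of_ne_zero (hα : 0 < α) {i : ℕ} {l v : StrictPartition} (h : StepAt i l v)
    (hi : l.row i ≠ 0) : pUp α l v * (α + 2 * l.weight) =
      2 * (l.realRow i * (l.realRow i + 1) + α) / (l.realRow i + 1) *
        shiftCoeff 1 l.row.support l.realRow i := by
  have hmem : i ∈ l.row.support := Finsupp.mem_support_iff.2 hi
  have hS : v.row.support = l.row.support := by
    rw [h.support_eq, Finset.insert_eq_of_mem hmem]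
  have hvi : v.realRow i = l.realRow i + 1 := by
    rw [h.realRow_eq, Function.update_self]
  have h1 : shiftCoeff (-1) v.row.support v.realRow i *
      shiftCoeff 1 l.row.support l.realRow i = 1 := by
    rw [shiftCoeff, shiftCoeff, hS, ← Finset.prod_mul_distrib]
    refine Finset.prod_eq_one fun k hk => ?_
    have hki := Finset.ne_of_mem_erase hk
    have hk := Finset.mem_of_mem_erase hk
    have e1 := l.sub_ne_zero_realRow hmem hk hki.symm
    have e2 := v.sub_ne_zero_realRow (hS ▸ hmem) (hS ▸ hk) hki.symm
    have hvk : v.realRow k = l.realRow k := by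
      rw [h.realRow_eq, Function.update_of_ne hki]
    rw [hvk] at e2 ⊢
    rw [hvi] at e2 ⊢
    have h1 := l.one_le_realRow i hmem
    have h2 := l.one_le_realRow k hk
    have e3 : l.realRow i + 1 + l.realRow k ≠ 0 := by linarith
    have e4 : l.realRow i + l.realRow k ≠ 0 := by linarith
    rw [show l.realRow i + 1 + -1 = l.realRow i by ring]
    field_simp
  have h2 : shiftCoeff (-1) v.row.support v.realRow i ≠ 0 := left_ne_zero_of_mul_eq_one h1
  have hw2 : α + 2 * (l.weight : ℝ) ≠ 0 := by positivity
  have h3 : l.realRow i + 1 ≠ 0 := by linarith [l.one_le_realRow i hmem]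
  rw [h.pUp_eq hα, h.kappa_eq, if_neg hi, downCoeff, hvi,
    eq_div_of_mul_eq h2 ((mul_comm _ _).trans h1)]
  push_cast
  field_simp

/-- The new part equals $1$, and its lowering coefficient is the inverse of $\prod(l_k-1)/(l_k+1)$.
-/
theorem StepAt.pUp_eq_of_eq_zero (hα : 0 < α) {i : ℕ} {l v : StrictPartition} (h : StepAt i l v)
    (hi : l.row i = 0) : pUp α l v * (α + 2 * l.weight) =
      α * ∏ k ∈ l.row.support, (l.realRow k - 1) / (l.realRow k + 1) := by
  have hmem : i ∉ l.row.support := Finsupp.notMem_support_iff.2 hi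
  have hli : l.realRow i = 0 := by rw [realRow, hi, Nat.cast_zero]
  have hvi : v.realRow i = 1 := by
    rw [h.realRow_eq, Function.update_self, hli, zero_add]
  have h1 : shiftCoeff (-1) v.row.support v.realRow i *
      ∏ k ∈ l.row.support, (l.realRow k - 1) / (l.realRow k + 1) = 1 := by
    rw [shiftCoeff, h.support_eq, Finset.erase_insert hmem, ← Finset.prod_mul_distrib]
    refine Finset.prod_eq_one fun k hk => ?_
    have hki : k ≠ i := fun hc => hmem (hc ▸ hk)
    have hvk : v.realRow k = l.realRow k := by
      rw [h.realRow_eq, Function.update_of_ne hki]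
    have e2 := v.sub_ne_zero_realRow (h.support_eq ▸ Finset.mem_insert_of_mem hk)
      (h.support_eq ▸ Finset.mem_insert_self _ _) hki
    rw [hvk, hvi] at e2
    rw [hvk, hvi]
    have h2 := l.one_le_realRow k hk
    have e3 : l.realRow k + 1 ≠ 0 := by linarith
    have e4 : l.realRow k ≠ 0 := by linarith
    have e5 : 1 - l.realRow k ≠ 0 := fun hc => e2 (by linarith)
    have e6 : 1 + l.realRow k ≠ 0 := by linarith
    rw [show (1 : ℝ) + -1 = 0 by ring, zero_sub, zero_add]
    field_simp
    ring
  have h2 : shiftCoeff (-1) v.row.support v.realRow i ≠ 0 := left_ne_zero_of_mul_eq_one h1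
  have hw2 : α + 2 * (l.weight : ℝ) ≠ 0 := by positivity
  rw [h.pUp_eq hα, h.kappa_eq, if_pos hi, downCoeff, hvi, hli,
    eq_div_of_mul_eq h2 ((mul_comm _ _).trans h1)]
  push_cast
  field_simp
  ring

/-- The adjoined variable is the first empty row. A row that cannot be extended contributes zero: if
the previous row is one box longer, then $l_i+1-l_j=0$, or $l_j-1=0$ when the row is new. -/
theorem sum_pUp_mul_evalAt (hα : 0 < α) {n : ℕ} {l : StrictPartition} (hl : l.weight = n)
    (g : Gam) : ∑ v : Level (n + 1), pUp α l v.1 * evalAt v.1 g =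
      raiseSum α l.length l.row.support l.realRow g / (α + 2 * n) := by
  have hw2 : α + 2 * (n : ℝ) ≠ 0 := by positivity
  have hnot : l.length ∉ l.row.support := by rw [support_row]; simp
  have hlen : l.row l.length = 0 := (l.row_eq_zero_iff _).2 le_rfl
  have hS : insert l.length l.row.support = Finset.range (l.length + 1) := by
    rw [support_row, Finset.range_add_one]
  set c : ℕ → ℝ := fun i => if l.row i = 0 then
      α * ∏ k ∈ l.row.support, (l.realRow k - 1) / (l.realRow k + 1) else
      2 * (l.realRow i * (l.realRow i + 1) + α) / (l.realRow i + 1) *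
        shiftCoeff 1 l.row.support l.realRow i with hc
  have hraise : raiseSum α l.length l.row.support l.realRow g =
      ∑ i ∈ insert l.length l.row.support, c i *
        evalOn (insert l.length l.row.support)
          (Function.update l.realRow i (l.realRow i + 1)) g := by
    have hl0 : l.realRow l.length = 0 := by rw [realRow, hlen, Nat.cast_zero]
    rw [raiseSum, Finset.sum_insert hnot, add_comm, hl0, zero_add, hc]
    simp only [if_pos hlen]
    congr 1
    refine Finset.sum_congr rfl fun i hi => ?_
    rw [if_neg (Finsupp.mem_support_iff.1 hi),
      evalOn_eq_of_subset (Finset.subset_insert l.length l.row.support)]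
    intro j hj hj'
    have hji : j ≠ i := fun e => hj' (e ▸ hi)
    rw [Function.update_of_ne hji, realRow, Finsupp.notMem_support_iff.1 hj', Nat.cast_zero]
  rw [hraise, Finset.sum_div]
  refine Finset.sum_eq_sum_of_rel _ _ (fun v i => StepAt i l v.1) _ _ ?_ ?_ ?_ ?_ ?_
  · intro v _ h
    have hk : kappa l v.1 ≠ 0 := fun hk => h (by
      rw [pUp, pDown, hk, Nat.cast_zero, mul_zero, mul_zero, zero_mul])
    obtain ⟨i, hi⟩ := exists_stepAt_of_kappa_ne_zero hk
    refine ⟨i, ?_, hi⟩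
    by_cases h0 : l.row i = 0
    · have h1 := hi.length_eq_of_eq_zero h0
      have h2 := (v.1.row_ne_zero_iff i).1 (by rw [hi.row_self]; omega)
      rw [hS, Finset.mem_range]
      omega
    · exact Finset.mem_insert_of_mem (Finsupp.mem_support_iff.2 h0)
  · intro i hi h
    have h := left_ne_zero_of_mul (left_ne_zero_of_mul (by rwa [div_eq_mul_inv] at h))
    rw [hS, Finset.mem_range] at hi
    obtain ⟨v, hv⟩ := exists_stepAt_right l i (by omega) fun j hj hj' => h (by
      have hjS : j ∈ l.row.support := Finsupp.mem_support_iff.2 (by omega)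
      rw [hc]
      simp only
      split_ifs with h0
      · rw [Finset.prod_eq_zero hjS, mul_zero]
        rw [realRow, hj', h0]
        simp
      · rw [shiftCoeff, Finset.prod_eq_zero (i := j) (Finset.mem_erase.2 ⟨by omega, hjS⟩), mul_zero]
        have : l.realRow i + 1 - l.realRow j = 0 := by
          rw [realRow, realRow, hj']
          push_cast
          ring
        rw [this, zero_mul, zero_div])
    exact ⟨⟨v, by rw [hv.weight_eq, hl]⟩, Finset.mem_univ _, hv⟩
  · exact fun v _ i _ j _ hi hj => hi.eq_index hj
  · exact fun v _ v' _ i _ h h' => Subtype.ext (h.eq_right h')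
  · intro v _ i hi h
    have he : evalAt v.1 = evalOn (insert l.length l.row.support)
        (Function.update l.realRow i (l.realRow i + 1)) := by
      rw [← h.realRow_eq]
      refine v.1.evalAt_eq_of_subset ?_
      rw [h.support_eq]
      exact Finset.insert_subset hi (Finset.subset_insert _ _)
    have hp : pUp α l v.1 * (α + 2 * n) = c i := by
      have hn : (n : ℝ) = l.weight := by rw [hl]
      rw [hn, hc]
      simp only
      split_ifs with h0
      · exact h.pUp_eq_of_eq_zero hα h0
      · exact h.pUp_eq_of_ne_zero hα h0
    rw [he, ← hp]
    field_simp

/-- The transition operators preserve the filtration by the factorial `Q`-functions. -/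
theorem transOp_evalAt_factQ (hα : 0 < α) (n : ℕ) (l : Level n) {L : List ℕ}
    (hL : ∀ r ∈ L, r ≠ 0) (hs : L.Pairwise (· > ·)) :
    (transOp α n - 1) (fun l => evalAt l.1 (factQ L)) l =
      (-(2 * ((L.sum : ℝ) * (L.sum + α / 2 - 1))) * evalAt l.1 (factQ L) +
        2 * ((n : ℝ) + 1 - L.sum) *
          evalAt l.1 (lowerQ α (fun r => descPochhammer ℝ r) L)) / ((n + 1) * (2 * n + α)) := by
  have h1 : transOp α n (fun l => evalAt l.1 (factQ L)) l =
      ∑ v : Level (n + 1), pUp α l.1 v.1 *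
        ∑ m : Level n, pDown v.1 m.1 * evalAt m.1 (factQ L) := by
    rw [transOp, Matrix.mulVecLin_apply, Matrix.mulVec, dotProduct]
    simp only [transMatrix, Finset.sum_mul, Finset.mul_sum, mul_assoc]
    exact Finset.sum_comm
  have h2 : ∀ v : Level (n + 1), pUp α l.1 v.1 *
      ∑ m : Level n, pDown v.1 m.1 * evalAt m.1 (factQ L) =
      ((n : ℝ) + 1 - L.sum) / (n + 1) * (pUp α l.1 v.1 * evalAt v.1 (factQ L)) := fun v => by
    rw [sum_pDown_mul_factQ v.2 hL]
    ring
  have hnot : l.1.length ∉ l.1.row.support := by rw [support_row]; simp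
  rw [LinearMap.sub_apply, Pi.sub_apply, h1, Finset.sum_congr rfl fun v _ => h2 v,
    ← Finset.mul_sum, sum_pUp_mul_evalAt hα l.2,
    raiseSum_factQ_of_one_le α hL hs hnot l.1.injOn_realRow l.1.one_le_realRow, sum_realRow, l.2,
    Module.End.one_apply]
  change _ / _ * (((_ * evalAt l.1 (factQ L)) + 2 * evalAt l.1 _) / _) - _ = _
  have hw1 : (n : ℝ) + 1 ≠ 0 := by positivity
  have hw2 : 2 * (n : ℝ) + α ≠ 0 := by positivity
  rw [add_comm α]
  field_simp
  ring

end Transitions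

end StrictPartition

/-! ### Lowered $Q$-functions, homogeneity, and comparison of $Q^*_\mu$ with $Q_\mu$. -/

namespace DoublySymmetric

open MvPolynomial StrictPartition

section Lowering

theorem lowerQ_eq_sum (α : ℝ) (φ : ℕ → Polynomial ℝ) (L : List ℕ) :
    lowerQ α φ L = ∑ i ∈ Finset.range L.length,
      boxWeight α (L.getD i 0) • vertexQ φ (L.set i (L.getD i 0 - 1)) := by
  induction L with
  | nil => simp [lowerQ]
  | cons r L ih =>
    rw [lowerQ, ih, List.length_cons, Finset.sum_range_succ', map_sum, add_comm]
    congr 1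
    refine Finset.sum_congr rfl fun i _ => ?_
    rw [map_smul]
    rfl

/-- Zeros may be dropped only at the end of a list, where $B_0$ acts on $1$ and $B_01=q_0=1$. Such a
zero appears when a row of one box is removed. -/
theorem listQ_append_replicate_zero (L : List ℕ) (k : ℕ) :
    listQ (L ++ List.replicate k 0) = listQ L := by
  induction L with
  | nil =>
    rw [List.nil_append]
    induction k with
    | zero => rfl
    | succ k ih =>
      rw [List.replicate_succ, listQ_cons, ih]
      have := vertexOp_X_pow_one 0
      rwa [rowQ_zero] at this
  | cons r L ih => rw [List.cons_append, listQ_cons, listQ_cons, ih]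

theorem listQ_set_of_stepAt {i : ℕ} {m l : StrictPartition} (h : StepAt i m l) :
    listQ (l.toList.set i (l.row i - 1)) = schurQ m := by
  have hle : m.length ≤ l.length := by
    by_cases hi : m.row i = 0
    · rw [h.length_eq_of_eq_zero hi]
      omega
    · rw [h.length_eq_of_ne_zero hi]
  have h1 : l.toList.set i (l.row i - 1) = (List.range l.length).map m.row := by
    refine List.ext_getElem (by simp) fun j h₁ h₂ => ?_
    rw [List.getElem_set]
    simp only [List.getElem_map, List.getElem_range, toList]
    split_ifs with hij
    · subst hij
      rw [h.row_self]
      rfl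
    · rw [h.row_of_ne (Ne.symm hij)]
  have h2 : (List.range l.length).map m.row =
      m.toList ++ List.replicate (l.length - m.length) 0 := by
    obtain ⟨k, hk⟩ := Nat.exists_eq_add_of_le hle
    rw [hk, List.range_add, List.map_append, toList, Nat.add_sub_cancel_left]
    congr 1
    rw [List.eq_replicate_iff]
    refine ⟨by simp, fun b hb => ?_⟩
    simp only [List.map_map, List.mem_map, Function.comp_apply] at hb
    obtain ⟨a, -, rfl⟩ := hb
    rw [row_eq_zero_iff]
    omega
  rw [h1, h2, listQ_append_replicate_zero, schurQ_eq_listQ]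

/-- If no box can be removed from the row, the lowered entry equals the next one, and a repeated
entry gives zero. -/
theorem listQ_set_eq_zero {i : ℕ} {l : StrictPartition} (hi : i < l.length)
    (h : ¬ ∃ m, StepAt i m l) : listQ (l.toList.set i (l.row i - 1)) = 0 := by
  have h1 : ¬ (l.row i = l.row (i + 1) + 1 → l.row (i + 1) = 0) := fun h1 =>
    h (exists_stepAt_left l i ((l.row_ne_zero_iff i).2 hi) h1)
  push Not at h1
  obtain ⟨h1, h2⟩ := h1
  have h3 := (l.row_ne_zero_iff _).1 h2
  refine vertexQ_eq_zero_of_not_nodup _ (fun r hr => ?_) (fun r hr => ?_) fun hd => ?_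
  · rw [Polynomial.coeff_X_pow, if_neg hr.symm]
  · rcases List.mem_or_eq_of_mem_set hr with hr | rfl
    · exact l.ne_zero_of_mem_toList hr
    · omega
  · have hlen : (l.toList.set i (l.row i - 1)).length = l.length := by simp
    have e := (hd.getElem_inj_iff (i := i) (j := i + 1) (hi := by omega) (hj := by omega)).1 (by
      rw [List.getElem_set_self, List.getElem_set_ne (by omega)]
      simp only [toList, List.getElem_map, List.getElem_range]
      omega)
    omega

/-- The boxes removable from a diagram, in terms of its rows. -/
theorem lowerQ_toList (α : ℝ) (l : StrictPartition) :
    lowerQ α (fun r => Polynomial.X ^ r) l.toList = ∑ y ∈ l.removable,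
      ((y : ℝ) * ((y : ℝ) + 1) + α) • schurQ (l.removeBox y) := by
  rw [lowerQ_eq_sum, length_toList]
  simp only [getD_toList]
  symm
  have hrem : ∀ y : ℤ, y ∈ l.removable ↔ ∃ i m, StepAt i m l ∧ y = m.row i := fun y => by
    simp only [removable, Finset.mem_image, Finset.mem_filter]
    constructor
    · rintro ⟨b, ⟨-, m, hm⟩, rfl⟩
      obtain ⟨h1, h2⟩ := addsBox_iff.1 hm
      refine ⟨b.1, m, h1, ?_⟩
      rw [content, h2]
      push_cast
      ring
    · rintro ⟨i, m, hm, rfl⟩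
      have hb : AddsBox m (i, i + m.row i) l := addsBox_iff.2 ⟨hm, rfl⟩
      refine ⟨_, ⟨?_, m, hb⟩, ?_⟩
      · rw [hb.2]
        exact Finset.mem_insert_self _ _
      · rw [content]
        push_cast
        ring
  have hlt : ∀ {i m}, StepAt i m l → i < l.length := fun {i m} h =>
    (l.row_ne_zero_iff i).1 (by rw [h.row_self]; omega)
  refine Finset.sum_eq_sum_of_rel _ _
    (fun (y : ℤ) (i : ℕ) => ∃ m, StepAt i m l ∧ y = (m.row i : ℤ)) _ _ ?_ ?_ ?_ ?_ ?_
  · intro y hy _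
    obtain ⟨i, m, h, rfl⟩ := (hrem y).1 hy
    exact ⟨i, Finset.mem_range.2 (hlt h), m, h, rfl⟩
  · intro i hi h
    by_contra hc
    refine h ?_
    change _ • listQ _ = 0
    rw [listQ_set_eq_zero (Finset.mem_range.1 hi), smul_zero]
    rintro ⟨m, hm⟩
    exact hc ⟨m.row i, (hrem _).2 ⟨i, m, hm, rfl⟩, m, hm, rfl⟩
  · rintro y _ i hi j hj ⟨m, hm, rfl⟩ ⟨m', hm', e⟩
    have h1 := hm.row_self
    have h2 := hm'.row_self
    have e : m.row i = m'.row j := by exact_mod_cast e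
    exact l.injOn_realRow (Finsupp.mem_support_iff.2 (by omega))
      (Finsupp.mem_support_iff.2 (by omega)) (by rw [realRow, realRow, h1, h2, e])
  · rintro y _ y' _ i _ ⟨m, hm, rfl⟩ ⟨m', hm', rfl⟩
    rw [hm.eq_left hm']
  · rintro y _ i hi ⟨m, hm, rfl⟩
    have hb : AddsBox m (i, i + m.row i) l := addsBox_iff.2 ⟨hm, rfl⟩
    have hcont : content (i, i + m.row i) = m.row i := by
      rw [content]
      push_cast
      ring
    have h1 := hb.removeBox_eq
    rw [hcont] at h1
    rw [h1]
    change _ = _ • listQ _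
    rw [listQ_set_of_stepAt hm, boxWeight, hm.row_self]
    congr 1
    push_cast
    ring

end Lowering

section Homogeneity

/-- The dilation `p_k ↦ t ^ k p_k`. -/
noncomputable def dilation (t : ℝ) : Gam →ₐ[ℝ] Gam :=
  aeval fun k : ℕ => C (t ^ (2 * k + 1)) * X k

theorem dilation_X (t : ℝ) (k : ℕ) : dilation t (X k) = C (t ^ (2 * k + 1)) * X k := aeval_X _ _

theorem dilation_C (t a : ℝ) : dilation t (C a) = C a := by
  rw [dilation, aeval_C]
  rfl

theorem evalOn_dilation {ι : Type*} [DecidableEq ι] (I : Finset ι) (y : ι → ℝ) (t : ℝ) (g : Gam) :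
    evalOn I y (dilation t g) = evalOn I (fun i => t * y i) g := by
  have : (evalOn I y).comp (dilation t) = evalOn I (fun i => t * y i) := by
    refine MvPolynomial.algHom_ext fun k => ?_
    rw [AlgHom.comp_apply, dilation_X, map_mul]
    simp only [evalOn, aeval_C, aeval_X, mul_pow, Finset.mul_sum]
    rfl
  rw [← this]
  rfl

theorem dilation_rowQ (t : ℝ) (m : ℕ) : dilation t (rowQ m) = C (t ^ m) * rowQ m := by
  induction m using Nat.strong_induction_on with
  | _ m ih =>
    cases m with
    | zero => simp
    | succ n =>
      rw [rowQ, map_mul, dilation_C, map_sum, Finset.mul_sum, Finset.mul_sum, Finset.mul_sum]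
      refine Finset.sum_congr rfl fun k _ => ?_
      split_ifs with hk
      · have e : t ^ (n + 1) = t ^ (2 * (k : ℕ) + 1) * t ^ (n - 2 * (k : ℕ)) := by
          rw [← pow_add]
          congr 1
          omega
        rw [map_mul, dilation_X, ih _ (by omega), e, C_mul]
        ring
      · rw [map_zero, mul_zero, mul_zero]

theorem dilation_vertexOp (t : ℝ) (r : ℕ) (g : Gam) :
    dilation t (vertexOp (Polynomial.X ^ r) g) =
      C (t ^ r) * vertexOp (Polynomial.X ^ r) (dilation t g) := by
  induction g using MvPolynomial.induction_on generalizing r with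
  | C a =>
    rw [dilation_C, vertexOp_X_pow_C, map_mul, dilation_C, dilation_rowQ]
    ring
  | add p q hp hq => rw [map_add, map_add, map_add, map_add, hp, hq, mul_add]
  | mul_X p k hp =>
    have e : dilation t (X k * p) = (t ^ (2 * k + 1)) • (X k * dilation t p) := by
      rw [map_mul, dilation_X, smul_eq_C_mul, mul_assoc]
    rw [mul_comm p, e, map_smul, vertexOp_X_pow_X_mul, vertexOp_X_pow_X_mul, map_sub, map_mul,
      dilation_X, hp, hp, smul_eq_C_mul, pow_add t r, C_mul]
    ring

theorem dilation_listQ (t : ℝ) (L : List ℕ) :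
    dilation t (listQ L) = C (t ^ L.sum) * listQ L := by
  induction L with
  | nil => simp [vertexQ]
  | cons r L ih =>
    rw [listQ_cons, dilation_vertexOp, ih, ← smul_eq_C_mul (listQ L), map_smul, smul_eq_C_mul,
      List.sum_cons, pow_add, C_mul, mul_assoc]

/-- Homogeneity of degree one less than the sum of the list. The factor $t$ on the left avoids a
truncated subtraction in the exponent. -/
theorem dilation_lowerQ (α t : ℝ) (L : List ℕ) (hL : ∀ r ∈ L, r ≠ 0) :
    C t * dilation t (lowerQ α (fun r => Polynomial.X ^ r) L) =
      C (t ^ L.sum) * lowerQ α (fun r => Polynomial.X ^ r) L := by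
  induction L with
  | nil => simp [lowerQ]
  | cons r L ih =>
    have ih := ih fun s hs => hL s (by simp [hs])
    obtain ⟨r, rfl⟩ := Nat.exists_eq_succ_of_ne_zero (hL r (by simp))
    have h1 : C t * vertexOp (Polynomial.X ^ (r + 1))
        (dilation t (lowerQ α (fun r => Polynomial.X ^ r) L)) = C (t ^ L.sum) *
          vertexOp (Polynomial.X ^ (r + 1)) (lowerQ α (fun r => Polynomial.X ^ r) L) := by
      rw [← smul_eq_C_mul, ← map_smul, smul_eq_C_mul, ih, ← smul_eq_C_mul, map_smul,
        smul_eq_C_mul]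
    have h2 := dilation_listQ t L
    rw [lowerQ, Nat.succ_eq_add_one, Nat.add_sub_cancel, map_add, map_smul, dilation_vertexOp,
      dilation_vertexOp, h2, ← smul_eq_C_mul (listQ L), map_smul, smul_eq_C_mul, smul_eq_C_mul,
      smul_eq_C_mul, List.sum_cons, show t ^ (r + 1 + L.sum) = t * t ^ r * t ^ L.sum by ring,
      show t ^ (r + 1) = t * t ^ r by ring, C_mul, C_mul, C_mul]
    linear_combination C (t ^ r) * C t * h1

end Homogeneity

section Filtration

/-- The span of the `Q`-functions of lists with entries in `p` and sum less than `k`. -/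
noncomputable def lowSpan (p : ℕ → Prop) (k : ℕ) : Submodule ℝ Gam :=
  Submodule.span ℝ {g | ∃ L : List ℕ, (∀ r ∈ L, p r) ∧ L.sum < k ∧ g = listQ L}

theorem listQ_mem_lowSpan {p : ℕ → Prop} {k : ℕ} {L : List ℕ} (hp : ∀ r ∈ L, p r)
    (hk : L.sum < k) : listQ L ∈ lowSpan p k :=
  Submodule.subset_span ⟨L, hp, hk, rfl⟩

theorem vertexOp_mem_lowSpan {p : ℕ → Prop} {k d : ℕ} {φ : Polynomial ℝ}
    (hφ : ∀ j, φ.coeff j ≠ 0 → p j ∧ j ≤ d) {w : Gam} (hw : w ∈ lowSpan p k) :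
    vertexOp φ w ∈ lowSpan p (k + d) := by
  have hsum : φ = ∑ j ∈ φ.support, φ.coeff j • Polynomial.X ^ j := by
    conv_lhs => rw [φ.as_sum_support_C_mul_X_pow]
    simp only [Polynomial.smul_eq_C_mul]
  rw [hsum, map_sum, LinearMap.sum_apply]
  refine Submodule.sum_mem _ fun j hj => ?_
  rw [map_smul, LinearMap.smul_apply]
  refine Submodule.smul_mem _ _ ?_
  obtain ⟨hpj, hjd⟩ := hφ j (Polynomial.mem_support_iff.1 hj)
  refine Submodule.span_induction ?_ ?_ ?_ ?_ hw
  · rintro _ ⟨L, hL, hk, rfl⟩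
    rw [← listQ_cons]
    refine listQ_mem_lowSpan (fun r hr => ?_) ?_
    · rcases List.mem_cons.1 hr with rfl | hr
      · exact hpj
      · exact hL r hr
    · rw [List.sum_cons]
      omega
  · rw [map_zero]
    exact Submodule.zero_mem _
  · intro x y _ _ hx hy
    rw [map_add]
    exact Submodule.add_mem _ hx hy
  · intro c x _ hx
    rw [map_smul]
    exact Submodule.smul_mem _ _ hx

theorem coeff_descPochhammer_ne_zero {r j : ℕ} (h : (descPochhammer ℝ r).coeff j ≠ 0) :
    j ≤ r ∧ (r ≠ 0 → j ≠ 0) := by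
  refine ⟨?_, fun hr hj => h ?_⟩
  · by_contra hc
    exact h (Polynomial.coeff_eq_zero_of_natDegree_lt (by
      rw [descPochhammer_natDegree]
      omega))
  · rw [hj, coeff_zero_descPochhammer hr]

theorem coeff_descPochhammer_sub_ne_zero {r j : ℕ}
    (h : (descPochhammer ℝ r - Polynomial.X ^ r).coeff j ≠ 0) : j ≠ 0 ∧ j < r := by
  rw [Polynomial.coeff_sub, Polynomial.coeff_X_pow] at h
  have hmonic : (descPochhammer ℝ r).coeff r = 1 := by
    have := (monic_descPochhammer ℝ r).coeff_natDegree
    rwa [descPochhammer_natDegree] at this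
  have hj : j ≠ r := by
    rintro rfl
    rw [if_pos rfl, hmonic, sub_self] at h
    exact h rfl
  rw [if_neg hj, sub_zero] at h
  obtain ⟨h1, h2⟩ := coeff_descPochhammer_ne_zero h
  exact ⟨h2 (by omega), by omega⟩

/-- The difference telescopes into a falling factorial acting on $u-v$ and the lower-order part of
the falling factorial acting on $v$. The predicate `p` covers two uses: lists without zeros, which
can be straightened into $Q$-functions, and arbitrary lists, which occur after an entry has been
lowered. -/
theorem vertexOp_descPochhammer_sub_mem {p : ℕ → Prop} (hp : ∀ j, j ≠ 0 → p j) {r k : ℕ}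
    (hr : r = 0 → p 0) {u v : Gam} (huv : u - v ∈ lowSpan p k) (hv : v ∈ lowSpan p (k + 1)) :
    vertexOp (descPochhammer ℝ r) u - vertexOp (Polynomial.X ^ r) v ∈ lowSpan p (k + r) := by
  have e : vertexOp (descPochhammer ℝ r) u - vertexOp (Polynomial.X ^ r) v =
      vertexOp (descPochhammer ℝ r) (u - v) +
        vertexOp (descPochhammer ℝ r - Polynomial.X ^ r) v := by
    rw [map_sub (vertexOp (descPochhammer ℝ r)), map_sub vertexOp, LinearMap.sub_apply]
    abel
  rw [e]
  refine Submodule.add_mem _ (vertexOp_mem_lowSpan (fun j hj => ?_) huv) ?_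
  · obtain ⟨h1, h2⟩ := coeff_descPochhammer_ne_zero hj
    refine ⟨?_, h1⟩
    rcases eq_or_ne j 0 with rfl | h0
    · exact hr (by
        by_contra hc
        exact h2 hc rfl)
    · exact hp j h0
  · rcases Nat.eq_zero_or_pos r with rfl | hr0
    · rw [descPochhammer_zero, pow_zero, sub_self, map_zero]
      exact Submodule.zero_mem _
    · have := vertexOp_mem_lowSpan (p := p) (d := r - 1) (φ := descPochhammer ℝ r - Polynomial.X ^ r)
        (fun j hj => by
          obtain ⟨h1, h2⟩ := coeff_descPochhammer_sub_ne_zero hj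
          exact ⟨hp j h1, by omega⟩) hv
      rwa [show k + 1 + (r - 1) = k + r by omega] at this

theorem factQ_sub_listQ_mem {p : ℕ → Prop} (hp : ∀ j, j ≠ 0 → p j) {L : List ℕ}
    (hL : ∀ r ∈ L, r ≠ 0) : factQ L - listQ L ∈ lowSpan p L.sum := by
  induction L with
  | nil =>
    have : factQ [] - listQ [] = 0 := sub_self _
    rw [this]
    exact Submodule.zero_mem _
  | cons r L ih =>
    have hr := hL r (by simp)
    have hL' : ∀ s ∈ L, s ≠ 0 := fun s hs => hL s (by simp [hs])
    rw [List.sum_cons, add_comm]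
    exact vertexOp_descPochhammer_sub_mem hp (fun h => absurd h hr) (ih hL')
      (listQ_mem_lowSpan (fun s hs => hp s (hL' s hs)) (Nat.lt_succ_self _))

theorem lowerQ_mem_lowSpan (α : ℝ) {L : List ℕ} (hL : ∀ r ∈ L, r ≠ 0) :
    lowerQ α (fun r => Polynomial.X ^ r) L ∈ lowSpan (fun _ => True) L.sum := by
  induction L with
  | nil => exact Submodule.zero_mem _
  | cons r L ih =>
    have hr := hL r (by simp)
    rw [lowerQ, List.sum_cons]
    refine Submodule.add_mem _ (Submodule.smul_mem _ _ ?_) ?_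
    · change listQ ((r - 1) :: L) ∈ _
      refine listQ_mem_lowSpan (fun _ _ => trivial) ?_
      rw [List.sum_cons]
      omega
    · rw [add_comm]
      refine vertexOp_mem_lowSpan (fun j hj => ⟨trivial, ?_⟩)
        (ih fun s hs => hL s (by simp [hs]))
      rw [Polynomial.coeff_X_pow] at hj
      by_contra hc
      exact hj (if_neg (by omega))

theorem lowerQ_sub_mem (α : ℝ) {L : List ℕ} (hL : ∀ r ∈ L, r ≠ 0) :
    lowerQ α (fun r => descPochhammer ℝ r) L - lowerQ α (fun r => Polynomial.X ^ r) L ∈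
      lowSpan (fun _ => True) (L.sum - 1) := by
  induction L with
  | nil =>
    rw [lowerQ, lowerQ, sub_self]
    exact Submodule.zero_mem _
  | cons r L ih =>
    have hr := hL r (by simp)
    have hL' : ∀ s ∈ L, s ≠ 0 := fun s hs => hL s (by simp [hs])
    have ih := ih hL'
    rw [lowerQ, lowerQ, List.sum_cons, add_sub_add_comm, ← smul_sub]
    refine Submodule.add_mem _ (Submodule.smul_mem _ _ ?_) ?_
    · have := vertexOp_descPochhammer_sub_mem (p := fun _ => True) (r := r - 1) (k := L.sum)
        (fun _ _ => trivial) (fun _ => trivial) (factQ_sub_listQ_mem (fun _ _ => trivial) hL')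
        (listQ_mem_lowSpan (fun _ _ => trivial) (Nat.lt_succ_self _))
      rwa [show L.sum + (r - 1) = r + L.sum - 1 by omega] at this
    · rcases L with _ | ⟨s, L⟩
      · rw [lowerQ, lowerQ, map_zero, map_zero, sub_zero]
        exact Submodule.zero_mem _
      · have hs := hL' s (by simp)
        have hpos : (s :: L).sum ≠ 0 := by
          rw [List.sum_cons]
          omega
        have := vertexOp_descPochhammer_sub_mem (p := fun _ => True) (r := r)
          (k := (s :: L).sum - 1) (fun _ _ => trivial) (fun _ => trivial) ih (by
            rw [show (s :: L).sum - 1 + 1 = (s :: L).sum by omega]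
            exact lowerQ_mem_lowSpan α hL')
        rwa [show (s :: L).sum - 1 + r = r + (s :: L).sum - 1 by omega] at this

end Filtration

end DoublySymmetric

/-! ### Rescaling, and convergence of the generators. -/

namespace StrictPartition

open DoublySymmetric MvPolynomial

section Scaling

/-- The value of a doubly symmetric function at `(l₁ / n, l₂ / n, …)`. -/
noncomputable def scaledEval (n : ℕ) (l : StrictPartition) : Gam →ₐ[ℝ] ℝ :=
  evalOn l.row.support fun i => (n : ℝ)⁻¹ * l.realRow i

theorem scaledEval_eq (n : ℕ) (l : StrictPartition) (g : Gam) :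
    scaledEval n l g = evalAt l (dilation (n : ℝ)⁻¹ g) := (evalOn_dilation _ _ _ _).symm

theorem scaledEval_listQ (n : ℕ) (l : StrictPartition) (L : List ℕ) :
    scaledEval n l (listQ L) = ((n : ℝ) ^ L.sum)⁻¹ * evalAt l (listQ L) := by
  rw [scaledEval_eq, dilation_listQ, ← smul_eq_C_mul, map_smul, smul_eq_mul, inv_pow]

theorem scaledEval_lowerQ (α : ℝ) {n : ℕ} (hn : n ≠ 0) (l : StrictPartition) {L : List ℕ}
    (hL : ∀ r ∈ L, r ≠ 0) :
    scaledEval n l (lowerQ α (fun r => Polynomial.X ^ r) L) =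
      (n : ℝ) * ((n : ℝ) ^ L.sum)⁻¹ * evalAt l (lowerQ α (fun r => Polynomial.X ^ r) L) := by
  have h := congrArg (evalAt l) (dilation_lowerQ α (n : ℝ)⁻¹ L hL)
  rw [← smul_eq_C_mul, ← smul_eq_C_mul, map_smul, map_smul, ← scaledEval_eq, smul_eq_mul,
    smul_eq_mul, inv_pow] at h
  have hn' : (n : ℝ) ≠ 0 := Nat.cast_ne_zero.2 hn
  rw [mul_assoc, ← h]
  field_simp

theorem scaledEval_X_zero {n : ℕ} (hn : n ≠ 0) (l : Level n) : scaledEval n l.1 (X 0) = 1 := by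
  have hn' : (n : ℝ) ≠ 0 := Nat.cast_ne_zero.2 hn
  simp only [scaledEval, evalOn, aeval_X, mul_zero, zero_add, pow_one]
  rw [← Finset.mul_sum, sum_realRow, l.2, inv_mul_cancel₀ hn']

/-- The rescaled parts lie in $[0,1]$ and sum to at most $1$, so every power sum is at most $1$ in
absolute value, uniformly in $n$. The level $n=0$ is included, as its sums are empty. -/
theorem exists_abs_scaledEval_le (g : Gam) :
    ∃ c, ∀ (n : ℕ) (l : Level n), |scaledEval n l.1 g| ≤ c := by
  induction g using MvPolynomial.induction_on with
  | C a => exact ⟨|a|, fun n l => by simp [scaledEval, evalOn]⟩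
  | add p q hp hq =>
    obtain ⟨c, hc⟩ := hp
    obtain ⟨d, hd⟩ := hq
    exact ⟨c + d, fun n l => by
      rw [map_add]
      exact (abs_add_le _ _).trans (add_le_add (hc n l) (hd n l))⟩
  | mul_X p k hp =>
    obtain ⟨c, hc⟩ := hp
    refine ⟨c, fun n l => ?_⟩
    have h1 : ∀ i, 0 ≤ (n : ℝ)⁻¹ * l.1.realRow i ∧ (n : ℝ)⁻¹ * l.1.realRow i ≤ 1 := fun i => by
      have hr : (0 : ℝ) ≤ l.1.realRow i := Nat.cast_nonneg _
      refine ⟨by positivity, ?_⟩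
      have : l.1.realRow i ≤ n := Nat.cast_le.2 ((l.1.row_le_weight i).trans_eq l.2)
      rw [inv_mul_eq_div]
      exact div_le_one_of_le₀ this (Nat.cast_nonneg _)
    have h2 : |scaledEval n l.1 (X k)| ≤ 1 := by
      simp only [scaledEval, evalOn, aeval_X]
      rw [abs_of_nonneg (Finset.sum_nonneg fun i _ => pow_nonneg (h1 i).1 _)]
      calc _ ≤ ∑ i ∈ l.1.row.support, (n : ℝ)⁻¹ * l.1.realRow i :=
            Finset.sum_le_sum fun i _ =>
              pow_le_of_le_one (h1 i).1 (h1 i).2 (Nat.succ_ne_zero _)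
        _ = (n : ℝ)⁻¹ * n := by rw [← Finset.mul_sum, sum_realRow, l.2]
        _ ≤ 1 := inv_mul_le_one
    rw [map_mul, abs_mul]
    calc _ ≤ |scaledEval n l.1 p| * 1 := mul_le_mul_of_nonneg_left h2 (abs_nonneg _)
      _ ≤ c := by
        rw [mul_one]
        exact hc n l

end Scaling

section Negligible

/-- Sequences of functions on the levels that tend to zero uniformly. -/
def Negligible (u : ∀ n, Level n → ℝ) : Prop := Tendsto (fun n => ‖u n‖) atTop (𝓝 0)

/-- Sequences of functions on the levels that are eventually uniformly bounded. -/
def EventuallyBounded (u : ∀ n, Level n → ℝ) : Prop := ∃ c, ∀ᶠ n in atTop, ‖u n‖ ≤ c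

variable {u v : ∀ n, Level n → ℝ}

theorem Negligible.add (hu : Negligible u) (hv : Negligible v) :
    Negligible fun n => u n + v n := by
  have := Tendsto.add hu hv
  rw [add_zero] at this
  exact squeeze_zero (fun n => norm_nonneg _) (fun n => norm_add_le _ _) this

theorem Negligible.congr (hu : Negligible u) (h : ∀ᶠ n in atTop, u n = v n) : Negligible v :=
  Tendsto.congr' (h.mono fun n hn => by rw [hn]) hu

theorem EventuallyBounded.smul_negligible {c : ℕ → ℝ} (hc : Tendsto c atTop (𝓝 0))
    (hu : EventuallyBounded u) : Negligible fun n => c n • u n := by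
  obtain ⟨b, hb⟩ := hu
  have h : Tendsto (fun n => ‖c n‖ * b) atTop (𝓝 0) := by
    have := hc.norm.mul_const b
    rwa [norm_zero, zero_mul] at this
  refine squeeze_zero' (Eventually.of_forall fun n => norm_nonneg _) (hb.mono fun n hn => ?_) h
  rw [norm_smul]
  exact mul_le_mul_of_nonneg_left hn (norm_nonneg _)

theorem Negligible.smul {c : ℕ → ℝ} {c₀ : ℝ} (hc : Tendsto c atTop (𝓝 c₀))
    (hu : Negligible u) : Negligible fun n => c n • u n := by
  have h := hc.norm.mul hu
  rw [mul_zero] at h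
  exact h.congr fun n => (norm_smul _ _).symm

theorem Negligible.const_smul (c : ℝ) (hu : Negligible u) : Negligible fun n => c • u n :=
  Negligible.smul tendsto_const_nhds hu

theorem negligible_zero : Negligible fun _ => 0 := by
  unfold Negligible
  simp only [norm_zero]
  exact tendsto_const_nhds

theorem Negligible.eventuallyBounded (hu : Negligible u) : EventuallyBounded u :=
  ⟨1, (hu.eventually_lt_const zero_lt_one).mono fun _ h => h.le⟩

theorem EventuallyBounded.sub (hu : EventuallyBounded u) (hv : EventuallyBounded v) :
    EventuallyBounded fun n => u n - v n := by
  obtain ⟨c, hc⟩ := hu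
  obtain ⟨d, hd⟩ := hv
  refine ⟨c + d, ?_⟩
  filter_upwards [hc, hd] with n h1 h2
  exact (norm_sub_le _ _).trans (add_le_add h1 h2)

/-- The function `g(l₁ / n, l₂ / n, …)` on the level `n`. -/
noncomputable def scaledFun (g : Gam) (n : ℕ) : Level n → ℝ := fun l => scaledEval n l.1 g

/-- The function `g(l₁, l₂, …)` on the level `n`. -/
noncomputable def levelFun (g : Gam) (n : ℕ) : Level n → ℝ := fun l => evalAt l.1 g

theorem eventuallyBounded_scaledFun (g : Gam) : EventuallyBounded (scaledFun g) := by
  obtain ⟨c, hc⟩ := exists_abs_scaledEval_le g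
  exact ⟨|c|, Eventually.of_forall fun n => (pi_norm_le_iff_of_nonneg (abs_nonneg c)).2
    fun l => (hc n l).trans (le_abs_self c)⟩

theorem tendsto_inv_pow_mul_pow {s k : ℕ} (h : s < k) :
    Tendsto (fun n : ℕ => ((n : ℝ) ^ k)⁻¹ * (n : ℝ) ^ s) atTop (𝓝 0) := by
  have h1 : Tendsto (fun n : ℕ => ((n : ℝ) ^ (k - s))⁻¹) atTop (𝓝 0) :=
    ((tendsto_pow_atTop (by omega)).comp tendsto_natCast_atTop_atTop).inv_tendsto_atTop
  refine h1.congr' ?_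
  filter_upwards [eventually_ne_atTop 0] with n hn
  have hn' : (n : ℝ) ≠ 0 := Nat.cast_ne_zero.2 hn
  obtain ⟨d, rfl⟩ := Nat.exists_eq_add_of_le h.le
  rw [Nat.add_sub_cancel_left, pow_add]
  field_simp

theorem levelFun_listQ {n : ℕ} (hn : n ≠ 0) (L : List ℕ) :
    levelFun (listQ L) n = (n : ℝ) ^ L.sum • scaledFun (listQ L) n := by
  have hn' : (n : ℝ) ≠ 0 := Nat.cast_ne_zero.2 hn
  funext l
  rw [Pi.smul_apply, levelFun, scaledFun, scaledEval_listQ, smul_eq_mul,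
    mul_inv_cancel_left₀ (pow_ne_zero _ hn')]

theorem levelFun_add (g h : Gam) (n : ℕ) : levelFun (g + h) n = levelFun g n + levelFun h n := by
  funext l
  exact map_add _ _ _

theorem levelFun_smul (c : ℝ) (g : Gam) (n : ℕ) : levelFun (c • g) n = c • levelFun g n := by
  funext l
  exact map_smul _ _ _

theorem levelFun_zero (n : ℕ) : levelFun 0 n = 0 := by
  funext l
  exact map_zero _

theorem scaledFun_add (g h : Gam) (n : ℕ) :
    scaledFun (g + h) n = scaledFun g n + scaledFun h n := by
  funext l
  exact map_add _ _ _

theorem scaledFun_smul (c : ℝ) (g : Gam) (n : ℕ) : scaledFun (c • g) n = c • scaledFun g n := by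
  funext l
  exact map_smul _ _ _

/-- By homogeneity, $Q_L$ without rescaling is of order at most $n^{|L|}$ on level $n$, and here
$|L|<k$. -/
theorem negligible_levelFun {p : ℕ → Prop} {k : ℕ} {w : Gam} (hw : w ∈ lowSpan p k) :
    Negligible fun n => ((n : ℝ) ^ k)⁻¹ • levelFun w n := by
  refine Submodule.span_induction ?_ ?_ ?_ ?_ hw
  · rintro _ ⟨L, -, hL, rfl⟩
    refine Negligible.congr ((eventuallyBounded_scaledFun (listQ L)).smul_negligible
      (tendsto_inv_pow_mul_pow hL)) ?_
    filter_upwards [eventually_ne_atTop 0] with n hn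
    rw [levelFun_listQ hn, smul_smul]
  · simp only [levelFun_zero, smul_zero]
    exact negligible_zero
  · intro x y _ _ hx hy
    simp only [levelFun_add, smul_add]
    exact hx.add hy
  · intro c x _ hx
    simp only [levelFun_smul, smul_comm _ c]
    exact hx.const_smul c

end Negligible

section Convergence

variable {α : ℝ}

/-- The rescaled generators of the Markov chains converge on `Q`-functions. -/
theorem negligible_schurQ (hα : 0 < α) (μ : StrictPartition) :
    Negligible fun n => scaledFun (gamOp α (schurQ μ)) n -
      (n : ℝ) ^ 2 • (transOp α n - 1) (scaledFun (schurQ μ) n) := by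
  induction hm : μ.weight using Nat.strong_induction_on generalizing μ with
  | _ m ih =>
    have hpos : ∀ r ∈ μ.toList, r ≠ 0 := fun r hr => μ.ne_zero_of_mem_toList hr
    have hsum : μ.toList.sum = m := by rw [sum_toList, hm]
    -- the terms of lower degree
    have hlow : ∀ w ∈ lowSpan (fun r => r ≠ 0) m, Negligible fun n =>
        ((n : ℝ) ^ m)⁻¹ • (n : ℝ) ^ 2 • (transOp α n - 1) (levelFun w n) := by
      intro w hw
      refine Submodule.span_induction ?_ ?_ ?_ ?_ hw
      · rintro _ ⟨L, hL, hLm, rfl⟩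
        have key : ∀ ν : StrictPartition, ν.weight = L.sum → Negligible fun n =>
            ((n : ℝ) ^ m)⁻¹ • (n : ℝ) ^ 2 • (transOp α n - 1) (levelFun (schurQ ν) n) := by
          intro ν hν
          -- By the induction hypothesis the rescaled generator converges on the smaller $Q_\nu$,
          -- hence is bounded there. The normalization by $n^{-m}$ instead of $n^{-|\nu|}$ then
          -- makes the term tend to zero.
          have hb : EventuallyBounded fun n =>
              (n : ℝ) ^ 2 • (transOp α n - 1) (scaledFun (schurQ ν) n) := by
            have := (eventuallyBounded_scaledFun (gamOp α (schurQ ν))).sub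
              (ih ν.weight (by omega) ν rfl).eventuallyBounded
            simpa only [sub_sub_cancel] using this
          refine Negligible.congr (hb.smul_negligible (tendsto_inv_pow_mul_pow hLm)) ?_
          filter_upwards [eventually_ne_atTop 0] with n hn
          rw [schurQ_eq_listQ, levelFun_listQ hn, sum_toList, hν, map_smul, smul_smul, smul_smul,
            smul_smul]
          congr 1
          ring
        rcases listQ_eq_zero_or_schurQ L hL with h | ⟨ν, hν, h | h⟩
        · rw [h]
          simp only [levelFun_zero, map_zero, smul_zero]
          exact negligible_zero
        · rw [h]
          exact key ν hν
        · have e : listQ L = (-1 : ℝ) • schurQ ν := by rw [h, neg_one_smul]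
          rw [e]
          simp only [levelFun_smul, map_smul, smul_comm _ (-1 : ℝ)]
          exact (key ν hν).const_smul _
      · simp only [levelFun_zero, map_zero, smul_zero]
        exact negligible_zero
      · intro x y _ _ hx hy
        simp only [levelFun_add, map_add, smul_add]
        exact hx.add hy
      · intro c x _ hx
        simp only [levelFun_smul, map_smul, smul_comm _ c]
        exact hx.const_smul c
    -- Decompose $Q^*_\mu=Q_\mu+w$, and its lowered sum into `low` and $z$. The first summands are
    -- homogeneous of degrees $m$ and $m-1$, and the remainders have lower degree.
    set L := μ.toList with hL
    set w := factQ L - listQ L with hw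
    set low := lowerQ α (fun r => Polynomial.X ^ r) L with hlowdef
    set z := lowerQ α (fun r => descPochhammer ℝ r) L - low with hz
    have hwm : ∀ p : ℕ → Prop, (∀ j, j ≠ 0 → p j) → w ∈ lowSpan p m := fun p hp => by
      rw [← hsum]
      exact factQ_sub_listQ_mem hp hpos
    have n1 := hlow w (hwm _ fun _ h => h)
    have n2 := negligible_levelFun (hwm _ fun _ h => h)
    -- The remainder $z$ has degree below $m-1$, which absorbs the extra factor $n$. For $m=0$ this
    -- bound is unavailable, but then $z=0$.
    have n3 : Negligible fun n => (n : ℝ) • ((n : ℝ) ^ m)⁻¹ • levelFun z n := by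
      rcases Nat.eq_zero_or_pos m with h0 | h0
      · have hnil : L = [] := by
          rcases hLc : L with _ | ⟨s, L'⟩
          · rfl
          · have h1 := hpos s (by rw [hLc]; simp)
            rw [hLc, List.sum_cons] at hsum
            omega
        have hz0 : z = 0 := by
          rw [hz, hlowdef, hnil, lowerQ, lowerQ, sub_self]
        rw [hz0]
        simp only [levelFun_zero, smul_zero]
        exact negligible_zero
      · have hzm := lowerQ_sub_mem α hpos
        rw [hsum] at hzm
        refine (negligible_levelFun hzm).congr ?_
        filter_upwards [eventually_ne_atTop 0] with n hn
        have hn' : (n : ℝ) ≠ 0 := Nat.cast_ne_zero.2 hn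
        obtain ⟨m, rfl⟩ := Nat.exists_eq_succ_of_ne_zero h0.ne'
        rw [smul_smul, Nat.succ_eq_add_one, Nat.add_sub_cancel, pow_succ]
        congr 1
        field_simp
    set M : ℝ := (m : ℝ) * (m + α / 2 - 1) with hM
    set a : ℕ → ℝ := fun n => 2 * (n : ℝ) ^ 2 / ((n + 1) * (2 * n + α)) with ha
    -- After multiplication by $n^2$, the exact formula for $T_n-1$ has coefficient $-M\,a_n$ at
    -- $Q^*_\mu$ and $n\,b_n$ at the lowered sum. Both $a_n$ and $b_n$ tend to $1$.
    set b : ℕ → ℝ := fun n => 2 * ((n : ℝ) + 1 - m) * n / ((n + 1) * (2 * n + α)) with hb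
    have hinv : Tendsto (fun n : ℕ => ((n : ℝ))⁻¹) atTop (𝓝 0) :=
      tendsto_inv_atTop_zero.comp tendsto_natCast_atTop_atTop
    have hat : Tendsto a atTop (𝓝 1) := by
      have h : Tendsto (fun n : ℕ => 2 / ((1 + (n : ℝ)⁻¹) * (2 + α * (n : ℝ)⁻¹))) atTop
          (𝓝 (2 / ((1 + 0) * (2 + α * 0)))) :=
        tendsto_const_nhds.div ((tendsto_const_nhds.add hinv).mul
          (tendsto_const_nhds.add (tendsto_const_nhds.mul hinv))) (by norm_num)
      rw [show (2 : ℝ) / ((1 + 0) * (2 + α * 0)) = 1 by norm_num] at h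
      refine h.congr' ?_
      filter_upwards [eventually_ne_atTop 0] with n hn
      have hn' : (n : ℝ) ≠ 0 := Nat.cast_ne_zero.2 hn
      have h1 : 2 * (n : ℝ) + α ≠ 0 := by positivity
      have h2 : (n : ℝ) + 1 ≠ 0 := by positivity
      rw [ha]
      field_simp
    have hbt : Tendsto b atTop (𝓝 1) := by
      have h : Tendsto (fun n : ℕ => a n * (1 + (1 - (m : ℝ)) * (n : ℝ)⁻¹)) atTop
          (𝓝 (1 * (1 + (1 - (m : ℝ)) * 0))) :=
        hat.mul (tendsto_const_nhds.add (tendsto_const_nhds.mul hinv))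
      rw [show (1 : ℝ) * (1 + (1 - (m : ℝ)) * 0) = 1 by ring] at h
      refine h.congr' ?_
      filter_upwards [eventually_ne_atTop 0] with n hn
      have hn' : (n : ℝ) ≠ 0 := Nat.cast_ne_zero.2 hn
      have h1 : 2 * (n : ℝ) + α ≠ 0 := by positivity
      have h2 : (n : ℝ) + 1 ≠ 0 := by positivity
      rw [ha, hb]
      field_simp
      ring
    have hat0 : Tendsto (fun n => M * (a n - 1)) atTop (𝓝 0) := by
      have := (hat.sub_const 1).const_mul M
      rwa [sub_self, mul_zero] at this
    have hbt0 : Tendsto (fun n => 1 - b n) atTop (𝓝 0) := by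
      have := hbt.const_sub 1
      rwa [sub_self] at this
    have t1 := (eventuallyBounded_scaledFun (listQ L)).smul_negligible hat0
    have t2 := (eventuallyBounded_scaledFun low).smul_negligible hbt0
    have t3 := n2.smul (hat.const_mul M)
    have t4 := n3.smul hbt.neg
    -- The error is exactly $M(a_n-1)Q_\mu+(1-b_n)\,\mathrm{low}$ at the rescaled point, plus
    -- $n^{-m}\bigl(Ma_nw-n\,b_nz\bigr)$, plus $n^{-m}n^2(T_n-1)w$.
    refine (((t1.add t2).add (t3.add t4)).add n1).congr ?_
    filter_upwards [eventually_ne_atTop 0] with n hn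
    have hn' : (n : ℝ) ≠ 0 := Nat.cast_ne_zero.2 hn
    have h1 : 2 * (n : ℝ) + α ≠ 0 := by positivity
    have h2 : (n : ℝ) + 1 ≠ 0 := by positivity
    have hnm : (n : ℝ) ^ m ≠ 0 := pow_ne_zero _ hn'
    have e1 : scaledFun (schurQ μ) n =
        ((n : ℝ) ^ m)⁻¹ • (levelFun (factQ L) n - levelFun w n) := by
      have : factQ L = listQ L + w := by rw [hw]; abel
      rw [this, levelFun_add, add_sub_cancel_right, levelFun_listQ hn, hsum, smul_smul,
        inv_mul_cancel₀ hnm, one_smul, schurQ_eq_listQ]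
    have e2 : scaledFun (gamOp α (schurQ μ)) n =
        (-M) • scaledFun (listQ L) n + scaledFun low n := by
      rw [gamOp_schurQ, hm, scaledFun_add, scaledFun_smul, schurQ_eq_listQ]
    rw [e1, e2, map_smul, map_sub]
    funext l
    have e3 := transOp_evalAt_factQ hα n l hpos μ.pairwise_toList
    rw [hsum] at e3
    change (transOp α n - 1) (levelFun (factQ L) n) l = _ at e3
    have e4 : evalAt l.1 (factQ L) =
        (n : ℝ) ^ m * scaledEval n l.1 (listQ L) + evalAt l.1 w := by
      rw [hw, map_sub, scaledEval_listQ, hsum, mul_inv_cancel_left₀ hnm]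
      ring
    have e5 : evalAt l.1 (lowerQ α (fun r => descPochhammer ℝ r) L) =
        (n : ℝ) ^ m * (n : ℝ)⁻¹ * scaledEval n l.1 low + evalAt l.1 z := by
      rw [hz, map_sub, hlowdef, scaledEval_lowerQ α hn _ hpos, hsum]
      field_simp
      ring
    simp only [Pi.add_apply, Pi.sub_apply, Pi.smul_apply, smul_eq_mul, scaledFun]
    rw [e3, e4, e5, hM, ha, hb]
    simp only [levelFun]
    field_simp
    ring

end Convergence

end StrictPartition

/-! ### The moment algebra as a polynomial algebra, and the conclusion. -/

namespace DoublySymmetric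

open MvPolynomial StrictPartition OmegaPlus

section MomentAlgebra

/-- The value of an element of the algebra of moments at a point. -/
noncomputable def momentEval (x : OmegaPlus) : momentAlgebra →ₐ[ℝ] ℝ :=
  (ContinuousMap.evalAlgHom ℝ ℝ x).comp momentAlgebra.val

theorem momentEval_evenMoment_succ (x : OmegaPlus) (k : ℕ) :
    momentEval x (evenMoment (k + 1)) = ∑' i, x.1 i ^ (2 * (k + 1) + 1) := by
  rw [evenMoment, dif_pos (Nat.succ_pos k)]
  rfl

/-- The rule $p_1^\circ=1$ is consistent with evaluation because the parts of $l$ add up to $n$.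
This fails at $n=0$, which does not matter for limits. -/
theorem momentEval_circ {n : ℕ} (hn : n ≠ 0) (l : Level n) (g : Gam) :
    momentEval (iota n l) (circ g) = scaledEval n l.1 g := by
  have : (momentEval (iota n l)).comp circ = scaledEval n l.1 := by
    refine MvPolynomial.algHom_ext fun k => ?_
    rw [AlgHom.comp_apply, circ, aeval_X]
    cases k with
    | zero => rw [scaledEval_X_zero hn, evenMoment, dif_neg (lt_irrefl 0), map_one]
    | succ k =>
      rw [momentEval_evenMoment_succ, tsum_eq_sum (s := l.1.row.support)]
      · simp only [scaledEval, evalOn, aeval_X]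
        refine Finset.sum_congr rfl fun i _ => ?_
        rw [inv_mul_eq_div]
        rfl
      · intro i hi
        change ((l.1.row i : ℝ) / n) ^ _ = 0
        rw [Finsupp.notMem_support_iff.1 hi, Nat.cast_zero, zero_div,
          zero_pow (Nat.succ_ne_zero _)]
  rw [← this]
  rfl

theorem proj_circ {n : ℕ} (hn : n ≠ 0) (g : Gam) :
    proj n (circ g : C(OmegaPlus, ℝ)) = scaledFun g n :=
  funext fun l => momentEval_circ hn l g

/-- The point of the simplex with finitely many given coordinates. -/
theorem exists_omegaPlus {N : ℕ} (y : Fin N → ℝ)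
    (hy : ∀ i : Fin N, ((N : ℝ) - 1 - i) / N ^ 2 ≤ y i ∧ y i ≤ ((N : ℝ) - i) / N ^ 2) :
    ∃ x : OmegaPlus, ∀ m : ℕ, ∑' i, x.1 i ^ (m + 1) = ∑ i : Fin N, y i ^ (m + 1) := by
  have hN : ∀ i : Fin N, (1 : ℝ) ≤ N := fun i => Nat.one_le_cast.2 (by have := i.2; omega)
  have h0 : ∀ i : Fin N, 0 ≤ y i := fun i => by
    refine le_trans (div_nonneg ?_ (by positivity)) (hy i).1
    have : ((i : ℕ) : ℝ) + 1 ≤ N := by exact_mod_cast i.2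
    linarith
  have h1 : ∀ i : Fin N, y i ≤ 1 / N := fun i => by
    have hN := hN i
    refine (hy i).2.trans ?_
    rw [div_le_div_iff₀ (by positivity) (by positivity)]
    have : (0 : ℝ) ≤ (i : ℕ) := Nat.cast_nonneg _
    nlinarith
  set x : ℕ → ℝ := fun i => if h : i < N then y ⟨i, h⟩ else 0 with hx
  have hx0 : ∀ i, 0 ≤ x i := fun i => by
    rw [hx]
    simp only
    split_ifs with h
    · exact h0 _
    · exact le_rfl
  have hsumpow : ∀ m : ℕ, HasSum (fun i => x i ^ (m + 1)) (∑ i : Fin N, y i ^ (m + 1)) := by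
    intro m
    have e : ∑ i : Fin N, y i ^ (m + 1) = ∑ i ∈ Finset.range N, x i ^ (m + 1) := by
      rw [Finset.sum_range]
      refine Finset.sum_congr rfl fun i _ => ?_
      rw [hx]
      simp only
      rw [dif_pos i.2]
    rw [e]
    refine hasSum_sum_of_ne_finset_zero fun i hi => ?_
    rw [hx]
    simp only
    rw [dif_neg (by simpa using hi), zero_pow (Nat.succ_ne_zero _)]
  have hsum : HasSum x (∑ i : Fin N, y i) := by simpa using hsumpow 0
  have hle : ∑ i : Fin N, y i ≤ 1 := by
    refine (Finset.sum_le_sum fun i _ => h1 i).trans ?_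
    rw [Finset.sum_const, Finset.card_univ, Fintype.card_fin, nsmul_eq_mul, mul_one_div]
    exact div_self_le_one _
  refine ⟨⟨x, fun i => ⟨hx0 i, ?_⟩, ?_, hsum.summable, hsum.tsum_eq.trans_le hle⟩,
    fun m => (hsumpow m).tsum_eq⟩
  · exact ((hsum.summable.le_tsum i fun j _ => hx0 j).trans hsum.tsum_eq.le).trans hle
  · refine antitone_nat_of_succ_le fun i => ?_
    -- The intervals are stacked: the upper end of the interval for index $i+1$ is the lower end of
    -- that for $i$, so any choice of coordinates is decreasing. As each is at most $1/N$, the sum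
    -- is at most $1$.
    by_cases h : i + 1 < N
    · have e1 : x (i + 1) = y ⟨i + 1, h⟩ := dif_pos h
      have e2 : x i = y ⟨i, by omega⟩ := dif_pos _
      rw [e1, e2]
      refine (hy _).2.trans (le_trans (le_of_eq ?_) (hy _).1)
      congr 1
      push_cast
      ring
    · have e1 : x (i + 1) = 0 := dif_neg h
      rw [e1]
      exact hx0 i

/-- The moments `q_2, q_4, …` are algebraically independent. -/
theorem aeval_evenMoment_injective :
    Function.Injective (aeval (R := ℝ) fun k : ℕ+ => evenMoment k) := by
  rw [injective_iff_map_eq_zero]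
  intro P hP
  by_contra hne
  obtain ⟨N, hR⟩ := exists_aeval_oddPowerSum_ne_zero (rename (fun k : ℕ+ => (k : ℕ)) P) fun h =>
    hne (rename_injective _ PNat.coe_injective (h.trans (map_zero _).symm))
  set R := aeval (fun m => ∑ i : Fin N, (X i : MvPolynomial (Fin N) ℝ) ^ (2 * m + 1))
    (rename (fun k : ℕ+ => (k : ℕ)) P) with hRdef
  -- A polynomial that vanishes on a product of infinite sets is zero. The product of these
  -- intervals consists of points of the simplex, where the relation among the moments is assumed.
  refine hR (MvPolynomial.funext_set (fun i : Fin N =>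
    Set.Icc (((N : ℝ) - 1 - i) / N ^ 2) (((N : ℝ) - i) / N ^ 2)) (fun i => ?_) fun y hy => ?_)
  · have hN : (1 : ℝ) ≤ N := Nat.one_le_cast.2 (by have := i.2; omega)
    refine Set.Icc_infinite ?_
    rw [div_lt_div_iff_of_pos_right (by positivity)]
    linarith
  · obtain ⟨x, hx⟩ := exists_omegaPlus y fun i => hy i (Set.mem_univ i)
    have h1 : (momentEval x).comp (aeval (R := ℝ) fun k : ℕ+ => evenMoment k) =
        aeval fun k : ℕ+ => ∑ i : Fin N, y i ^ (2 * (k : ℕ) + 1) := by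
      refine MvPolynomial.algHom_ext fun k => ?_
      rw [AlgHom.comp_apply, aeval_X, aeval_X, ← hx]
      obtain ⟨k, rfl⟩ : ∃ j : ℕ, k = j.succPNat := ⟨k.natPred, (PNat.succPNat_natPred k).symm⟩
      exact momentEval_evenMoment_succ x k
    have h2 : eval y R = aeval (fun k : ℕ+ => ∑ i : Fin N, y i ^ (2 * (k : ℕ) + 1)) P := by
      rw [hRdef, aeval_rename, ← coe_aeval_eq_eval, RingHom.coe_coe, ← AlgHom.comp_apply]
      congr 1
      refine MvPolynomial.algHom_ext fun k => ?_
      rw [AlgHom.comp_apply, aeval_X, aeval_X]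
      simp
    rw [h2, ← h1, AlgHom.comp_apply, hP, map_zero, map_zero]

theorem aeval_evenMoment_surjective :
    Function.Surjective (aeval (R := ℝ) fun k : ℕ+ => evenMoment k) := fun f => by
  obtain ⟨g, rfl⟩ := circ_surjective f
  exact ⟨setOne g, (circ_eq_aeval_setOne g).symm⟩

end MomentAlgebra

section Generator

variable (α : ℝ)

theorem gamOp_add (g h : Gam) : gamOp α (g + h) = gamOp α g + gamOp α h := by
  simp only [gamOp, map_add, smul_add]
  abel

theorem gamOp_smul (c : ℝ) (g : Gam) : gamOp α (c • g) = c • gamOp α g := by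
  simp only [gamOp, map_smul, Derivation.map_smul, smul_comm _ c, ← smul_add, ← smul_sub]

/-- The formal generator as a linear map. -/
noncomputable def opLinear : MvPolynomial ℕ+ ℝ →ₗ[ℝ] MvPolynomial ℕ+ ℝ where
  toFun := FormalGenerator.op α
  map_add' P Q := by
    -- Linearity is inherited from `gamOp` through the surjection $p_1\mapsto1$, which avoids
    -- handling the formally infinite sums.
    obtain ⟨g, rfl⟩ := setOne_surjective P
    obtain ⟨h, rfl⟩ := setOne_surjective Q
    rw [← map_add, op_setOne, op_setOne, op_setOne, gamOp_add, map_add]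
  map_smul' c P := by
    obtain ⟨g, rfl⟩ := setOne_surjective P
    rw [← map_smul, op_setOne, op_setOne, gamOp_smul, map_smul, RingHom.id_apply]

/-- The algebra of moments as the polynomial algebra in `q_2, q_4, …`. -/
noncomputable def momentEquiv : MvPolynomial ℕ+ ℝ ≃ₗ[ℝ] momentAlgebra :=
  LinearEquiv.ofBijective (aeval (R := ℝ) fun k : ℕ+ => evenMoment k).toLinearMap
    ⟨aeval_evenMoment_injective, aeval_evenMoment_surjective⟩

theorem momentEquiv_apply (P : MvPolynomial ℕ+ ℝ) :
    momentEquiv P = aeval (fun k : ℕ+ => evenMoment k) P := rfl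

/-- The generator of the limit process on the algebra of moments. -/
noncomputable def generator : momentAlgebra →ₗ[ℝ] momentAlgebra :=
  momentEquiv.toLinearMap ∘ₗ opLinear α ∘ₗ momentEquiv.symm.toLinearMap

theorem generator_aeval (P : MvPolynomial ℕ+ ℝ) :
    generator α (aeval (fun k : ℕ+ => evenMoment k) P) =
      aeval (fun k : ℕ+ => evenMoment k) (FormalGenerator.op α P) := by
  rw [← momentEquiv_apply, ← momentEquiv_apply, generator, LinearMap.comp_apply,
    LinearMap.comp_apply, LinearEquiv.coe_coe, LinearEquiv.coe_coe, LinearEquiv.symm_apply_apply]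
  rfl

theorem generator_circ (g : Gam) : generator α (circ g) = circ (gamOp α g) := by
  rw [circ_eq_aeval_setOne, generator_aeval, op_setOne, ← circ_eq_aeval_setOne]

variable {α}

/-- Both the operator and its approximations are linear, so convergence on the $Q_\mu$ suffices
because they span $\Gamma$. -/
theorem negligible_gam (hα : 0 < α) (g : Gam) :
    Negligible fun n => scaledFun (gamOp α g) n -
      (n : ℝ) ^ 2 • (transOp α n - 1) (scaledFun g n) := by
  have hg : g ∈ Submodule.span ℝ (Set.range schurQ) := by
    rw [span_schurQ]
    exact Submodule.mem_top
  refine Submodule.span_induction ?_ ?_ ?_ ?_ hg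
  · rintro _ ⟨μ, rfl⟩
    exact negligible_schurQ hα μ
  · refine negligible_zero.congr (Eventually.of_forall fun n => ?_)
    have h0 : scaledFun (0 : Gam) n = 0 := funext fun l => map_zero _
    have h1 : gamOp α 0 = 0 := by simpa using gamOp_smul α 0 0
    rw [h1, h0, map_zero, smul_zero, sub_zero]
  · intro x y _ _ hx hy
    refine (hx.add hy).congr (Eventually.of_forall fun n => ?_)
    rw [gamOp_add, scaledFun_add, scaledFun_add, map_add, smul_add]
    abel
  · intro c x _ hx
    refine (hx.const_smul c).congr (Eventually.of_forall fun n => ?_)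
    rw [gamOp_smul, scaledFun_smul, scaledFun_smul, map_smul, smul_sub, smul_comm c]

theorem convergesAlong_generator (hα : 0 < α) (f : momentAlgebra) :
    ConvergesAlong proj
      (fun n => (n : ℝ) ^ 2 • (transOp α n - 1) (proj n (f : C(OmegaPlus, ℝ))))
      (generator α f : C(OmegaPlus, ℝ)) := by
  obtain ⟨g, rfl⟩ := circ_surjective f
  refine Negligible.congr (negligible_gam hα g) ?_
  filter_upwards [eventually_ne_atTop 0] with n hn
  rw [generator_circ, proj_circ hn, proj_circ hn]

theorem generator_circ_schurQ (α : ℝ) (μ : StrictPartition) :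
    generator α (circ (schurQ μ)) =
      (-((μ.weight : ℝ) * ((μ.weight : ℝ) + α / 2 - 1))) • circ (schurQ μ) +
        ∑ y ∈ μ.removable,
          ((y : ℝ) * ((y : ℝ) + 1) + α) • circ (schurQ (μ.removeBox y)) := by
  rw [generator_circ, gamOp_schurQ, lowerQ_toList, map_add, map_smul, map_sum]
  simp only [map_smul]

end Generator

end DoublySymmetric

open StrictPartition OmegaPlus DoublySymmetric in
/-- Here `schurQ μ` is the Schur `Q`-function `Q_μ`, and `circ (schurQ μ)` its image `Q°_μ`. -/
theorem proposition6p8 (α : ℝ) (hα : 0 < α) :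
    (∀ μ : StrictPartition, IsSchurQ μ (schurQ μ)) ∧
    Submodule.span ℝ (Set.range fun μ : StrictPartition => circ (schurQ μ)) = ⊤ ∧
    ∃ A : momentAlgebra →ₗ[ℝ] momentAlgebra,
      (∀ f : momentAlgebra,
        ConvergesAlong proj
          (fun n => (n : ℝ) ^ 2 • (transOp α n - 1) (proj n (f : C(OmegaPlus, ℝ))))
          (A f : C(OmegaPlus, ℝ))) ∧
      (∀ P : MvPolynomial ℕ+ ℝ,
        A (MvPolynomial.aeval (fun k : ℕ+ => evenMoment k) P) =
          MvPolynomial.aeval (fun k : ℕ+ => evenMoment k) (FormalGenerator.op α P)) ∧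
      (∀ μ : StrictPartition,
        A (circ (schurQ μ)) =
          (-((μ.weight : ℝ) * ((μ.weight : ℝ) + α / 2 - 1))) • circ (schurQ μ) +
            ∑ y ∈ μ.removable,
              ((y : ℝ) * ((y : ℝ) + 1) + α) • circ (schurQ (μ.removeBox y))) :=
  ⟨isSchurQ_schurQ, span_circ_schurQ, generator α, convergesAlong_generator hα,
    generator_aeval α, generator_circ_schurQ α⟩
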